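/- Let $K$ be a field and let $0\le n\le \ell$ be integers. Let $H=\mathcal H_{\ell,n}^{(0)}$ be the cyclotomic nilHecke algebra of type $A$: the unital associative $K$-algebra generated by $\psi_1,\dots,\psi_{n-1},y_1,\dots,y_n$ with relations $\psi_r^2=0$; $\psi_r\psi_k=\psi_k\psi_r$ for $k<r-1$; $\psi_r\psi_{r+1}\psi_r=\psi_{r+1}\psi_r\psi_{r+1}$; $y_ry_k=y_ky_r$; $\psi_ry_k=y_k\psi_r$ for $k\ne r,r+1$; $\psi_ry_{r+1}=y_r\psi_r+1$; $y_{r+1}\psi_r=\psi_ry_r+1$; and $y_1^\ell=0$ (no last relation if $n=0$). It is $\mathbb Z$-graded by $\deg\psi_r=-2$, $\deg y_r=2$; let $*$ be the anti-automorphism fixing all generators. "Module" means $\mathbb Z$-graded right $H$-module, isomorphisms have degree $0$, and $M\langle s\rangle_d=M_{d-s}$. For $w\in\mathfrak S_n$ put $\psi_w=\psi_{i_1}\cdots\psi_{i_k}$ for a reduced expression $w=s_{i_1}\cdots s_{i_k}$. Let $\mathscr P_0$ be the set of $\ell$-tuples $\mu$ of partitions having exactly $n$ components equal to $(1)$ and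 the others empty; $\theta(\mu)=(k_1<\dots<k_n)$ lists the positions (in $\{1,\dots,\ell\}$) of the components $(1)$. Write $\lambda>\mu$ if $\theta(\lambda)\ne\theta(\mu)$ and $\theta(\lambda)_i\le\theta(\mu)_i$ for all $i$. Put $y_\mu=y_1^{\ell-k_1}\cdots y_n^{\ell-k_n}$, and let $H^{>\mu}$ be the two-sided ideal generated by the elements $\psi_w^*y_\lambda\psi_u$ with $\lambda>\mu$ and $w,u\in\mathfrak S_n$. The graded Specht module $S^\mu$ is the right submodule of $H/H^{>\mu}$ generated by $y_\mu+H^{>\mu}$, graded so that this generator has degree $n\ell-\sum_i k_i$. It carries the bilinear form determined by $pq^*\equiv\langle p+H^{>\mu},q+H^{>\mu}\rangle\,y_\mu \pmod{H^{>\mu}}$; let $D^\mu$ be the quotient of $S^\mu$ by the radical of this form. Let $\lambda_{\min}\in\mathscr P_0$ have $\theta(\lambda_{\min})=(\ell-n+1,\dots,\ell)$ and put $D_0=D^{\lambda_{\min}}$. Then $D_0$ is a graded simple $H$-module, and every graded simple $H$-module is isomorphic to $D_0\langle s\rangle$ for some $s\in\mathbb Z$. It has a projective cover in the category of graded modules.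 Moreover, for $P_0$ any such projective cover of $D_0$, $$\dim_K D_0=n!,\qquad \dim_K P_0=\binom{\ell}{n}\,n!,$$ and for every $\mu\in\mathscr P_0$ with $\theta(\mu)=(k_1,\dots,k_n)$ there is an isomorphism of graded modules $$S^\mu\;\cong\; D_0\Big\langle n\ell-\frac{n(n-1)}2-\sum_{i=1}^n k_i\Big\rangle .$$ -/

import Mathlib

open MulOpposite

universe u

/-! ### Graded right modules over a `ℤ`-graded algebra

A right `A`-module is a module over `Aᵐᵒᵖ`, with `x · a = op a • x`. -/

section GradedModules

variable {K A : Type u} [Field K] [Ring A] [Algebra K A]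

/-- A `ℤ`-graded right module over the algebra `A` with homogeneous components `𝒜`. -/
structure GradedRightModule (𝒜 : ℤ → Submodule K A) where
  carrier : Type u
  [addCommGroup : AddCommGroup carrier]
  [moduleField : Module K carrier]
  [moduleOp : Module Aᵐᵒᵖ carrier]
  [isScalarTower : IsScalarTower K Aᵐᵒᵖ carrier]
  /-- the homogeneous component of each degree -/
  piece : ℤ → Submodule K carrier
  isInternal : DirectSum.IsInternal piece
  op_smul_mem : ∀ {i j : ℤ} {x : carrier} {a : A},
    x ∈ piece i → a ∈ 𝒜 j → op a • x ∈ piece (i + j)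

namespace GradedRightModule

variable {𝒜 : ℤ → Submodule K A}

instance : CoeSort (GradedRightModule 𝒜) (Type u) := ⟨carrier⟩

instance (M : GradedRightModule 𝒜) : AddCommGroup M := M.addCommGroup
instance (M : GradedRightModule 𝒜) : Module K M := M.moduleField
instance (M : GradedRightModule 𝒜) : Module Aᵐᵒᵖ M := M.moduleOp
instance (M : GradedRightModule 𝒜) : IsScalarTower K Aᵐᵒᵖ M := M.isScalarTower

/-- The module `M⟨s⟩`: the same right module, with `M⟨s⟩_d = M_{d - s}`. -/
def shift (M : GradedRightModule 𝒜) (s : ℤ) : GradedRightModule 𝒜 where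
  carrier := M
  piece d := M.piece (d - s)
  isInternal := by
    have h := M.isInternal
    rw [DirectSum.isInternal_submodule_iff_iSupIndep_and_iSup_eq_top] at h ⊢
    refine ⟨h.1.comp (sub_left_injective (b := s)), ?_⟩
    rw [← h.2]
    exact (Equiv.subRight s).iSup_comp (g := M.piece)
  op_smul_mem := by
    intro i j x a hx ha
    have := M.op_smul_mem hx ha
    rwa [sub_add_eq_add_sub] at this

/-- A homomorphism of right modules that preserves degrees. -/
def IsGradedHom {M N : GradedRightModule 𝒜} (f : M →ₗ[Aᵐᵒᵖ] N) : Prop :=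
  ∀ d, ∀ x ∈ M.piece d, f x ∈ N.piece d

/-- `M` and `N` are isomorphic as graded right modules (through a map of degree `0`). -/
def IsIsomorphic (M N : GradedRightModule 𝒜) : Prop :=
  ∃ e : M ≃ₗ[Aᵐᵒᵖ] N, ∀ d x, x ∈ M.piece d ↔ e x ∈ N.piece d

/-- A right submodule is homogeneous if it is generated by homogeneous elements, that is,
if it is the sum of its intersections with the homogeneous components. -/
def IsHomogeneous {M : GradedRightModule 𝒜} (N : Submodule Aᵐᵒᵖ M) : Prop :=
  N.restrictScalars K ≤ ⨆ d, N.restrictScalars K ⊓ M.piece d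

/-- `M` is a simple object of the category of graded right modules: it is nonzero and has no
homogeneous submodules other than `0` and `M`. -/
def IsGradedSimple (M : GradedRightModule 𝒜) : Prop :=
  Nontrivial M ∧ ∀ N : Submodule Aᵐᵒᵖ M, IsHomogeneous N → N = ⊥ ∨ N = ⊤

/-- `P` is a projective object of the category of graded right modules. -/
def IsGradedProjective (P : GradedRightModule 𝒜) : Prop :=
  ∀ (M N : GradedRightModule 𝒜) (g : M →ₗ[Aᵐᵒᵖ] N) (f : P →ₗ[Aᵐᵒᵖ] N),
    IsGradedHom g → Function.Surjective g → IsGradedHom f →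
      ∃ h : P →ₗ[Aᵐᵒᵖ] M, IsGradedHom h ∧ g ∘ₗ h = f

/-- `P` is a projective cover of `D` in the category of graded right modules: `P` is projective
and maps onto `D` with superfluous kernel. -/
def IsProjectiveCover (P D : GradedRightModule 𝒜) : Prop :=
  IsGradedProjective P ∧ ∃ f : P →ₗ[Aᵐᵒᵖ] D, IsGradedHom f ∧ Function.Surjective f ∧
    ∀ N : Submodule Aᵐᵒᵖ P, IsHomogeneous N → N ⊔ LinearMap.ker f = ⊤ → N = ⊤

/-- A homogeneous submodule, as a graded right module. -/
def sub (M : GradedRightModule 𝒜) (N : Submodule Aᵐᵒᵖ M) (hN : IsHomogeneous N) :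
    GradedRightModule 𝒜 where
  carrier := N
  piece d := (M.piece d).comap (N.subtype.restrictScalars K)
  isInternal := by
    have h := M.isInternal
    rw [DirectSum.isInternal_submodule_iff_iSupIndep_and_iSup_eq_top] at h ⊢
    constructor
    · rw [iSupIndep_iff_finsetSum_eq_zero_imp_eq_zero] at h ⊢
      intro s v hv hs i hi
      have := h.1 s (fun i => (v i : M)) (fun i hi => hv i hi)
        (by simpa using congrArg (N.subtype.restrictScalars K) hs) i hi
      exact Subtype.ext this
    · rw [eq_top_iff]
      rintro ⟨x, hx⟩ -
      have hx' : x ∈ ⨆ d, N.restrictScalars K ⊓ M.piece d := hN hx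
      have key : (⨆ d, N.restrictScalars K ⊓ M.piece d) ≤
          (⨆ d, (M.piece d).comap (N.subtype.restrictScalars K)).map
            (N.subtype.restrictScalars K) := by
        refine iSup_le fun d y hy => ?_
        exact ⟨⟨y, hy.1⟩, Submodule.mem_iSup_of_mem d (show y ∈ M.piece d from hy.2), rfl⟩
      obtain ⟨y, hy, hyx⟩ := key hx'
      have : y = ⟨x, hx⟩ := Subtype.ext hyx
      rwa [← this]
  op_smul_mem := by
    intro i j x a hx ha
    exact M.op_smul_mem (x := (x : M)) hx ha

/-- The quotient by a homogeneous submodule, as a graded right module. -/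
def quot (M : GradedRightModule 𝒜) (N : Submodule Aᵐᵒᵖ M) (hN : IsHomogeneous N) :
    GradedRightModule 𝒜 where
  carrier := M ⧸ N
  piece d := (M.piece d).map (N.mkQ.restrictScalars K)
  isInternal := by
    have h := M.isInternal
    rw [DirectSum.isInternal_submodule_iff_iSupIndep_and_iSup_eq_top] at h ⊢
    constructor
    · rw [iSupIndep_iff_finsetSum_eq_zero_imp_eq_zero] at h ⊢
      intro s v hv hs i hi
      have hv' : ∀ i, ∃ y : M, i ∈ s → y ∈ M.piece i ∧ N.mkQ y = v i := by
        intro i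
        by_cases hi : i ∈ s
        · obtain ⟨y, hy, hyv⟩ := hv i hi
          exact ⟨y, fun _ => ⟨hy, hyv⟩⟩
        · exact ⟨0, fun h => absurd h hi⟩
      choose y hy using hv'
      have hsum : ∑ i ∈ s, y i ∈ N := by
        rw [← Submodule.ker_mkQ N, LinearMap.mem_ker, map_sum, ← hs]
        exact Finset.sum_congr rfl fun i hi => (hy i hi).2
      obtain ⟨z, hz, hzs⟩ := (Submodule.mem_iSup_iff_exists_finsupp _ _).1 (hN hsum)
      have hdiff := h.1 (s ∪ z.support) (fun i => (if i ∈ s then y i else 0) - z i)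
        (fun i _ => by
          refine Submodule.sub_mem _ ?_ (hz i).2
          split_ifs with h'
          · exact (hy i h').1
          · exact Submodule.zero_mem _)
        (by
          rw [Finset.sum_sub_distrib, sub_eq_zero]
          rw [Finset.sum_ite_mem, Finset.union_inter_cancel_left, ← hzs]
          exact Finset.sum_subset Finset.subset_union_right
            (fun i _ h' => Finsupp.notMem_support_iff.1 h'))
        i (Finset.mem_union_left _ hi)
      simp only [hi, if_true, sub_eq_zero] at hdiff
      rw [← (hy i hi).2, hdiff, ← LinearMap.mem_ker, Submodule.ker_mkQ]
      exact (hz i).1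
    · rw [← Submodule.map_iSup, h.2, Submodule.map_top, LinearMap.range_eq_top]
      exact N.mkQ_surjective
  op_smul_mem := by
    rintro i j _ a ⟨y, hy, rfl⟩ ha
    exact ⟨op a • y, M.op_smul_mem hy ha, by simp⟩

end GradedRightModule

end GradedModules

/-! ### The cyclotomic nilHecke algebra -/

namespace CycNilHecke

section Algebra

variable (K : Type u) [Field K] (ℓ n : ℕ)

/-- The generators: `Sum.inl r` is `ψ_{r+1}` (there are `n - 1` of them) and `Sum.inr k` is
`y_{k+1}` (there are `n` of them). -/
abbrev Gen : Type := Fin (n - 1) ⊕ Fin n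

variable {n} in
/-- The free generator `ψ_{r+1}`. -/
abbrev freePsi (r : Fin (n - 1)) : FreeAlgebra K (Gen n) := FreeAlgebra.ι K (Sum.inl r)

variable {n} in
/-- The free generator `y_{k+1}`. -/
abbrev freeY (k : Fin n) : FreeAlgebra K (Gen n) := FreeAlgebra.ι K (Sum.inr k)

/-- The defining relations. Indices start at `0`, so the cyclotomic relation is `y 0 ^ ℓ = 0`. -/
inductive Rel : FreeAlgebra K (Gen n) → FreeAlgebra K (Gen n) → Prop
  | psi_sq (r : Fin (n - 1)) : Rel (freePsi K r * freePsi K r) 0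
  | psi_comm (r k : Fin (n - 1)) (h : k.val + 1 < r.val) :
      Rel (freePsi K r * freePsi K k) (freePsi K k * freePsi K r)
  | psi_braid (r s : Fin (n - 1)) (h : s.val = r.val + 1) :
      Rel (freePsi K r * freePsi K s * freePsi K r) (freePsi K s * freePsi K r * freePsi K s)
  | y_comm (k m : Fin n) : Rel (freeY K k * freeY K m) (freeY K m * freeY K k)
  | psi_y_comm (r : Fin (n - 1)) (k : Fin n) (h : k.val ≠ r.val) (h' : k.val ≠ r.val + 1) :
      Rel (freePsi K r * freeY K k) (freeY K k * freePsi K r)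
  | psi_y_succ (r : Fin (n - 1)) (k m : Fin n) (hk : k.val = r.val) (hm : m.val = r.val + 1) :
      Rel (freePsi K r * freeY K m) (freeY K k * freePsi K r + 1)
  | y_succ_psi (r : Fin (n - 1)) (k m : Fin n) (hk : k.val = r.val) (hm : m.val = r.val + 1) :
      Rel (freeY K m * freePsi K r) (freePsi K r * freeY K k + 1)
  | cyclotomic (k : Fin n) (h : k.val = 0) : Rel (freeY K k ^ ℓ) 0

/-- The cyclotomic nilHecke algebra. -/
def Alg : Type u := RingQuot (Rel K ℓ n)

noncomputable instance : Ring (Alg K ℓ n) := inferInstanceAs (Ring (RingQuot (Rel K ℓ n)))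
noncomputable instance : Algebra K (Alg K ℓ n) :=
  inferInstanceAs (Algebra K (RingQuot (Rel K ℓ n)))

/-- The quotient map from the free algebra. -/
noncomputable def mk : FreeAlgebra K (Gen n) →ₐ[K] Alg K ℓ n := RingQuot.mkAlgHom K (Rel K ℓ n)

variable {n}

/-- The image of a generator. -/
noncomputable def gen (g : Gen n) : Alg K ℓ n := mk K ℓ n (FreeAlgebra.ι K g)

/-- The element `ψ_{r+1}`. -/
noncomputable def psi (r : Fin (n - 1)) : Alg K ℓ n := gen K ℓ (Sum.inl r)

/-- The element `y_{k+1}`. -/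
noncomputable def y (k : Fin n) : Alg K ℓ n := gen K ℓ (Sum.inr k)

/-- `deg ψ_r = -2` and `deg y_k = 2`. -/
def genDeg : Gen n → ℤ := Sum.elim (fun _ => -2) (fun _ => 2)

variable (n)

/-- The homogeneous component of degree `d`: the span of the monomials of degree `d` in the
generators. -/
noncomputable def piece (d : ℤ) : Submodule K (Alg K ℓ n) :=
  Submodule.span K {x | ∃ w : List (Gen n), (w.map genDeg).sum = d ∧ (w.map (gen K ℓ)).prod = x}

variable {K ℓ n}

theorem mk_rel {a b : FreeAlgebra K (Gen n)} (h : Rel K ℓ n a b) : mk K ℓ n a = mk K ℓ n b :=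
  RingQuot.mkAlgHom_rel K h

/-- Construct an algebra map out of the cyclotomic nilHecke algebra from its values on the
generators. -/
noncomputable def lift {B : Type*} [Ring B] [Algebra K B] (f : Gen n → B)
    (h : ∀ ⦃a b⦄, Rel K ℓ n a b → FreeAlgebra.lift K f a = FreeAlgebra.lift K f b) :
    Alg K ℓ n →ₐ[K] B :=
  RingQuot.liftAlgHom K ⟨FreeAlgebra.lift K f, h⟩

theorem lift_gen {B : Type*} [Ring B] [Algebra K B] (f : Gen n → B)
    (h : ∀ ⦃a b⦄, Rel K ℓ n a b → FreeAlgebra.lift K f a = FreeAlgebra.lift K f b) (g : Gen n) :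
    lift f h (gen K ℓ g) = f g := by
  have := RingQuot.liftAlgHom_mkAlgHom_apply K (FreeAlgebra.lift K f) h (FreeAlgebra.ι K g)
  rw [FreeAlgebra.lift_ι_apply] at this
  exact this

theorem mk_ι (g : Gen n) : mk K ℓ n (FreeAlgebra.ι K g) = gen K ℓ g := rfl

/-- The anti-automorphism `*` fixing the generators, as a map to the opposite algebra. -/
noncomputable def antiInvolution : Alg K ℓ n →ₐ[K] (Alg K ℓ n)ᵐᵒᵖ :=
  lift (fun g => op (gen K ℓ g)) (by
    intro a b h
    cases h with
    | psi_sq r =>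
      have := mk_rel (Rel.psi_sq (K := K) (ℓ := ℓ) r)
      simp only [map_mul, map_zero, FreeAlgebra.lift_ι_apply, mk_ι] at this ⊢
      simpa [← op_mul] using congrArg op this
    | psi_comm r k h =>
      have := mk_rel (Rel.psi_comm (K := K) (ℓ := ℓ) r k h)
      simp only [map_mul, FreeAlgebra.lift_ι_apply, mk_ι] at this ⊢
      simpa [← op_mul] using congrArg op this.symm
    | psi_braid r s h =>
      have := mk_rel (Rel.psi_braid (K := K) (ℓ := ℓ) r s h)
      simp only [map_mul, FreeAlgebra.lift_ι_apply, mk_ι] at this ⊢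
      simpa [← op_mul, mul_assoc] using congrArg op this
    | y_comm k m =>
      have := mk_rel (Rel.y_comm (K := K) (ℓ := ℓ) k m)
      simp only [map_mul, FreeAlgebra.lift_ι_apply, mk_ι] at this ⊢
      simpa [← op_mul] using congrArg op this.symm
    | psi_y_comm r k h h' =>
      have := mk_rel (Rel.psi_y_comm (K := K) (ℓ := ℓ) r k h h')
      simp only [map_mul, FreeAlgebra.lift_ι_apply, mk_ι] at this ⊢
      simpa [← op_mul] using congrArg op this.symm
    | psi_y_succ r k m hk hm =>
      have := mk_rel (Rel.y_succ_psi (K := K) (ℓ := ℓ) r k m hk hm)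
      simp only [map_mul, map_add, map_one, FreeAlgebra.lift_ι_apply, mk_ι] at this ⊢
      simpa [← op_mul] using congrArg op this
    | y_succ_psi r k m hk hm =>
      have := mk_rel (Rel.psi_y_succ (K := K) (ℓ := ℓ) r k m hk hm)
      simp only [map_mul, map_add, map_one, FreeAlgebra.lift_ι_apply, mk_ι] at this ⊢
      simpa [← op_mul] using congrArg op this
    | cyclotomic k h =>
      have := mk_rel (Rel.cyclotomic (K := K) (ℓ := ℓ) k h)
      simp only [map_pow, map_zero, FreeAlgebra.lift_ι_apply, mk_ι] at this ⊢
      simpa [← op_pow] using congrArg op this)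

/-- The element `x^*`. -/
noncomputable def inv (x : Alg K ℓ n) : Alg K ℓ n := unop (antiInvolution x)

theorem inv_gen (g : Gen n) : inv (gen K ℓ g) = gen K ℓ g := by
  rw [inv, antiInvolution, lift_gen, unop_op]

theorem inv_mul (a b : Alg K ℓ n) : inv (a * b) = inv b * inv a := by simp [inv]
theorem inv_one : inv (1 : Alg K ℓ n) = 1 := by simp [inv]
theorem inv_zero : inv (0 : Alg K ℓ n) = 0 := by simp [inv]
theorem inv_add (a b : Alg K ℓ n) : inv (a + b) = inv a + inv b := by simp [inv]
theorem inv_neg (a : Alg K ℓ n) : inv (-a) = -inv a := by simp [inv]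
theorem inv_smul (c : K) (a : Alg K ℓ n) : inv (c • a) = c • inv a := by simp [inv]

theorem inv_prod (w : List (Gen n)) :
    inv ((w.map (gen K ℓ)).prod) = ((w.reverse).map (gen K ℓ)).prod := by
  induction w with
  | nil => simp [inv_one]
  | cons g w ih => simp [inv_mul, inv_gen, ih]

theorem prod_mem_piece (w : List (Gen n)) :
    (w.map (gen K ℓ)).prod ∈ piece K ℓ n (w.map genDeg).sum :=
  Submodule.subset_span ⟨w, rfl, rfl⟩

theorem gen_mem_piece (g : Gen n) : gen K ℓ g ∈ piece K ℓ n (genDeg g) := by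
  simpa using prod_mem_piece (K := K) (ℓ := ℓ) [g]

theorem one_mem_piece : (1 : Alg K ℓ n) ∈ piece K ℓ n 0 := by
  simpa using prod_mem_piece (K := K) (ℓ := ℓ) ([] : List (Gen n))

theorem mul_mem_piece {i j : ℤ} {a b : Alg K ℓ n} (ha : a ∈ piece K ℓ n i)
    (hb : b ∈ piece K ℓ n j) : a * b ∈ piece K ℓ n (i + j) := by
  have : piece K ℓ n i * piece K ℓ n j ≤ piece K ℓ n (i + j) := by
    rw [piece, piece, Submodule.span_mul_span, piece]
    refine Submodule.span_mono ?_
    rintro _ ⟨_, ⟨w, rfl, rfl⟩, _, ⟨v, rfl, rfl⟩, rfl⟩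
    exact ⟨w ++ v, by simp, by simp⟩
  exact this (Submodule.mul_mem_mul ha hb)

theorem inv_mem_piece {d : ℤ} {a : Alg K ℓ n} (ha : a ∈ piece K ℓ n d) :
    inv a ∈ piece K ℓ n d := by
  induction ha using Submodule.span_induction with
  | mem x hx =>
    obtain ⟨w, rfl, rfl⟩ := hx
    rw [inv_prod]
    refine Submodule.subset_span ⟨w.reverse, ?_, rfl⟩
    rw [List.map_reverse, List.sum_reverse]
  | zero => simp [inv_zero]
  | add x z _ _ hx hz => rw [inv_add]; exact Submodule.add_mem _ hx hz
  | smul c x _ hx => rw [inv_smul]; exact Submodule.smul_mem _ _ hx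

/-- The algebra is spanned by the monomials in the generators. -/
theorem iSup_piece : ⨆ d, piece K ℓ n d = ⊤ := by
  rw [eq_top_iff]
  rintro x -
  obtain ⟨a, rfl⟩ := RingQuot.mkAlgHom_surjective K (Rel K ℓ n) x
  change mk K ℓ n a ∈ _
  induction a using FreeAlgebra.induction with
  | grade0 c =>
    rw [AlgHom.commutes, Algebra.algebraMap_eq_smul_one]
    exact Submodule.smul_mem _ _ (Submodule.mem_iSup_of_mem 0 one_mem_piece)
  | grade1 g => exact Submodule.mem_iSup_of_mem _ (gen_mem_piece g)
  | add a b ha hb => rw [map_add]; exact Submodule.add_mem _ ha hb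
  | mul a b ha hb =>
    rw [map_mul]
    have : (⨆ d, piece K ℓ n d) * (⨆ d, piece K ℓ n d) ≤ ⨆ d, piece K ℓ n d := by
      rw [Submodule.iSup_mul]
      refine iSup_le fun i => ?_
      rw [Submodule.mul_iSup]
      refine iSup_le fun j => Submodule.mul_le.2 fun a ha b hb => ?_
      exact Submodule.mem_iSup_of_mem _ (mul_mem_piece ha hb)
    exact this (Submodule.mul_mem_mul ha hb)

/-- The map sending a homogeneous element `x` of degree `d` to `x T^d`. -/
noncomputable def coaction : Alg K ℓ n →ₐ[K] AddMonoidAlgebra (Alg K ℓ n) ℤ :=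
  lift (fun g => AddMonoidAlgebra.single (genDeg g) (gen K ℓ g)) (by
    intro a b h
    have key := mk_rel h
    cases h <;>
    simp only [map_mul, map_add, map_one, map_pow, map_zero, FreeAlgebra.lift_ι_apply, mk_ι,
      AddMonoidAlgebra.single_mul_single, AddMonoidAlgebra.single_pow, genDeg, Sum.elim_inl,
      Sum.elim_inr, AddMonoidAlgebra.one_def] at key ⊢ <;>
    rw [key] <;> (try simp only [AddMonoidAlgebra.single_add, AddMonoidAlgebra.single_zero]) <;> rfl)

theorem coaction_of_mem {d : ℤ} {a : Alg K ℓ n} (ha : a ∈ piece K ℓ n d) :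
    coaction a = AddMonoidAlgebra.single d a := by
  induction ha using Submodule.span_induction with
  | mem x hx =>
    obtain ⟨w, rfl, rfl⟩ := hx
    induction w with
    | nil =>
      simp only [List.map_nil, List.prod_nil, List.sum_nil, map_one, AddMonoidAlgebra.one_def]
    | cons g w ih =>
      simp only [List.map_cons, List.prod_cons, List.sum_cons, map_mul, ih]
      rw [coaction, lift_gen, AddMonoidAlgebra.single_mul_single]
  | zero => simp only [map_zero, AddMonoidAlgebra.single_zero]
  | add x z _ _ hx hz => rw [map_add, hx, hz, AddMonoidAlgebra.single_add]
  | smul c x _ hx => rw [map_smul, hx, AddMonoidAlgebra.smul_single]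

theorem isInternal_piece : DirectSum.IsInternal (piece K ℓ n) := by
  rw [DirectSum.isInternal_submodule_iff_iSupIndep_and_iSup_eq_top]
  refine ⟨?_, iSup_piece⟩
  rw [iSupIndep_iff_finsetSum_eq_zero_imp_eq_zero]
  intro s v hv hs i hi
  have h := congrArg coaction hs
  rw [map_sum, map_zero, Finset.sum_congr rfl fun j hj => coaction_of_mem (hv j hj)] at h
  have h2 := congrArg (fun f => f.coeff i) h
  simpa only [AddMonoidAlgebra.coeff_sum, AddMonoidAlgebra.coeff_single, Finsupp.finsetSum_apply,
    Finsupp.single_apply, Finset.sum_ite_eq', hi, if_true, AddMonoidAlgebra.coeff_zero,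
    Finsupp.zero_apply] using h2

/-- The scalars of the field and the right multiplications are compatible. -/
instance : IsScalarTower K (Alg K ℓ n)ᵐᵒᵖ (Alg K ℓ n) :=
  ⟨fun c a x => by
    rw [← op_unop a, ← op_smul, op_smul_eq_mul, op_smul_eq_mul, mul_smul_comm]⟩

variable (K ℓ n) in
/-- The algebra as a graded right module over itself. -/
noncomputable def regular : GradedRightModule (piece K ℓ n) where
  carrier := Alg K ℓ n
  piece := piece K ℓ n
  isInternal := isInternal_piece
  op_smul_mem := fun hx ha => mul_mem_piece hx ha

/-! ### Multipartitions and the cellular ideals -/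

variable (ℓ n) in
/-- The `ℓ`-tuples of partitions with `n` components equal to `(1)` and all others empty, encoded
by the set of positions (starting at `0`) of the components equal to `(1)`. -/
def Multipartition : Type := {s : Finset (Fin ℓ) // s.card = n}

/-- The entries `1 ≤ k_1 < ⋯ < k_n ≤ ℓ` of `θ(μ)`. -/
def theta (μ : Multipartition ℓ n) (i : Fin n) : ℕ := (μ.1.orderEmbOfFin μ.2 i).val + 1

/-- The dominance order `μ < lam`: the components `(1)` of `lam` stand further to the left. -/
def Dominates (lam μ : Multipartition ℓ n) : Prop :=
  (∀ i, theta lam i ≤ theta μ i) ∧ theta lam ≠ theta μ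

variable (n) in
/-- The multipartition `(∅, …, ∅, (1), …, (1))`. -/
def lamMin (h : n ≤ ℓ) : Multipartition ℓ n :=
  ⟨Finset.univ.filter fun j => ℓ - n ≤ j.val, by
    have hc : (Finset.univ.filter fun j : Fin ℓ => ℓ - n ≤ j.val) =
        Finset.univ.image fun i : Fin n => (⟨ℓ - n + i.val, by omega⟩ : Fin ℓ) := by
      ext j
      simp only [Finset.mem_filter, Finset.mem_univ, true_and, Finset.mem_image]
      constructor
      · intro hj
        exact ⟨⟨j.val - (ℓ - n), by omega⟩, Fin.ext (by simp only; omega)⟩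
      · rintro ⟨i, rfl⟩
        simp only; omega
    rw [hc, Finset.card_image_of_injective, Finset.card_univ, Fintype.card_fin]
    intro i j hij
    have := congrArg Fin.val hij
    exact Fin.ext (by simp only at this; omega)⟩

variable (K) in
/-- `y_μ = y_1^{ℓ - k_1} ⋯ y_n^{ℓ - k_n}` where `θ(μ) = (k_1, …, k_n)`. -/
noncomputable def yElt (μ : Multipartition ℓ n) : Alg K ℓ n :=
  (List.ofFn fun i => y K ℓ i ^ (ℓ - theta μ i)).prod

/-- The permutation `s_{i_1} ⋯ s_{i_k}` of the word `i_1, …, i_k`, where `s_r = (r, r + 1)`. -/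
def permOfWord (w : List (Fin (n - 1))) : Equiv.Perm (Fin n) :=
  (w.map fun r => Equiv.swap (⟨r.val, by omega⟩ : Fin n) ⟨r.val + 1, by omega⟩).prod

/-- The word is a reduced expression of its permutation. -/
def IsReduced (w : List (Fin (n - 1))) : Prop :=
  ∀ v : List (Fin (n - 1)), permOfWord v = permOfWord w → w.length ≤ v.length

variable (K ℓ) in
/-- `ψ_{i_1} ⋯ ψ_{i_k}`; for a reduced expression of `w` this is `ψ_w`. -/
noncomputable def psiWord (w : List (Fin (n - 1))) : Alg K ℓ n := (w.map (psi K ℓ)).prod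

variable (K) in
/-- The elements `ψ_w^* y_lam ψ_u` with `lam > μ`. -/
def cellularElts (μ : Multipartition ℓ n) : Set (Alg K ℓ n) :=
  {x | ∃ (lam : Multipartition ℓ n) (w u : List (Fin (n - 1))), Dominates lam μ ∧
    IsReduced w ∧ IsReduced u ∧ inv (psiWord K ℓ w) * yElt K lam * psiWord K ℓ u = x}

variable (K) in
/-- The two-sided ideal of all elements above `μ`. -/
noncomputable def cellIdeal (μ : Multipartition ℓ n) : TwoSidedIdeal (Alg K ℓ n) :=
  TwoSidedIdeal.span (cellularElts K μ)

variable (K) in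
/-- The ideal above `μ`, as a submodule of the right regular module. -/
noncomputable def cellSubmodule (μ : Multipartition ℓ n) : Submodule (Alg K ℓ n)ᵐᵒᵖ (Alg K ℓ n) where
  carrier := {x | x ∈ cellIdeal K μ}
  add_mem' := fun hx hz => (cellIdeal K μ).add_mem hx hz
  zero_mem' := (cellIdeal K μ).zero_mem
  smul_mem' := fun a x hx => (cellIdeal K μ).mul_mem_right x a.unop hx

theorem mem_cellSubmodule {μ : Multipartition ℓ n} {x : Alg K ℓ n} :
    x ∈ cellSubmodule K μ ↔ x ∈ cellIdeal K μ := Iff.rfl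

theorem exists_mem_piece_prod (w : List (Alg K ℓ n)) (h : ∀ x ∈ w, ∃ d, x ∈ piece K ℓ n d) :
    ∃ d, w.prod ∈ piece K ℓ n d := by
  induction w with
  | nil => exact ⟨0, by simpa using one_mem_piece⟩
  | cons a w ih =>
    obtain ⟨i, hi⟩ := h a (by simp)
    obtain ⟨j, hj⟩ := ih fun x hx => h x (by simp [hx])
    exact ⟨i + j, by simpa using mul_mem_piece hi hj⟩

theorem pow_mem_piece {d : ℤ} {a : Alg K ℓ n} (ha : a ∈ piece K ℓ n d) (k : ℕ) :
    ∃ e, a ^ k ∈ piece K ℓ n e := by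
  have := exists_mem_piece_prod (List.replicate k a) (by
    intro x hx
    rw [List.eq_of_mem_replicate hx]
    exact ⟨d, ha⟩)
  simpa using this

theorem yElt_mem_piece (μ : Multipartition ℓ n) : ∃ d, yElt K μ ∈ piece K ℓ n d := by
  refine exists_mem_piece_prod _ fun x hx => ?_
  obtain ⟨i, rfl⟩ := List.mem_ofFn.1 hx
  exact pow_mem_piece (gen_mem_piece (Sum.inr i)) _

theorem psiWord_mem_piece (w : List (Fin (n - 1))) : ∃ d, psiWord K ℓ w ∈ piece K ℓ n d := by
  refine exists_mem_piece_prod _ fun x hx => ?_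
  obtain ⟨i, -, rfl⟩ := List.mem_map.1 hx
  exact ⟨_, gen_mem_piece (Sum.inl i)⟩

theorem cellSubmodule_isHomogeneous (μ : Multipartition ℓ n) :
    GradedRightModule.IsHomogeneous (M := regular K ℓ n) (cellSubmodule K μ) := by
  set J : Submodule K (Alg K ℓ n) :=
    ⨆ d, (cellSubmodule K μ).restrictScalars K ⊓ piece K ℓ n d with hJ
  have hl : ∀ a x, x ∈ J → a * x ∈ J := by
    intro a x hx
    have ha : a ∈ ⨆ d, piece K ℓ n d := iSup_piece (K := K) ▸ Submodule.mem_top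
    have hle : (⨆ d, piece K ℓ n d) * J ≤ J := by
      rw [hJ, Submodule.iSup_mul]
      refine iSup_le fun i => ?_
      rw [Submodule.mul_iSup]
      refine iSup_le fun j => Submodule.mul_le.2 fun b hb z hz => ?_
      exact Submodule.mem_iSup_of_mem (i + j)
        ⟨(cellIdeal K μ).mul_mem_left b z hz.1, mul_mem_piece hb hz.2⟩
    exact hle (Submodule.mul_mem_mul ha hx)
  have hr : ∀ a x, x ∈ J → x * a ∈ J := by
    intro a x hx
    have ha : a ∈ ⨆ d, piece K ℓ n d := iSup_piece (K := K) ▸ Submodule.mem_top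
    have hle : J * (⨆ d, piece K ℓ n d) ≤ J := by
      rw [hJ, Submodule.iSup_mul]
      refine iSup_le fun i => ?_
      rw [Submodule.mul_iSup]
      refine iSup_le fun j => Submodule.mul_le.2 fun z hz b hb => ?_
      exact Submodule.mem_iSup_of_mem (i + j)
        ⟨(cellIdeal K μ).mul_mem_right z b hz.1, mul_mem_piece hz.2 hb⟩
    exact hle (Submodule.mul_mem_mul hx ha)
  intro x hx
  change x ∈ J
  have hx' : x ∈ TwoSidedIdeal.span (cellularElts K μ) := hx
  clear hx
  induction hx' using TwoSidedIdeal.span_induction with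
  | mem x h =>
    have hmem : x ∈ cellIdeal K μ := TwoSidedIdeal.subset_span h
    obtain ⟨lam, w, u, -, -, -, rfl⟩ := h
    obtain ⟨i, hi⟩ := psiWord_mem_piece (K := K) (ℓ := ℓ) w
    obtain ⟨j, hj⟩ := yElt_mem_piece (K := K) lam
    obtain ⟨k, hk⟩ := psiWord_mem_piece (K := K) (ℓ := ℓ) u
    have hJle : (cellSubmodule K μ).restrictScalars K ⊓ piece K ℓ n (i + j + k) ≤ J :=
      le_iSup (fun d => (cellSubmodule K μ).restrictScalars K ⊓ piece K ℓ n d) (i + j + k)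
    exact hJle ⟨hmem, mul_mem_piece (mul_mem_piece (inv_mem_piece hi) hj) hk⟩
  | zero => exact Submodule.zero_mem _
  | add x z _ _ hx hz => exact Submodule.add_mem _ hx hz
  | neg x _ hx => exact Submodule.neg_mem _ hx
  | left_absorb a x _ hx => exact hl a x hx
  | right_absorb a x _ hx => exact hr a x hx

theorem y_commute (k m : Fin n) : Commute (y K ℓ k) (y K ℓ m) := by
  have := mk_rel (Rel.y_comm (K := K) (ℓ := ℓ) k m)
  rw [map_mul, map_mul] at this
  exact this

theorem inv_pow (a : Alg K ℓ n) (k : ℕ) : inv (a ^ k) = inv a ^ k := by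
  simp [inv]

theorem inv_listProd (w : List (Alg K ℓ n)) : inv w.prod = (w.map inv).reverse.prod := by
  induction w with
  | nil => simp [inv_one]
  | cons a w ih => simp [inv_mul, ih]

theorem inv_inv (a : Alg K ℓ n) : inv (inv a) = a := by
  have ha : a ∈ ⨆ d, piece K ℓ n d := iSup_piece (K := K) ▸ Submodule.mem_top
  induction ha using Submodule.iSup_induction' with
  | mem d x hx =>
    induction hx using Submodule.span_induction with
    | mem x hx =>
      obtain ⟨w, -, rfl⟩ := hx
      rw [inv_prod, inv_prod, List.reverse_reverse]
    | zero => rw [inv_zero, inv_zero]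
    | add x z _ _ hx hz => rw [inv_add, inv_add, hx, hz]
    | smul c x _ hx => rw [inv_smul, inv_smul, hx]
  | zero => rw [inv_zero, inv_zero]
  | add x z _ _ hx hz => rw [inv_add, inv_add, hx, hz]

theorem inv_yElt (μ : Multipartition ℓ n) : inv (yElt K μ) = yElt K μ := by
  rw [yElt, inv_listProd, List.map_ofFn]
  have : (inv ∘ fun i => y K ℓ i ^ (ℓ - theta μ i)) = fun i => y K ℓ i ^ (ℓ - theta μ i) := by
    funext i
    simp only [Function.comp_apply, inv_pow, y, inv_gen]
  rw [this]
  refine (List.reverse_perm _).prod_eq' ?_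
  rw [List.pairwise_reverse, List.pairwise_ofFn]
  exact fun i j _ => (y_commute j i).pow_pow _ _

theorem inv_mem_cellIdeal {μ : Multipartition ℓ n} {x : Alg K ℓ n} (hx : x ∈ cellIdeal K μ) :
    inv x ∈ cellIdeal K μ := by
  have hx' : x ∈ TwoSidedIdeal.span (cellularElts K μ) := hx
  clear hx
  induction hx' using TwoSidedIdeal.span_induction with
  | mem x h =>
    obtain ⟨lam, w, u, h, hw, hu, rfl⟩ := h
    refine TwoSidedIdeal.subset_span ⟨lam, u, w, h, hu, hw, ?_⟩
    rw [inv_mul, inv_mul, inv_inv, inv_yElt, mul_assoc]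
  | zero => rw [inv_zero]; exact zero_mem _
  | add x z _ _ hx hz => rw [inv_add]; exact add_mem hx hz
  | neg x _ hx => rw [inv_neg]; exact neg_mem hx
  | left_absorb a x _ hx => rw [inv_mul]; exact (cellIdeal K μ).mul_mem_right _ _ hx
  | right_absorb a x _ hx => rw [inv_mul]; exact (cellIdeal K μ).mul_mem_left _ _ hx

/-! ### Specht modules and their simple heads -/

variable (K) in
/-- The quotient of the algebra by the ideal above `μ`, as a graded right module. -/
noncomputable def cellQuot (μ : Multipartition ℓ n) : GradedRightModule (piece K ℓ n) :=
  (regular K ℓ n).quot (cellSubmodule K μ) (cellSubmodule_isHomogeneous μ)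

variable (K) in
/-- The residue class of an element modulo the ideal above `μ`. -/
noncomputable def residue (μ : Multipartition ℓ n) :
    Alg K ℓ n →ₗ[(Alg K ℓ n)ᵐᵒᵖ] cellQuot K μ :=
  (cellSubmodule K μ).mkQ

theorem residue_eq_zero {μ : Multipartition ℓ n} {p : Alg K ℓ n} :
    residue K μ p = 0 ↔ p ∈ cellIdeal K μ :=
  (Submodule.Quotient.mk_eq_zero (cellSubmodule K μ)).trans mem_cellSubmodule

theorem residue_mem_piece {μ : Multipartition ℓ n} {p : Alg K ℓ n} {d : ℤ}
    (hp : p ∈ piece K ℓ n d) : residue K μ p ∈ (cellQuot K μ).piece d :=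
  ⟨p, hp, rfl⟩

/-- A submodule generated by a homogeneous element is homogeneous. -/
theorem span_isHomogeneous {M : GradedRightModule (piece K ℓ n)} {x : M} {d : ℤ}
    (hx : x ∈ M.piece d) :
    GradedRightModule.IsHomogeneous (Submodule.span (Alg K ℓ n)ᵐᵒᵖ {x}) := by
  intro z hz
  obtain ⟨a, rfl⟩ := Submodule.mem_span_singleton.1 hz
  have ha : unop a ∈ ⨆ d, piece K ℓ n d := iSup_piece (K := K) ▸ Submodule.mem_top
  rw [← op_unop a]
  clear hz
  generalize unop a = b at ha
  induction ha using Submodule.iSup_induction' with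
  | mem e b hb =>
    exact Submodule.mem_iSup_of_mem (d + e)
      ⟨Submodule.smul_mem _ _ (Submodule.mem_span_singleton_self x), M.op_smul_mem hx hb⟩
  | zero => rw [op_zero, zero_smul]; exact Submodule.zero_mem _
  | add b c _ _ hb hc => rw [op_add, add_smul]; exact Submodule.add_mem _ hb hc

variable (K) in
/-- The graded Specht module `S^μ`: the right submodule generated by the class of `y_μ` in the
quotient by the ideal above `μ`, with the grading in which that class, which has degree
`deg y_μ = 2 (n ℓ - ∑ k_i)` in the quotient, has degree `n ℓ - ∑ k_i`. -/
noncomputable def specht (μ : Multipartition ℓ n) : GradedRightModule (piece K ℓ n) :=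
  ((cellQuot K μ).sub (Submodule.span (Alg K ℓ n)ᵐᵒᵖ {residue K μ (yElt K μ)})
    (span_isHomogeneous (residue_mem_piece (yElt_mem_piece μ).choose_spec))).shift
      (-((n : ℤ) * ℓ - ∑ i, (theta μ i : ℤ)))

variable (K) in
/-- The inclusion of `S^μ` into the quotient by the ideal above `μ`. -/
noncomputable def spechtIncl (μ : Multipartition ℓ n) :
    specht K μ →ₗ[(Alg K ℓ n)ᵐᵒᵖ] cellQuot K μ :=
  (Submodule.span (Alg K ℓ n)ᵐᵒᵖ {residue K μ (yElt K μ)}).subtype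

/-- The value at `(x, z)` of the bilinear form on `S^μ` is `c`. The form is determined by
`p q^* ≡ ⟨x, z⟩ y_μ` modulo the ideal above `μ`, where `p` and `q` represent `x` and `z`. -/
def IsFormValue (μ : Multipartition ℓ n) (x z : specht K μ) (c : K) : Prop :=
  ∀ p q : Alg K ℓ n, residue K μ p = spechtIncl K μ x → residue K μ q = spechtIncl K μ z →
    p * inv q - c • yElt K μ ∈ cellIdeal K μ

theorem exists_lift {μ : Multipartition ℓ n} (x : specht K μ) :
    ∃ p, residue K μ p = spechtIncl K μ x :=
  (cellSubmodule K μ).mkQ_surjective _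

theorem exists_lift_of_mem {μ : Multipartition ℓ n} {x : specht K μ} {d : ℤ}
    (hx : x ∈ (specht K μ).piece d) :
    ∃ p ∈ piece K ℓ n (d + ((n : ℤ) * ℓ - ∑ i, (theta μ i : ℤ))),
      residue K μ p = spechtIncl K μ x := by
  obtain ⟨p, hp, hpx⟩ := hx
  rw [sub_neg_eq_add] at hp
  exact ⟨p, hp, hpx⟩

theorem sub_mem_of_residue_eq {μ : Multipartition ℓ n} {p q : Alg K ℓ n}
    (h : residue K μ p = residue K μ q) : p - q ∈ cellIdeal K μ := by
  rw [← residue_eq_zero, map_sub, h, sub_self]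

variable (K) in
/-- The radical of the bilinear form on `S^μ`. -/
def formRadical (μ : Multipartition ℓ n) : Submodule (Alg K ℓ n)ᵐᵒᵖ (specht K μ) where
  carrier := {x | ∀ z, IsFormValue μ x z 0}
  zero_mem' := by
    intro z p q hp hq
    rw [map_zero, residue_eq_zero] at hp
    rw [zero_smul, sub_zero]
    exact (cellIdeal K μ).mul_mem_right _ _ hp
  add_mem' := by
    intro x x' hx hx' z p q hp hq
    obtain ⟨p₁, hp₁⟩ := exists_lift x
    have h₁ := hx z p₁ q hp₁ hq
    have h₂ := hx' z (p - p₁) q (by rw [map_sub, hp, hp₁, map_add, add_sub_cancel_left]) hq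
    rw [zero_smul, sub_zero] at h₁ h₂ ⊢
    have := add_mem h₁ h₂
    rwa [← add_mul, add_sub_cancel] at this
  smul_mem' := by
    intro a x hx z p q hp hq
    obtain ⟨p₁, hp₁⟩ := exists_lift x
    have h₁ := hx (op (inv (unop a)) • z) p₁ (q * inv (unop a)) hp₁ (by
      rw [map_smul, ← hq, ← map_smul, op_smul_eq_mul])
    have h₂ : p - p₁ * unop a ∈ cellIdeal K μ := sub_mem_of_residue_eq (by
      rw [hp, map_smul, ← hp₁, ← map_smul, ← op_unop a, op_smul_eq_mul, unop_op])
    rw [zero_smul, sub_zero, inv_mul, inv_inv] at h₁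
    rw [zero_smul, sub_zero]
    have := add_mem h₁ ((cellIdeal K μ).mul_mem_right _ (inv q) h₂)
    rwa [sub_mul, mul_assoc p₁, add_sub_cancel] at this

theorem mem_formRadical {μ : Multipartition ℓ n} {x : specht K μ} :
    x ∈ formRadical K μ ↔ ∀ z, IsFormValue μ x z 0 := Iff.rfl

theorem mem_cellIdeal_of_sum {μ : Multipartition ℓ n} (s : Finset ℤ) (f : ℤ → Alg K ℓ n) (k : ℤ)
    (hf : ∀ d ∈ s, f d ∈ piece K ℓ n (d + k)) (hs : ∑ d ∈ s, f d ∈ cellIdeal K μ) :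
    ∀ d ∈ s, f d ∈ cellIdeal K μ := by
  have h := ((cellQuot K μ).shift (-k)).isInternal
  rw [DirectSum.isInternal_submodule_iff_iSupIndep_and_iSup_eq_top,
    iSupIndep_iff_finsetSum_eq_zero_imp_eq_zero] at h
  intro d hd
  rw [← residue_eq_zero]
  refine h.1 s (fun d => residue K μ (f d)) (fun d hd => ?_) ?_ d hd
  · have := residue_mem_piece (μ := μ) (hf d hd)
    rwa [← sub_neg_eq_add] at this
  · have := residue_eq_zero.2 hs
    rwa [map_sum] at this

theorem formRadical_isHomogeneous (μ : Multipartition ℓ n) :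
    GradedRightModule.IsHomogeneous (formRadical K μ) := by
  have hsup := ((DirectSum.isInternal_submodule_iff_iSupIndep_and_iSup_eq_top _).1
    (specht K μ).isInternal).2
  intro x hx
  obtain ⟨v, hv, hvx⟩ := (Submodule.mem_iSup_iff_exists_finsupp _ _).1
    (hsup ▸ Submodule.mem_top : x ∈ ⨆ d, (specht K μ).piece d)
  choose P hP hPv using fun d => exists_lift_of_mem (hv d)
  rw [← hvx]
  refine Submodule.sum_mem _ fun d hd => Submodule.mem_iSup_of_mem d ⟨?_, hv d⟩
  change v d ∈ formRadical K μ
  have main : ∀ e : ℤ, ∀ z ∈ (specht K μ).piece e, ∀ q, residue K μ q = spechtIncl K μ z →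
      P d * inv q ∈ cellIdeal K μ := by
    intro e z hz q hq
    obtain ⟨Q, hQ, hQz⟩ := exists_lift_of_mem hz
    have hx' := hx z (∑ d ∈ v.support, P d) Q (by
      rw [map_sum, ← hvx, Finsupp.sum, map_sum]
      exact Finset.sum_congr rfl fun d _ => hPv d) hQz
    rw [zero_smul, sub_zero, Finset.sum_mul] at hx'
    have h₁ := mem_cellIdeal_of_sum v.support (fun d => P d * inv Q) _ (fun d _ => by
      have := mul_mem_piece (hP d) (inv_mem_piece hQ)
      rwa [add_assoc] at this) hx' d hd
    have h₂ := (cellIdeal K μ).mul_mem_left (P d) _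
      (inv_mem_cellIdeal (sub_mem_of_residue_eq (hq.trans hQz.symm)))
    have h₃ := add_mem h₂ h₁
    rwa [← mul_add, ← inv_add, sub_add_cancel] at h₃
  intro z p q hp hq
  rw [zero_smul, sub_zero]
  have key : ∀ q, residue K μ q = spechtIncl K μ z → P d * inv q ∈ cellIdeal K μ := by
    have hz : z ∈ ⨆ e, (specht K μ).piece e := hsup ▸ Submodule.mem_top
    clear hq
    induction hz using Submodule.iSup_induction' with
    | mem e z hz => exact main e z hz
    | zero =>
      intro q hq
      rw [map_zero, residue_eq_zero] at hq
      exact (cellIdeal K μ).mul_mem_left _ _ (inv_mem_cellIdeal hq)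
    | add z z' _ _ hz hz' =>
      intro q hq
      obtain ⟨q₁, hq₁⟩ := exists_lift z
      have h := add_mem (hz q₁ hq₁)
        (hz' (q - q₁) (by rw [map_sub, hq, hq₁, map_add, add_sub_cancel_left]))
      rwa [← mul_add, ← inv_add, add_sub_cancel] at h
  have h := add_mem ((cellIdeal K μ).mul_mem_right _ (inv q)
    (sub_mem_of_residue_eq (hp.trans (hPv d).symm))) (key q hq)
  rwa [← add_mul, sub_add_cancel] at h

variable (K) in
/-- The graded module `D^μ`, the quotient of `S^μ` by the radical of its bilinear form. -/
noncomputable def simpleHead (μ : Multipartition ℓ n) : GradedRightModule (piece K ℓ n) :=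
  (specht K μ).quot (formRadical K μ) (formRadical_isHomogeneous μ)

variable (K) in
/-- The graded module `D_0`. -/
noncomputable def D0 (h : n ≤ ℓ) : GradedRightModule (piece K ℓ n) := simpleHead K (lamMin n h)

end Algebra

end CycNilHecke

/-! The algebra $H$ acts on polynomials: $\psi_r$ by the Demazure operator $\partial_r
f=(f-s_rf)/(x_{r+1}-x_r)$ and $y_k$ by multiplication by $x_k$. Every ideal stable under the
$\partial_r$ and containing $x_1^\ell$ gives a quotient module. A stable ideal containing $x_1^m$,
$m\ge n$, contains $h_{m-i}(x_1,\dots,x_{i+1})$ for $i<n$; hence the monomials under the staircase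
$(m-1,\dots,m-n)$ span the quotient and every nonzero class divides the class of the staircase
monomial. If that monomial survives, the dimension is $m!/(m-n)!$. This is used for $m=n$ (simple
modules) and $m=\ell$ (the projective).

Simple modules. Let $Y=\sum_k y_kH$. Moving the $y_k$ to the left shows $\dim H/Y\le n!$. Through
$*$, the coinvariant quotient ($m=n$) is a right module of dimension $n!$; its staircase class is
killed by $Y$ and generates, because $y^{\mathrm{stair}}\psi_{w_0}\equiv\pm1$ modulo
$\sum_r\psi_rH$. So $H/Y$ is this module, and the divisibility property makes it simple
(`exists_mul_sub_one_mem_yIdeal`). A graded module generated by a nonzero homogeneous vector killed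
by all $y_k$ is therefore a shift of $H/Y$, determined by the degree of that vector. The $y_k$
commute and are nilpotent, so every graded simple module has such a generator.

Specht modules. The generator of $S^\mu$ is such a vector: $y_\mu y_k\in H^{>\mu}$ by pushing ties
between exponents to the left, and $y_\mu\notin H^{>\mu}$ by a functional. The functional takes the
coefficient of $(x_1\cdots x_n)^{\ell-1}$ in $\det(x_i^{p_j})\cdot f$ with $p=\theta(\mu)-1$. The
$\partial_r$ are self-adjoint for the resulting form, so a degree count gives vanishing on
$H^{>\mu}$, while the value is $1$ on $e\,y_\mu$ whenever $1-e\in\sum_r\psi_rH$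
(`mul_yElt_notMem_cellIdeal`). The same fact shows that the form on $S^{\lambda_{\min}}$ is nonzero.

Projective cover. Up to sign $y^{\mathrm{stair}}\psi_{w_0}$ is an idempotent $e$ with $e\psi_r=0$,
so $eH=e\,K[y]$. Its degree-zero part is $Ke$, which makes the map onto the simple module
superfluous. The annihilator of $e$ in the polynomial ring is Demazure stable and does not contain
the $\ell$-staircase monomial, so $\dim eH=\ell!/(\ell-n)!$. -/

namespace CycNilHecke

open MvPolynomial

/-! ### Demazure operators on polynomials -/

section Demazure

variable {σ : Type*} [DecidableEq σ] {K : Type u} [Field K]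

/-- The algebra automorphism exchanging two variables. -/
noncomputable def swapVar (a b : σ) : MvPolynomial σ K →ₐ[K] MvPolynomial σ K :=
  rename (Equiv.swap a b)

@[simp] theorem swapVar_X_left (a b : σ) : swapVar a b (X a : MvPolynomial σ K) = X b := by
  simp [swapVar]

@[simp] theorem swapVar_X_right (a b : σ) : swapVar a b (X b : MvPolynomial σ K) = X a := by
  simp [swapVar]

theorem swapVar_X_of_ne {a b c : σ} (h : c ≠ a) (h' : c ≠ b) :
    swapVar a b (X c : MvPolynomial σ K) = X c := by
  simp [swapVar, Equiv.swap_apply_of_ne_of_ne h h']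

@[simp] theorem swapVar_swapVar (a b : σ) (f : MvPolynomial σ K) :
    swapVar a b (swapVar a b f) = f := by
  have : (Equiv.swap a b : σ → σ) ∘ Equiv.swap a b = id := by ext; simp
  rw [swapVar, rename_rename, this, rename_id_apply]

theorem swapVar_braid {a b c : σ} (hab : a ≠ b) (hbc : b ≠ c) (hac : a ≠ c)
    (f : MvPolynomial σ K) :
    swapVar a b (swapVar b c (swapVar a b f)) = swapVar b c (swapVar a b (swapVar b c f)) := by
  simp only [swapVar, rename_rename]
  congr 2
  ext x
  simp only [Function.comp_apply]
  by_cases h1 : x = a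
  · subst h1
    simp [Equiv.swap_apply_of_ne_of_ne, hab, hac, hac.symm, hbc.symm]
  by_cases h2 : x = b
  · subst h2
    simp [Equiv.swap_apply_of_ne_of_ne, hab, hac, hac.symm, hbc.symm]
  by_cases h3 : x = c
  · subst h3
    simp [Equiv.swap_apply_of_ne_of_ne, hab, hac, hac.symm, hbc.symm]
  · simp [Equiv.swap_apply_of_ne_of_ne, h1, h2, h3]

theorem swapVar_comm {a b c d : σ} (hac : a ≠ c) (had : a ≠ d) (hbc : b ≠ c) (hbd : b ≠ d)
    (f : MvPolynomial σ K) :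
    swapVar a b (swapVar c d f) = swapVar c d (swapVar a b f) := by
  simp only [swapVar, rename_rename]
  congr 2
  have : Equiv.Perm.Disjoint (Equiv.swap a b) (Equiv.swap c d) := by
    intro x
    by_cases h1 : x = a
    · subst h1; exact Or.inr (Equiv.swap_apply_of_ne_of_ne hac had)
    by_cases h2 : x = b
    · subst h2; exact Or.inr (Equiv.swap_apply_of_ne_of_ne hbc hbd)
    · exact Or.inl (Equiv.swap_apply_of_ne_of_ne h1 h2)
  ext x
  exact congrArg (fun e : Equiv.Perm σ => e x) this.commute.eq

/-- The difference $f-sf$ obeys a twisted Leibniz rule, so divisibility need only be checked on the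
variables. -/
theorem exists_demazure (a b : σ) (f : MvPolynomial σ K) :
    ∃ g, (X b - X a) * g = f - swapVar a b f := by
  induction f using MvPolynomial.induction_on with
  | C c => exact ⟨0, by simp [swapVar]⟩
  | add p q hp hq =>
    obtain ⟨g, hg⟩ := hp
    obtain ⟨h, hh⟩ := hq
    exact ⟨g + h, by rw [mul_add, hg, hh, map_add]; ring⟩
  | mul_X p i hp =>
    obtain ⟨g, hg⟩ := hp
    have : ∃ k : MvPolynomial σ K, (X b - X a) * k = X i - swapVar a b (X i) := by
      by_cases h1 : i = a
      · subst h1; exact ⟨-1, by simp⟩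
      by_cases h2 : i = b
      · subst h2; exact ⟨1, by simp⟩
      · exact ⟨0, by simp [swapVar_X_of_ne h1 h2]⟩
    obtain ⟨k, hk⟩ := this
    refine ⟨g * X i + swapVar a b p * k, ?_⟩
    rw [map_mul]
    linear_combination X i * hg + swapVar a b p * hk

theorem X_sub_X_ne_zero {σ : Type*} {a b : σ} (h : a ≠ b) : (X b - X a : MvPolynomial σ K) ≠ 0 :=
  sub_ne_zero.2 fun h' => h (X_injective h').symm

/-- The Demazure operator `f ↦ (f - s f) / (X b - X a)`, where `s` exchanges `a` and `b`. -/
noncomputable def demazure {a b : σ} (h : a ≠ b) : MvPolynomial σ K →ₗ[K] MvPolynomial σ K where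
  toFun f := (exists_demazure a b f).choose
  map_add' f g := mul_left_cancel₀ (X_sub_X_ne_zero (K := K) h) (by
    rw [mul_add, (exists_demazure a b _).choose_spec, (exists_demazure a b _).choose_spec,
      (exists_demazure a b _).choose_spec, map_add]; ring)
  map_smul' c f := mul_left_cancel₀ (X_sub_X_ne_zero (K := K) h) (by
    rw [RingHom.id_apply, mul_smul_comm, (exists_demazure a b _).choose_spec,
      (exists_demazure a b _).choose_spec, map_smul, smul_sub])

theorem demazure_spec {a b : σ} (h : a ≠ b) (f : MvPolynomial σ K) :
    (X b - X a) * demazure h f = f - swapVar a b f :=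
  (exists_demazure a b f).choose_spec

theorem demazure_eq {a b : σ} (h : a ≠ b) {f g : MvPolynomial σ K}
    (hg : (X b - X a) * g = f - swapVar a b f) : demazure h f = g :=
  mul_left_cancel₀ (X_sub_X_ne_zero (K := K) h) (by rw [demazure_spec, hg])

theorem demazure_mul {a b : σ} (h : a ≠ b) (f g : MvPolynomial σ K) :
    demazure h (f * g) = demazure h f * g + swapVar a b f * demazure h g := by
  refine demazure_eq h ?_
  rw [map_mul]
  linear_combination g * demazure_spec h f + swapVar a b f * demazure_spec h g

theorem swapVar_demazure {a b : σ} (h : a ≠ b) (f : MvPolynomial σ K) :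
    swapVar a b (demazure h f) = demazure h f := by
  refine mul_left_cancel₀ (X_sub_X_ne_zero (K := K) h) ?_
  have := congrArg (swapVar a b) (demazure_spec h f)
  simp only [map_mul, map_sub, swapVar_X_left, swapVar_X_right, swapVar_swapVar] at this
  linear_combination -this - demazure_spec h f

theorem demazure_eq_zero {a b : σ} (h : a ≠ b) {f : MvPolynomial σ K}
    (hf : swapVar a b f = f) : demazure h f = 0 :=
  demazure_eq h (by rw [hf, mul_zero, sub_self])

theorem demazure_demazure {a b : σ} (h : a ≠ b) (f : MvPolynomial σ K) :
    demazure h (demazure h f) = 0 :=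
  demazure_eq_zero h (swapVar_demazure h f)

theorem demazure_one {a b : σ} (h : a ≠ b) : demazure h (1 : MvPolynomial σ K) = 0 :=
  demazure_eq_zero h (map_one _)

theorem demazure_X_left {a b : σ} (h : a ≠ b) : demazure h (X a : MvPolynomial σ K) = -1 :=
  demazure_eq h (by simp)

theorem demazure_X_right {a b : σ} (h : a ≠ b) : demazure h (X b : MvPolynomial σ K) = 1 :=
  demazure_eq h (by simp)

theorem demazure_X_mul_of_ne {a b c : σ} (h : a ≠ b) (h1 : c ≠ a) (h2 : c ≠ b)
    (f : MvPolynomial σ K) : demazure h (X c * f) = X c * demazure h f := by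
  rw [demazure_mul, demazure_eq_zero h (swapVar_X_of_ne h1 h2), swapVar_X_of_ne h1 h2, zero_mul,
    zero_add]

theorem demazure_X_left_mul {a b : σ} (h : a ≠ b) (f : MvPolynomial σ K) :
    demazure h (X a * f) = X b * demazure h f - f := by
  rw [demazure_mul, demazure_X_left, swapVar_X_left]; ring

theorem demazure_X_right_mul {a b : σ} (h : a ≠ b) (f : MvPolynomial σ K) :
    demazure h (X b * f) = X a * demazure h f + f := by
  rw [demazure_mul, demazure_X_right, swapVar_X_right]; ring

theorem demazure_comm {a b c d : σ} (hab : a ≠ b) (hcd : c ≠ d) (hac : a ≠ c) (had : a ≠ d)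
    (hbc : b ≠ c) (hbd : b ≠ d) (f : MvPolynomial σ K) :
    demazure hab (demazure hcd f) = demazure hcd (demazure hab f) := by
  refine mul_left_cancel₀ (X_sub_X_ne_zero (K := K) hab)
    (mul_left_cancel₀ (X_sub_X_ne_zero (K := K) hcd) ?_)
  have e1 := demazure_spec hab (demazure hcd f)
  have e2 := demazure_spec hcd f
  have e3 := congrArg (swapVar a b) e2
  have e4 := demazure_spec hcd (demazure hab f)
  have e5 := demazure_spec hab f
  have e6 := congrArg (swapVar c d) e5
  simp only [map_mul, map_sub, swapVar_X_of_ne hac.symm hbc.symm,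
    swapVar_X_of_ne had.symm hbd.symm, swapVar_X_of_ne hac had, swapVar_X_of_ne hbc hbd] at e3 e6
  have e7 := swapVar_comm (K := K) hac had hbc hbd f
  linear_combination (X d - X c) * e1 + e2 - e3 - (X b - X a) * e4 - e5 + e6 + e7

/-- Multiplied by $(X_b-X_a)(X_c-X_a)(X_c-X_b)$, either composite becomes the alternating sum of $f$
over the six permutations of $a,b,c$. The two sums differ only in the word used for the longest
permutation, and `swapVar_braid` identifies those. -/
theorem demazure_braid {a b c : σ} (hab : a ≠ b) (hbc : b ≠ c) (hac : a ≠ c)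
    (f : MvPolynomial σ K) :
    demazure hab (demazure hbc (demazure hab f)) =
      demazure hbc (demazure hab (demazure hbc f)) := by
  -- Two factors occur twice: clearing denominators leaves a redundant $X_b-X_a$ in `E` and a
  -- redundant $X_c-X_b$ in `F`.
  refine mul_left_cancel₀ (X_sub_X_ne_zero (K := K) hab)
    (mul_left_cancel₀ (X_sub_X_ne_zero (K := K) hbc)
      (mul_left_cancel₀ (X_sub_X_ne_zero (K := K) hac)
        (mul_left_cancel₀ (X_sub_X_ne_zero (K := K) hab)
          (mul_left_cancel₀ (X_sub_X_ne_zero (K := K) hbc) ?_))))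
  have e1 := demazure_spec hab f
  have e2 := demazure_spec hbc (demazure hab f)
  have e3 := demazure_spec hab (demazure hbc (demazure hab f))
  have e4 := congrArg (swapVar b c) e1
  have e5 := congrArg (swapVar a b) e2
  have e6 := congrArg (swapVar a b) e1
  have f1 := demazure_spec hbc f
  have f2 := demazure_spec hab (demazure hbc f)
  have f3 := demazure_spec hbc (demazure hab (demazure hbc f))
  have f4 := congrArg (swapVar a b) f1
  have f5 := congrArg (swapVar b c) f2
  have f6 := congrArg (swapVar b c) f1
  simp only [map_mul, map_sub, swapVar_X_left, swapVar_X_right, swapVar_swapVar,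
    swapVar_X_of_ne hab hac, swapVar_X_of_ne hac.symm hbc.symm] at e4 e5 e6 f4 f5 f6
  have e7 := congrArg (swapVar a b) e4
  have f7 := congrArg (swapVar b c) f4
  simp only [map_mul, map_sub, swapVar_X_left, swapVar_X_right,
    swapVar_X_of_ne hab hac, swapVar_X_of_ne hac.symm hbc.symm] at e7 f7
  have e8 := swapVar_braid (K := K) hab hbc hac f
  have E : (X b - X a) * ((X c - X a) * ((X c - X b) * ((X b - X a) *
      demazure hab (demazure hbc (demazure hab f))))) = (X b - X a) *
      (f - swapVar a b f - swapVar b c f + swapVar b c (swapVar a b f) +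
        swapVar a b (swapVar b c f) - swapVar a b (swapVar b c (swapVar a b f))) := by
    linear_combination e3 * ((X c - X b) * (X c - X a) * (X b - X a)) +
      e2 * ((X c - X a) * (X b - X a)) - e5 * ((X c - X b) * (X b - X a)) + e1 * (X c - X a) -
      e4 * (X b - X a) + e6 * (X c - X b) + e7 * (X b - X a)
  have F : (X c - X b) * ((X c - X a) * ((X c - X b) * ((X b - X a) *
      demazure hbc (demazure hab (demazure hbc f))))) = (X c - X b) *
      (f - swapVar a b f - swapVar b c f + swapVar b c (swapVar a b f) +
        swapVar a b (swapVar b c f) - swapVar b c (swapVar a b (swapVar b c f))) := by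
    linear_combination f3 * ((X b - X a) * (X c - X a) * (X c - X b)) +
      f2 * ((X c - X a) * (X c - X b)) - f5 * ((X c - X b) * (X b - X a)) + f1 * (X c - X a) -
      f4 * (X c - X b) + f6 * (X b - X a) + f7 * (X c - X b)
  linear_combination (X c - X b) * E - (X b - X a) * F - (X c - X b) * (X b - X a) * e8

end Demazure

/-! ### Complete homogeneous polynomials -/

/-- The complete homogeneous polynomial of degree `k` in `x 0, …, x (i - 1)`. -/
def completeHomog {R : Type*} [CommRing R] (x : ℕ → R) : ℕ → ℕ → R
  | 0, 0 => 1
  | 0, _ + 1 => 0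
  | _ + 1, 0 => 1
  | i + 1, k + 1 => completeHomog x i (k + 1) + x i * completeHomog x (i + 1) k
termination_by i k => (i, k)

section CompleteHomog

variable {R : Type*} [CommRing R] (x : ℕ → R)

@[simp] theorem completeHomog_zero_right (i : ℕ) : completeHomog x i 0 = 1 := by
  cases i <;> simp [completeHomog]

@[simp] theorem completeHomog_zero_succ (k : ℕ) : completeHomog x 0 (k + 1) = 0 := by
  simp [completeHomog]

theorem completeHomog_succ_succ (i k : ℕ) : completeHomog x (i + 1) (k + 1) =
    completeHomog x i (k + 1) + x i * completeHomog x (i + 1) k := by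
  rw [completeHomog]

theorem completeHomog_one (k : ℕ) : completeHomog x 1 k = x 0 ^ k := by
  induction k with
  | zero => simp
  | succ k ih => rw [completeHomog_succ_succ, ih, completeHomog_zero_succ, zero_add, pow_succ']

theorem completeHomog_succ (i k : ℕ) : completeHomog x (i + 1) k =
    x i ^ k + ∑ j ∈ Finset.range k, x i ^ j * completeHomog x i (k - j) := by
  induction k with
  | zero => simp
  | succ k ih =>
    rw [completeHomog_succ_succ, ih, Finset.sum_range_succ', mul_add, Finset.mul_sum]
    simp only [pow_zero, one_mul, Nat.sub_zero, Nat.add_sub_add_right, pow_succ', mul_assoc]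
    ring

theorem swapVar_completeHomog {σ : Type*} [DecidableEq σ] {K : Type u} [Field K]
    {x : ℕ → MvPolynomial σ K} {a b : σ} (i k : ℕ) (h : ∀ j < i, swapVar a b (x j) = x j) :
    swapVar a b (completeHomog x i k) = completeHomog x i k := by
  induction i generalizing k with
  | zero => cases k <;> simp
  | succ i ih =>
    induction k with
    | zero => simp
    | succ k ihk =>
      rw [completeHomog_succ_succ, map_add, map_mul, ih _ fun j hj => h j (by omega), ihk,
        h i (by omega)]

/-- In the generating function $\prod_j(1-x_jt)^{-1}$ only the factor of $x_i=X_a$ is moved by the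
swap, and $\partial(1-X_at)^{-1}=-t\,(1-X_at)^{-1}(1-X_bt)^{-1}$. The induction is the
coefficientwise form of this. -/
theorem demazure_completeHomog {σ : Type*} [DecidableEq σ] {K : Type u} [Field K]
    {x : ℕ → MvPolynomial σ K} {a b : σ} (hab : a ≠ b) (i k : ℕ) (ha : x i = X a)
    (hb : x (i + 1) = X b) (h : ∀ j < i, swapVar a b (x j) = x j) :
    demazure hab (completeHomog x (i + 1) (k + 1)) = -completeHomog x (i + 2) k := by
  have h0 : ∀ k, demazure hab (completeHomog x i k) = 0 := fun k =>
    demazure_eq_zero hab (swapVar_completeHomog i k h)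
  induction k with
  | zero =>
    rw [completeHomog_succ_succ, map_add, h0, ha, demazure_X_left_mul]
    simp [demazure_one]
  | succ k ih =>
    rw [completeHomog_succ_succ, map_add, h0, ha, demazure_X_left_mul, ih,
      completeHomog_succ_succ x (i + 1) k, hb]
    ring

end CompleteHomog

end CycNilHecke

namespace CycNilHecke

open MvPolynomial

/-! ### Quotients of the polynomial ring with a staircase basis -/

section Staircase

variable {K : Type u} [Field K] {n : ℕ}

variable (K n) in
/-- The variable with the given number, and `0` if there is none. -/
noncomputable def var (i : ℕ) : MvPolynomial (Fin n) K := if h : i < n then X ⟨i, h⟩ else 0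

theorem var_of_lt {i : ℕ} (h : i < n) : var K n i = X ⟨i, h⟩ := dif_pos h

/-- The exponent `(m - 1, m - 2, …)` of the first `i` variables. -/
noncomputable def stairPrefix (m n i : ℕ) : Fin n →₀ ℕ :=
  Finsupp.equivFunOnFinite.symm fun j => if j.val < i then m - 1 - j else 0

/-- The exponent `(m - 1, m - 2, …, m - n)`. -/
noncomputable def stair (m n : ℕ) : Fin n →₀ ℕ := Finsupp.equivFunOnFinite.symm fun j => m - 1 - j

theorem stairPrefix_apply (m i : ℕ) (j : Fin n) :
    stairPrefix m n i j = if j.val < i then m - 1 - j else 0 := rfl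

theorem stair_apply (m : ℕ) (j : Fin n) : stair m n j = m - 1 - j := rfl

variable {m : ℕ} {I : Ideal (MvPolynomial (Fin n) K)}

theorem monomial_one_mul (b c : Fin n →₀ ℕ) :
    (monomial b 1 * monomial c 1 : MvPolynomial (Fin n) K) = monomial (b + c) 1 := by
  rw [monomial_mul, one_mul]

theorem monomial_mem_of_le {b c : Fin n →₀ ℕ} (h : c ≤ b) (hc : monomial c (1 : K) ∈ I) :
    monomial b (1 : K) ∈ I := by
  obtain ⟨d, rfl⟩ := exists_add_of_le h
  rw [← monomial_one_mul]
  exact I.mul_mem_right _ hc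

/-- Start from $h_m(x_0)=x_0^m$ and apply successive Demazure operators: up to sign, each lowers the
degree by one and adjoins one variable. -/
theorem completeHomog_mem_of_stable
    (hst : ∀ (a b : Fin n) (hab : a ≠ b), b.val = a.val + 1 → ∀ f ∈ I, demazure hab f ∈ I)
    (h0 : ∀ k : Fin n, k.val = 0 → X k ^ m ∈ I) (hnm : n ≤ m) (i : ℕ) (hi : i < n) :
    completeHomog (var K n) (i + 1) (m - i) ∈ I := by
  induction i with
  | zero =>
    rw [completeHomog_one, var_of_lt hi]
    exact h0 _ rfl
  | succ i ih =>
    have h := hst ⟨i, by omega⟩ ⟨i + 1, hi⟩ (by simp [Fin.ext_iff]) rfl _ (ih (by omega))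
    obtain ⟨k, hk⟩ : ∃ k, m - i = k + 1 := ⟨m - i - 1, by omega⟩
    rw [hk, demazure_completeHomog _ i k (var_of_lt _) (var_of_lt _), neg_mem_iff] at h
    · rwa [show m - (i + 1) = k by omega]
    · intro j hj
      rw [var_of_lt (by omega)]
      exact swapVar_X_of_ne (by simp [Fin.ext_iff]; omega) (by simp [Fin.ext_iff]; omega)

/-- Let $T_i=x_0^{m-1}\cdots x_{i-1}^{m-i}$. Once $T_i$ kills the variables before $i$ modulo `I`,
only the term $x_i^{m-i}$ of $h_{m-i}(x_0,\dots,x_i)$ survives multiplication by $T_i$. Then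
$T_{i+1}=T_ix_i^{m-1-i}$ kills $x_i$ as well, and the induction continues. -/
theorem stairPrefix_mul_X_pow_mem
    (hI : ∀ i < n, completeHomog (var K n) (i + 1) (m - i) ∈ I)
    (hnm : n ≤ m) (i : ℕ) :
    (∀ j : Fin n, j.val < i → monomial (stairPrefix m n i) (1 : K) * X j ∈ I) ∧
    (∀ h : i < n, monomial (stairPrefix m n i) (1 : K) * X ⟨i, h⟩ ^ (m - i) ∈ I) := by
  have step : ∀ i, (∀ j : Fin n, j.val < i → monomial (stairPrefix m n i) (1 : K) * X j ∈ I) →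
      ∀ h : i < n, monomial (stairPrefix m n i) (1 : K) * X ⟨i, h⟩ ^ (m - i) ∈ I := by
    intro i hi h
    have hh : ∀ i' ≤ i, ∀ k, monomial (stairPrefix m n i) (1 : K) *
        completeHomog (var K n) i' (k + 1) ∈ I := by
      intro i' hi'
      induction i' with
      | zero => simp
      | succ i' ih =>
        intro k
        rw [completeHomog_succ_succ, mul_add, ← mul_assoc, var_of_lt (by omega)]
        exact add_mem (ih (by omega) k) (I.mul_mem_right _ (hi _ (by simp only; omega)))
    have h1 := I.mul_mem_left (monomial (stairPrefix m n i) (1 : K)) (hI i h)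
    rw [completeHomog_succ, mul_add, var_of_lt h, Finset.mul_sum] at h1
    refine (Submodule.add_mem_iff_left I (Submodule.sum_mem _ fun j hj => ?_)).1 h1
    rw [mul_left_comm]
    obtain ⟨k, hk⟩ : ∃ k, m - i - j = k + 1 :=
      ⟨m - i - j - 1, by have := Finset.mem_range.1 hj; omega⟩
    rw [hk]
    exact I.mul_mem_left _ (hh i le_rfl k)
  suffices h : ∀ j : Fin n, j.val < i → monomial (stairPrefix m n i) (1 : K) * X j ∈ I from
    ⟨h, step i h⟩
  induction i with
  | zero => intro j hj; omega
  | succ i ih =>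
    intro j hj
    by_cases hin : i < n
    · have e : stairPrefix m n (i + 1) = stairPrefix m n i + Finsupp.single ⟨i, hin⟩ (m - 1 - i) := by
        ext k
        simp only [stairPrefix_apply, Finsupp.add_apply, Finsupp.single_apply, Fin.ext_iff]
        split_ifs <;> (try subst_vars) <;> (try omega)
      rw [e, ← monomial_one_mul, ← X_pow_eq_monomial]
      by_cases hji : j.val < i
      · rw [mul_right_comm]
        exact I.mul_mem_right _ (ih j hji)
      · have : j = ⟨i, hin⟩ := Fin.ext (by simp only; omega)
        rw [this, mul_assoc, ← pow_succ, show m - 1 - i + 1 = m - i by omega]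
        exact step i ih hin
    · have e : stairPrefix m n (i + 1) = stairPrefix m n i := by
        ext k
        simp only [stairPrefix_apply]
        split_ifs <;> omega
      rw [e]
      exact ih j (by omega)

/-- The monomial is divisible by $T_ix_i^{m-i}$. Nothing is assumed on the entries after `i`, which
is what a lexicographic argument needs. -/
theorem monomial_mem_of_lex
    (hI : ∀ i < n, completeHomog (var K n) (i + 1) (m - i) ∈ I)
    (hnm : n ≤ m) {b : Fin n →₀ ℕ} (i : Fin n)
    (hb : ∀ j < i, m - 1 - j.val ≤ b j) (hbi : m - i ≤ b i) : monomial b (1 : K) ∈ I := by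
  have h := (stairPrefix_mul_X_pow_mem hI hnm i).2 i.2
  rw [X_pow_eq_monomial, monomial_one_mul] at h
  refine monomial_mem_of_le (fun j => ?_) h
  simp only [stairPrefix_apply, Finsupp.add_apply, Finsupp.single_apply, Fin.eta]
  by_cases hji : j < i
  · rw [if_pos (Fin.lt_def.1 hji), if_neg (ne_of_gt hji)]
    simpa using hb j hji
  · rw [if_neg (by rwa [← Fin.lt_def]), zero_add]
    split_ifs with h'
    · rw [← h']; exact hbi
    · exact Nat.zero_le _

theorem stair_mul_X_mem
    (hI : ∀ i < n, completeHomog (var K n) (i + 1) (m - i) ∈ I)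
    (hnm : n ≤ m) (k : Fin n) :
    monomial (stair m n) (1 : K) * X k ∈ I := by
  rw [X, monomial_one_mul]
  refine monomial_mem_of_lex hI hnm k (fun j hj => ?_) ?_
  · simp [stair_apply]
  · simp only [Finsupp.add_apply, stair_apply, Finsupp.single_eq_same]
    omega

/-- The exponents below the staircase. -/
abbrev Box (m n : ℕ) : Type := (i : Fin n) → Fin (m - i)

/-- An element of the box as an exponent. -/
noncomputable def boxExp (a : Box m n) : Fin n →₀ ℕ := Finsupp.equivFunOnFinite.symm fun i => (a i).val

theorem boxExp_apply (a : Box m n) (i : Fin n) : boxExp a i = a i := rfl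

theorem card_box : Fintype.card (Box m n) = m.descFactorial n := by
  rw [Fintype.card_pi, Nat.descFactorial_eq_prod_range, Finset.prod_range]
  simp

/-- Straightening from the last variable to the first: modulo `I`, $h_{m-i}(x_0,\dots,x_i)$ rewrites
$x_i^{m-i}$ through terms with a smaller power of $x_i$, enlarging only exponents before $i$. Bounds
already achieved after $i$ therefore persist. -/
theorem monomial_mem_sup
    (hI : ∀ i < n, completeHomog (var K n) (i + 1) (m - i) ∈ I)
    (i : ℕ) (b : Fin n →₀ ℕ)
    (hb : ∀ j : Fin n, i ≤ j.val → b j < m - j) : monomial b (1 : K) ∈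
      I.restrictScalars K ⊔ Submodule.span K (Set.range fun a : Box m n => monomial (boxExp a) 1) := by
  set E := I.restrictScalars K ⊔
    Submodule.span K (Set.range fun a : Box m n => monomial (boxExp a) (1 : K)) with hE
  induction i generalizing b with
  | zero =>
    refine Submodule.mem_sup_right (Submodule.subset_span
      ⟨fun j => ⟨b j, hb j (Nat.zero_le _)⟩, ?_⟩)
    exact congrArg (fun e => monomial e (1 : K)) (by ext j; rfl)
  | succ i ih =>
    by_cases hin : i < n
    swap
    · exact ih b fun j hj => by omega
    obtain ⟨c, hc⟩ : ∃ c, b ⟨i, hin⟩ = c := ⟨_, rfl⟩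
    induction c using Nat.strong_induction_on generalizing b with
    | _ c ihc =>
    by_cases hci : c < m - i
    · refine ih b fun j hj => ?_
      rcases hj.eq_or_lt with h | h
      · subst h
        rw [Fin.eta] at hc
        rw [hc]; exact hci
      · exact hb j h
    -- Multiplying by a polynomial in the variables before `i` keeps the exponent of $x_i$ below `c`
    -- and does not touch the later ones, so `ihc` still applies to every term.
    have key : ∀ i' ≤ i, ∀ k, ∀ b : Fin n →₀ ℕ, b ⟨i, hin⟩ < c →
        (∀ j : Fin n, i + 1 ≤ j.val → b j < m - j) →
          completeHomog (var K n) i' k * monomial b 1 ∈ E := by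
      intro i' hi'
      induction i' with
      | zero =>
        intro k b h1 h2
        cases k with
        | zero => rw [completeHomog_zero_right, one_mul]; exact ihc _ h1 b h2 rfl
        | succ k => rw [completeHomog_zero_succ, zero_mul]; exact zero_mem _
      | succ i' ihi =>
        intro k
        induction k with
        | zero =>
          intro b h1 h2
          rw [completeHomog_zero_right, one_mul]; exact ihc _ h1 b h2 rfl
        | succ k ihk =>
          intro b h1 h2
          rw [completeHomog_succ_succ, add_mul, var_of_lt (by omega), mul_comm (X _), mul_assoc, X,
            monomial_one_mul]
          refine add_mem (ihi (by omega) _ b h1 h2) (ihk _ ?_ fun j hj => ?_)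
          · rw [Finsupp.add_apply, Finsupp.single_eq_of_ne (by simp [Fin.ext_iff]; omega), zero_add]
            exact h1
          · rw [Finsupp.add_apply, Finsupp.single_eq_of_ne (by simp [Fin.ext_iff]; omega), zero_add]
            exact h2 j hj
    have hle : Finsupp.single ⟨i, hin⟩ (m - i) ≤ b := by
      rw [Finsupp.single_le_iff, hc]
      omega
    obtain ⟨d, rfl⟩ := exists_add_of_le hle
    rw [Finsupp.add_apply, Finsupp.single_eq_same] at hc
    have h1 := I.mul_mem_right (monomial d 1) (hI i hin)
    rw [completeHomog_succ, var_of_lt hin, add_mul, Finset.sum_mul, X_pow_eq_monomial,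
      monomial_one_mul] at h1
    refine (Submodule.add_mem_iff_left E (Submodule.sum_mem _ fun j hj => ?_)).1
      (Submodule.mem_sup_left h1)
    have hj := Finset.mem_range.1 hj
    rw [mul_comm (X _ ^ j), mul_assoc, X_pow_eq_monomial, monomial_one_mul]
    refine key i le_rfl _ _ ?_ fun k hk => ?_
    · rw [Finsupp.add_apply, Finsupp.single_eq_same]
      omega
    · have := hb k hk
      rw [Finsupp.add_apply, Finsupp.single_eq_of_ne (by simp [Fin.ext_iff]; omega)] at this ⊢
      exact this

theorem sup_span_eq_top
    (hI : ∀ i < n, completeHomog (var K n) (i + 1) (m - i) ∈ I)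
    : I.restrictScalars K ⊔
    Submodule.span K (Set.range fun a : Box m n => monomial (boxExp a) (1 : K)) = ⊤ := by
  rw [eq_top_iff]
  rintro f -
  induction f using MvPolynomial.induction_on' with
  | monomial b c =>
    rw [← mul_one c, ← smul_eq_mul, ← smul_monomial]
    exact Submodule.smul_mem _ _ (monomial_mem_sup hI n b fun j hj => by omega)
  | add p q hp hq => exact add_mem hp hq

/-- Take the lexicographically least exponent `a` of the combination and multiply by the monomial
that carries it to the staircase. Any other exponent exceeds `a` where it first differs, so its
multiple passes the staircase there and vanishes by `monomial_mem_of_lex`. -/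
theorem exists_mul_sub_stair_mem_of_box
    (hI : ∀ i < n, completeHomog (var K n) (i + 1) (m - i) ∈ I)
    (hnm : n ≤ m) (c : Box m n → K) (hc : c ≠ 0) :
    ∃ g, (∑ a, c a • monomial (boxExp a) (1 : K)) * g - monomial (stair m n) 1 ∈ I := by
  classical
  obtain ⟨a, ha, hmin⟩ := Finset.exists_min_image (Finset.univ.filter fun a => c a ≠ 0)
    (fun a => toLex fun i => (a i).val) (by
      obtain ⟨a, ha⟩ := Function.ne_iff.1 hc
      exact ⟨a, by simpa using ha⟩)
  have ha' : c a ≠ 0 := (Finset.mem_filter.1 ha).2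
  have hle : ∀ a : Box m n, ∀ i, (a i).val ≤ m - 1 - i := fun a i => by
    have := (a i).2
    omega
  refine ⟨monomial (stair m n - boxExp a) (c a)⁻¹, ?_⟩
  rw [← Finset.add_sum_erase _ _ (Finset.mem_univ a), add_mul, add_sub_right_comm]
  refine add_mem ?_ ?_
  · rw [smul_mul_assoc, monomial_mul, one_mul, add_tsub_cancel_of_le, smul_monomial, smul_eq_mul,
      mul_inv_cancel₀ ha', sub_self]
    · exact zero_mem _
    · exact fun i => hle a i
  · rw [Finset.sum_mul]
    refine Submodule.sum_mem _ fun a' h' => ?_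
    by_cases hc' : c a' = 0
    · rw [hc', zero_smul, zero_mul]; exact zero_mem _
    have hne : a' ≠ a := Finset.ne_of_mem_erase h'
    have hlt : toLex (fun i => (a i).val) < toLex fun i => (a' i).val := by
      refine lt_of_le_of_ne (hmin a' (by simpa using hc')) fun h => hne ?_
      funext i
      exact Fin.ext (congrFun (toLex.injective h) i).symm
    obtain ⟨i, hi1, hi2⟩ := hlt
    replace hi1 : ∀ j < i, (a j).val = a' j := hi1
    replace hi2 : (a i).val < a' i := hi2
    rw [smul_mul_assoc, monomial_mul, one_mul, smul_monomial, ← mul_one (c a' • (c a)⁻¹),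
      ← smul_eq_mul (c a' • (c a)⁻¹), ← smul_monomial, ← algebraMap_smul (MvPolynomial (Fin n) K)]
    refine I.mul_mem_left _ (monomial_mem_of_lex hI hnm i (fun j hj => ?_) ?_)
    · have := hi1 j hj
      have h2 := hle a j
      simp only [Finsupp.add_apply, Finsupp.tsub_apply, boxExp_apply, stair_apply]
      rw [← this]
      omega
    · have h2 := hle a i
      simp only [Finsupp.add_apply, Finsupp.tsub_apply, boxExp_apply, stair_apply]
      omega

theorem exists_mul_sub_stair_mem
    (hI : ∀ i < n, completeHomog (var K n) (i + 1) (m - i) ∈ I)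
    (hnm : n ≤ m) {f : MvPolynomial (Fin n) K} (hf : f ∉ I) :
    ∃ g, f * g - monomial (stair m n) 1 ∈ I := by
  have h : f ∈ I.restrictScalars K ⊔
    Submodule.span K (Set.range fun a : Box m n => monomial (boxExp a) (1 : K)) :=
      sup_span_eq_top hI ▸ Submodule.mem_top
  obtain ⟨p, hp, q, hq, rfl⟩ := Submodule.mem_sup.1 h
  obtain ⟨c, rfl⟩ := (Submodule.mem_span_range_iff_exists_fun K).1 hq
  obtain ⟨g, hg⟩ := exists_mul_sub_stair_mem_of_box hI hnm c (by
    rintro rfl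
    exact hf (by simpa using hp))
  refine ⟨g, ?_⟩
  rw [add_mul, add_sub_assoc]
  exact add_mem (I.mul_mem_right _ hp) hg

/-- A linear relation among the box monomials could be multiplied up to the staircase monomial,
which `hT` keeps outside `I`. -/
theorem finrank_quotient_staircase
    (hI : ∀ i < n, completeHomog (var K n) (i + 1) (m - i) ∈ I)
    (hnm : n ≤ m) (hT : monomial (stair m n) (1 : K) ∉ I) :
    Module.finrank K (MvPolynomial (Fin n) K ⧸ I) = m.descFactorial n := by
  let v : Box m n → MvPolynomial (Fin n) K ⧸ I := fun a =>
    Ideal.Quotient.mk I (monomial (boxExp a) 1)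
  have hli : LinearIndependent K v := by
    rw [Fintype.linearIndependent_iff]
    intro c hc
    by_contra hne
    obtain ⟨g, hg⟩ := exists_mul_sub_stair_mem_of_box hI hnm c (by
      rintro rfl
      exact hne fun _ => rfl)
    refine hT ?_
    have h : (∑ a, c a • monomial (boxExp a) (1 : K)) ∈ I := by
      rw [← Ideal.Quotient.eq_zero_iff_mem, map_sum, ← hc]
      rfl
    have := sub_mem (I.mul_mem_right g h) hg
    rwa [sub_sub_cancel] at this
  have hsp : ⊤ ≤ Submodule.span K (Set.range v) := by
    rintro x -
    obtain ⟨f, rfl⟩ := Ideal.Quotient.mk_surjective x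
    have h : f ∈ I.restrictScalars K ⊔
      Submodule.span K (Set.range fun a : Box m n => monomial (boxExp a) (1 : K)) :=
        sup_span_eq_top hI ▸ Submodule.mem_top
    obtain ⟨p, hp, q, hq, rfl⟩ := Submodule.mem_sup.1 h
    obtain ⟨c, rfl⟩ := (Submodule.mem_span_range_iff_exists_fun K).1 hq
    rw [map_add, Ideal.Quotient.eq_zero_iff_mem.2 hp, zero_add, map_sum]
    refine Submodule.sum_mem _ fun a _ => ?_
    exact Submodule.smul_mem (Submodule.span K (Set.range v)) (c a) (Submodule.subset_span ⟨a, rfl⟩)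
  rw [Module.finrank_eq_card_basis (Module.Basis.mk hli hsp), card_box]

end Staircase

end CycNilHecke

namespace CycNilHecke

open MvPolynomial

/-! ### Polynomial representations of the cyclotomic nilHecke algebra -/

section Representation

variable {K : Type u} [Field K] {n : ℕ}

/-- The strand `r`, as the first of the two strands on which `ψ_r` acts. -/
def fstStrand (r : Fin (n - 1)) : Fin n := ⟨r.val, by omega⟩

/-- The strand `r + 1`, as the second of the two strands on which `ψ_r` acts. -/
def sndStrand (r : Fin (n - 1)) : Fin n := ⟨r.val + 1, by omega⟩

theorem fstStrand_ne_sndStrand (r : Fin (n - 1)) : fstStrand r ≠ sndStrand r := by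
  simp [fstStrand, sndStrand]

/-- The Demazure operator in two consecutive variables. -/
noncomputable def simpleDemazure (r : Fin (n - 1)) :
    MvPolynomial (Fin n) K →ₗ[K] MvPolynomial (Fin n) K := demazure (fstStrand_ne_sndStrand r)

/-- In the braid relation the middle strand appears both as `sndStrand r` and as `fstStrand s`,
which agree only propositionally. -/
theorem demazure_braid_of_eq {a b b' c : Fin n} (h : b = b') (hab : a ≠ b) (hbc : b' ≠ c)
    (hac : a ≠ c) (f : MvPolynomial (Fin n) K) :
    demazure hab (demazure hbc (demazure hab f)) =
      demazure hbc (demazure hab (demazure hbc f)) := by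
  subst h
  exact demazure_braid hab hbc hac f

variable (I : Ideal (MvPolynomial (Fin n) K))

/-- An ideal stable under the Demazure operators. -/
def IsDemazureStable : Prop := ∀ r : Fin (n - 1), ∀ f ∈ I, simpleDemazure r f ∈ I

variable {I}

/-- The action of the generators on a quotient of the polynomial ring. -/
noncomputable def repGen (hst : IsDemazureStable I) :
    Gen n → Module.End K (MvPolynomial (Fin n) K ⧸ I)
  | Sum.inl r => ((I.restrictScalars K).liftQ
      ((Ideal.Quotient.mkₐ K I).toLinearMap ∘ₗ simpleDemazure r) (by
        intro f hf
        exact Ideal.Quotient.eq_zero_iff_mem.2 (hst r f hf))) ∘ₗ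
      (Submodule.Quotient.restrictScalarsEquiv K I).symm.toLinearMap
  | Sum.inr k => LinearMap.mulLeft K (Ideal.Quotient.mk I (X k))

theorem repGen_inl (hst : IsDemazureStable I) (r : Fin (n - 1)) (f : MvPolynomial (Fin n) K) :
    repGen hst (Sum.inl r) (Ideal.Quotient.mk I f) = Ideal.Quotient.mk I (simpleDemazure r f) := rfl

theorem repGen_inr (hst : IsDemazureStable I) (k : Fin n) (f : MvPolynomial (Fin n) K) :
    repGen hst (Sum.inr k) (Ideal.Quotient.mk I f) = Ideal.Quotient.mk I (X k * f) := rfl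

theorem repGen_inr_pow (hst : IsDemazureStable I) (k : Fin n) (e : ℕ)
    (f : MvPolynomial (Fin n) K) :
    (repGen hst (Sum.inr k) ^ e) (Ideal.Quotient.mk I f) = Ideal.Quotient.mk I (X k ^ e * f) := by
  induction e with
  | zero => simp
  | succ e ih => rw [pow_succ', Module.End.mul_apply, ih, repGen_inr, pow_succ', mul_assoc]

variable {ℓ : ℕ}

/-- The action of the cyclotomic nilHecke algebra on a quotient of the polynomial ring. -/
noncomputable def rep (hst : IsDemazureStable I)
    (hℓ : ∀ k : Fin n, k.val = 0 → (X k ^ ℓ : MvPolynomial (Fin n) K) ∈ I) :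
    Alg K ℓ n →ₐ[K] Module.End K (MvPolynomial (Fin n) K ⧸ I) :=
  lift (repGen hst) (by
    intro a b h
    refine LinearMap.ext fun x => ?_
    obtain ⟨f, rfl⟩ := Ideal.Quotient.mk_surjective x
    cases h with
    | psi_sq r =>
      simp only [map_mul, map_zero, FreeAlgebra.lift_ι_apply]
      simp only [Module.End.mul_apply, repGen_inl, simpleDemazure, demazure_demazure,
        LinearMap.zero_apply, map_zero]
    | psi_comm r k h =>
      simp only [map_mul, FreeAlgebra.lift_ι_apply]
      simp only [Module.End.mul_apply, repGen_inl, simpleDemazure]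
      rw [demazure_comm] <;> simp only [fstStrand, sndStrand, ne_eq, Fin.mk.injEq] <;> omega
    | psi_braid r s h =>
      simp only [map_mul, FreeAlgebra.lift_ι_apply]
      simp only [Module.End.mul_apply, repGen_inl, simpleDemazure]
      rw [demazure_braid_of_eq]
      · simp [fstStrand, sndStrand, h]
      · simp [fstStrand, sndStrand, h]; omega
    | y_comm k m =>
      simp only [map_mul, FreeAlgebra.lift_ι_apply]
      simp only [Module.End.mul_apply, repGen_inr]
      rw [mul_left_comm]
    | psi_y_comm r k h h' =>
      simp only [map_mul, FreeAlgebra.lift_ι_apply]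
      simp only [Module.End.mul_apply, repGen_inr, repGen_inl, simpleDemazure]
      rw [demazure_X_mul_of_ne _ (by simpa [fstStrand, Fin.ext_iff] using h)
        (by simpa [sndStrand, Fin.ext_iff] using h')]
    | psi_y_succ r k m hk hm =>
      obtain rfl : k = fstStrand r := Fin.ext hk
      obtain rfl : m = sndStrand r := Fin.ext hm
      simp only [map_mul, map_add, map_one, FreeAlgebra.lift_ι_apply]
      simp only [Module.End.mul_apply, LinearMap.add_apply, Module.End.one_apply, repGen_inr,
        repGen_inl, simpleDemazure, demazure_X_right_mul, map_add]
    | y_succ_psi r k m hk hm =>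
      obtain rfl : k = fstStrand r := Fin.ext hk
      obtain rfl : m = sndStrand r := Fin.ext hm
      simp only [map_mul, map_add, map_one, FreeAlgebra.lift_ι_apply]
      simp only [Module.End.mul_apply, LinearMap.add_apply, Module.End.one_apply, repGen_inr,
        repGen_inl, simpleDemazure, demazure_X_left_mul]
      rw [← map_add, sub_add_cancel]
    | cyclotomic k h =>
      simp only [map_pow, map_zero, FreeAlgebra.lift_ι_apply, repGen_inr_pow, LinearMap.zero_apply]
      exact Ideal.Quotient.eq_zero_iff_mem.2 (I.mul_mem_right _ (hℓ k h)))

theorem rep_psi (hst : IsDemazureStable I)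
    (hℓ : ∀ k : Fin n, k.val = 0 → (X k ^ ℓ : MvPolynomial (Fin n) K) ∈ I) (r : Fin (n - 1))
    (f : MvPolynomial (Fin n) K) : rep hst hℓ (psi K ℓ r) (Ideal.Quotient.mk I f) =
      Ideal.Quotient.mk I (simpleDemazure r f) := by
  rw [rep, psi, lift_gen, repGen_inl]

theorem rep_y (hst : IsDemazureStable I)
    (hℓ : ∀ k : Fin n, k.val = 0 → (X k ^ ℓ : MvPolynomial (Fin n) K) ∈ I) (k : Fin n)
    (f : MvPolynomial (Fin n) K) : rep hst hℓ (y K ℓ k) (Ideal.Quotient.mk I f) =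
      Ideal.Quotient.mk I (X k * f) := by
  rw [rep, y, lift_gen, repGen_inr]

end Representation

/-! ### The form defined by an alternant -/

section Alternant

variable {K : Type u} [Field K] {n : ℕ}

/-- The exponent with all entries equal to `c`. -/
noncomputable def constExp (n c : ℕ) : Fin n →₀ ℕ := Finsupp.equivFunOnFinite.symm fun _ => c

theorem constExp_apply (c : ℕ) (i : Fin n) : constExp n c i = c := rfl

variable (K) in
/-- The determinant of the powers `X i ^ p j`. -/
noncomputable def alternant (p : Fin n → ℕ) : MvPolynomial (Fin n) K :=
  (Matrix.of fun i j => X i ^ p j : Matrix (Fin n) (Fin n) (MvPolynomial (Fin n) K)).det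

theorem swapVar_alternant {a b : Fin n} (h : a ≠ b) (p : Fin n → ℕ) :
    swapVar a b (alternant K p) = -alternant K p := by
  have e : (swapVar a b).mapMatrix (Matrix.of fun i j => (X i ^ p j : MvPolynomial (Fin n) K)) =
      (Matrix.of fun i j => (X i ^ p j : MvPolynomial (Fin n) K)).submatrix (Equiv.swap a b) id := by
    ext1 i j
    simp [swapVar]
  rw [alternant, AlgHom.map_det, e, Matrix.det_permute, Equiv.Perm.sign_swap h]
  simp

/-- Subtracting row `a` from row `b` makes row `b` divisible by $X_b-X_a$. The quotient is symmetric
because the alternant and $X_b-X_a$ both change sign under the swap. -/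
theorem exists_alternant_eq_mul {a b : Fin n} (h : a ≠ b) (p : Fin n → ℕ) :
    ∃ B, alternant K p = (X b - X a) * B ∧ swapVar a b B = B := by
  suffices h' : ∃ B, alternant K p = (X b - X a) * B by
    obtain ⟨B, hB⟩ := h'
    refine ⟨B, hB, ?_⟩
    have := swapVar_alternant (K := K) h p
    rw [hB, map_mul, map_sub, swapVar_X_left, swapVar_X_right] at this
    exact mul_left_cancel₀ (X_sub_X_ne_zero (K := K) h) (by linear_combination -this)
  have hq : ∀ j, ∃ q, (X b ^ p j - X a ^ p j : MvPolynomial (Fin n) K) = (X b - X a) * q :=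
    fun j => sub_dvd_pow_sub_pow (X b) (X a) (p j)
  choose q hq using hq
  set M : Matrix (Fin n) (Fin n) (MvPolynomial (Fin n) K) := Matrix.of fun i j => X i ^ p j with hM
  refine ⟨(M.updateRow b q).det, ?_⟩
  rw [← Matrix.det_updateRow_smul M b (X b - X a) q]
  have : M.updateRow b ((X b - X a : MvPolynomial (Fin n) K) • q) =
      M.updateRow b (M b + (-1 : MvPolynomial (Fin n) K) • M a) := by
    congr 1
    funext j
    simp only [Pi.smul_apply, smul_eq_mul, Pi.add_apply, hM, Matrix.of_apply, ← hq]
    ring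
  rw [this, Matrix.det_updateRow_add_smul_self _ h.symm]
  rfl

theorem X_pow_dvd_alternant {p : Fin n → ℕ} {c : ℕ} (hc : ∀ j, c ≤ p j) (i : Fin n) :
    X i ^ c ∣ alternant K p := by
  set M : Matrix (Fin n) (Fin n) (MvPolynomial (Fin n) K) := Matrix.of fun i j => X i ^ p j with hM
  refine ⟨(M.updateRow i fun j => X i ^ (p j - c)).det, ?_⟩
  rw [← Matrix.det_updateRow_smul]
  have : (X i ^ c : MvPolynomial (Fin n) K) • (fun j => (X i ^ (p j - c) : MvPolynomial (Fin n) K)) =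
      M i := by
    funext j
    simp only [Pi.smul_apply, smul_eq_mul, hM, Matrix.of_apply, ← pow_add,
      Nat.add_sub_cancel' (hc j)]
  rw [this, Matrix.updateRow_eq_self]
  rfl

theorem alternant_isHomogeneous (p : Fin n → ℕ) :
    (alternant K p).IsHomogeneous (∑ i, p i) := by
  rw [alternant, Matrix.det_apply]
  refine IsHomogeneous.sum _ _ _ fun σ _ => ?_
  have : (∏ i, (X (σ i) ^ p i : MvPolynomial (Fin n) K)).IsHomogeneous (∑ i, p i) :=
    IsHomogeneous.prod _ _ _ fun i _ => isHomogeneous_X_pow _ _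
  rcases Int.units_eq_one_or (Equiv.Perm.sign σ) with h | h
  · simpa [h] using this
  · simpa [h] using this.neg

theorem coeff_alternant {p : Fin n → ℕ} (hp : Function.Injective p) :
    coeff (Finsupp.equivFunOnFinite.symm p) (alternant K p) = 1 := by
  rw [alternant, Matrix.det_apply, coeff_sum, Finset.sum_eq_single 1]
  · have : (∏ i, (X i ^ p i : MvPolynomial (Fin n) K)) =
        monomial (Finsupp.equivFunOnFinite.symm p) 1 := by
      rw [monomial_eq, Finsupp.prod_fintype _ _ fun i => pow_zero _]
      simp
    simp [this]
  · intro σ _ hσ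
    have : (∏ i, (X (σ i) ^ p i : MvPolynomial (Fin n) K)) =
        monomial (Finsupp.equivFunOnFinite.symm (p ∘ σ.symm)) 1 := by
      rw [monomial_eq, Finsupp.prod_fintype _ _ fun i => pow_zero _, ← Equiv.prod_comp σ (fun i =>
        (X i : MvPolynomial (Fin n) K) ^ Finsupp.equivFunOnFinite.symm (p ∘ σ.symm) i)]
      simp
    have hne : Finsupp.equivFunOnFinite.symm (p ∘ σ.symm) ≠ Finsupp.equivFunOnFinite.symm p := by
      intro h
      apply hσ
      ext i
      have := congrFun (Finsupp.equivFunOnFinite.symm.injective h) (σ i)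
      have := hp (by simpa using this)
      simp [← this]
    simp only [Matrix.of_apply, this]
    rcases Int.units_eq_one_or (Equiv.Perm.sign σ) with h | h <;>
      simp [h, coeff_monomial, hne]
  · simp

variable (K) in
/-- The coefficient of `X ^ (ℓ - 1, …, ℓ - 1)` in the product with an alternant. -/
noncomputable def coeffForm (ℓ : ℕ) (p : Fin n → ℕ) : MvPolynomial (Fin n) K →ₗ[K] K :=
  lcoeff K (constExp n (ℓ - 1)) ∘ₗ LinearMap.mulLeft K (alternant K p)

theorem coeffForm_apply (ℓ : ℕ) (p : Fin n → ℕ) (f : MvPolynomial (Fin n) K) :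
    coeffForm K ℓ p f = coeff (constExp n (ℓ - 1)) (alternant K p * f) := rfl

theorem coeff_constExp_swapVar (a b : Fin n) (c : ℕ) (f : MvPolynomial (Fin n) K) :
    coeff (constExp n c) (swapVar a b f) = coeff (constExp n c) f := by
  have : constExp n c = (constExp n c).mapDomain (Equiv.swap a b) := by
    rw [← Finsupp.equivMapDomain_eq_mapDomain]
    ext i
    simp [constExp_apply]
  conv_lhs => rw [this]
  exact coeff_rename_mapDomain _ (Equiv.injective _) _ _

/-- Write the alternant as $(X_b-X_a)B$ with $B$ symmetric. The alternant times $\partial f\cdot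
g-f\cdot\partial g$ is $h-sh$ with $h=B\,f\,s(g)$, and a coefficient at an exponent fixed by $s$
vanishes on $h-sh$. This self-adjointness makes the form compatible with `inv`. -/
theorem coeffForm_demazure_mul {a b : Fin n} (h : a ≠ b) (ℓ : ℕ) (p : Fin n → ℕ)
    (f g : MvPolynomial (Fin n) K) :
    coeffForm K ℓ p (demazure h f * g) = coeffForm K ℓ p (f * demazure h g) := by
  obtain ⟨B, hB, hBs⟩ := exists_alternant_eq_mul (K := K) h p
  rw [← sub_eq_zero, ← map_sub, coeffForm_apply]
  have : alternant K p * (demazure h f * g - f * demazure h g) =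
      B * (f * swapVar a b g) - swapVar a b (B * (f * swapVar a b g)) := by
    rw [map_mul, hBs, map_mul, swapVar_swapVar, hB]
    linear_combination B * g * demazure_spec h f - B * f * demazure_spec h g
  rw [this, coeff_sub, coeff_constExp_swapVar, sub_self]

variable (K) in
/-- The largest ideal in the kernel of `coeffForm`. -/
noncomputable def formIdeal (ℓ : ℕ) (p : Fin n → ℕ) : Ideal (MvPolynomial (Fin n) K) where
  carrier := {f | ∀ g, coeffForm K ℓ p (f * g) = 0}
  add_mem' ha hb g := by rw [add_mul, map_add, ha, hb, add_zero]
  zero_mem' g := by rw [zero_mul, map_zero]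
  smul_mem' c f hf g := by
    rw [smul_eq_mul, mul_comm c, mul_assoc]
    exact hf _

theorem coeffForm_eq_zero {ℓ : ℕ} {p : Fin n → ℕ} {f : MvPolynomial (Fin n) K}
    (hf : f ∈ formIdeal K ℓ p) : coeffForm K ℓ p f = 0 := by
  simpa using hf 1

theorem formIdeal_isDemazureStable (ℓ : ℕ) (p : Fin n → ℕ) :
    IsDemazureStable (formIdeal K ℓ p) := by
  intro r f hf g
  rw [simpleDemazure, coeffForm_demazure_mul]
  exact hf _

/-- The alternant contributes $X_i^{\ell-m}$, so the product carries $X_i$ to a power at least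
$\ell$, beyond the exponent $\ell-1$ being read off. The index `i` and $n\le\ell$ give $\ell\ge1$,
so $\ell-1$ is not truncated. -/
theorem X_pow_mem_formIdeal {ℓ m : ℕ} (hn : n ≤ ℓ) {p : Fin n → ℕ} (hp : ∀ j, ℓ ≤ p j + m)
    (i : Fin n) : X i ^ m ∈ formIdeal K ℓ p := by
  intro g
  obtain ⟨q, hq⟩ := X_pow_dvd_alternant (K := K) (p := p) (c := ℓ - m)
    (fun j => by have := hp j; omega) i
  have : alternant K p * (X i ^ m * g) =
      monomial (Finsupp.single i (ℓ - m + m)) 1 * (q * g) := by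
    rw [← X_pow_eq_monomial, pow_add, hq]
    ring
  rw [coeffForm_apply, this, coeff_monomial_mul', if_neg]
  rw [Finsupp.single_le_iff, constExp_apply]
  have := i.pos
  omega

theorem coeffForm_monomial {ℓ : ℕ} {p : Fin n → ℕ} (hp : Function.Injective p)
    (hpℓ : ∀ i, p i < ℓ) :
    coeffForm K ℓ p (monomial (Finsupp.equivFunOnFinite.symm fun i => ℓ - 1 - p i) 1) = 1 := by
  have : constExp n (ℓ - 1) = Finsupp.equivFunOnFinite.symm p +
      Finsupp.equivFunOnFinite.symm fun i => ℓ - 1 - p i := by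
    ext i
    have := hpℓ i
    simp only [constExp_apply, Finsupp.add_apply, Finsupp.equivFunOnFinite_symm_apply_apply]
    omega
  rw [coeffForm_apply, this, coeff_mul_monomial, coeff_alternant hp, mul_one]

/-- Degree count: the alternant is homogeneous of degree $\sum p_i$, so all monomials of the product
have degree above $n(\ell-1)$. -/
theorem coeffForm_monomial_mul_eq_zero {ℓ : ℕ} {p : Fin n → ℕ} {b : Fin n →₀ ℕ}
    (h : n * (ℓ - 1) < ∑ i, p i + ∑ i, b i) (f : MvPolynomial (Fin n) K) :
    coeffForm K ℓ p (monomial b 1 * f) = 0 := by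
  rw [coeffForm_apply, mul_left_comm, coeff_monomial_mul', one_mul]
  split_ifs with hb
  swap
  · rfl
  rw [coeff_mul]
  refine Finset.sum_eq_zero fun x hx => ?_
  rw [(alternant_isHomogeneous p).coeff_eq_zero, zero_mul]
  have hx := Finset.HasAntidiagonal.mem_antidiagonal.1 hx
  intro hd
  have hle : ∀ i, x.1 i + b i ≤ ℓ - 1 := by
    intro i
    have h1 := DFunLike.congr_fun hx i
    have h2 := hb i
    simp only [Finsupp.add_apply, Finsupp.tsub_apply, constExp_apply] at h1 h2
    omega
  rw [Finsupp.degree_eq_sum] at hd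
  have := Finset.sum_le_sum fun i (_ : i ∈ (Finset.univ : Finset (Fin n))) => hle i
  rw [Finset.sum_add_distrib, hd, Finset.sum_const, Finset.card_univ, Fintype.card_fin,
    smul_eq_mul] at this
  omega

end Alternant

end CycNilHecke

namespace CycNilHecke

open MvPolynomial

/-! ### Relations in the cyclotomic nilHecke algebra -/

section Relations

variable {K : Type u} [Field K] {ℓ n : ℕ}

theorem psi_mul_self (r : Fin (n - 1)) : psi K ℓ r * psi K ℓ r = 0 := by
  have := mk_rel (Rel.psi_sq (K := K) (ℓ := ℓ) r)
  rwa [map_mul, map_zero] at this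

theorem psi_mul_y_snd (r : Fin (n - 1)) :
    psi K ℓ r * y K ℓ (sndStrand r) = y K ℓ (fstStrand r) * psi K ℓ r + 1 := by
  have := mk_rel (Rel.psi_y_succ (K := K) (ℓ := ℓ) r (fstStrand r) (sndStrand r) rfl rfl)
  rwa [map_mul, map_add, map_mul, map_one] at this

theorem y_snd_mul_psi (r : Fin (n - 1)) :
    y K ℓ (sndStrand r) * psi K ℓ r = psi K ℓ r * y K ℓ (fstStrand r) + 1 := by
  have := mk_rel (Rel.y_succ_psi (K := K) (ℓ := ℓ) r (fstStrand r) (sndStrand r) rfl rfl)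
  rwa [map_mul, map_add, map_mul, map_one] at this

theorem psi_mul_y_of_ne {r : Fin (n - 1)} {k : Fin n} (h : k ≠ fstStrand r)
    (h' : k ≠ sndStrand r) : psi K ℓ r * y K ℓ k = y K ℓ k * psi K ℓ r := by
  have := mk_rel (Rel.psi_y_comm (K := K) (ℓ := ℓ) r k (fun e => h (Fin.ext e))
    (fun e => h' (Fin.ext e)))
  rwa [map_mul, map_mul] at this

theorem y_pow_eq_zero_of_val_eq_zero {k : Fin n} (h : k.val = 0) : y K ℓ k ^ ℓ = 0 := by
  have := mk_rel (Rel.cyclotomic (K := K) (ℓ := ℓ) k h)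
  rwa [map_pow, map_zero] at this

/-- Induction along right multiplication by the generators. -/
theorem alg_induction {p : Alg K ℓ n → Prop} (one : p 1) (add : ∀ x z, p x → p z → p (x + z))
    (smul : ∀ (c : K) x, p x → p (c • x)) (psi : ∀ x r, p x → p (x * psi K ℓ r))
    (y : ∀ x k, p x → p (x * y K ℓ k)) (x : Alg K ℓ n) : p x := by
  have hx : x ∈ ⨆ d, piece K ℓ n d := iSup_piece (K := K) ▸ Submodule.mem_top
  have zero : p 0 := by simpa using smul 0 1 one
  induction hx using Submodule.iSup_induction' with
  | mem d x hx =>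
    induction hx using Submodule.span_induction with
    | mem x hx =>
      obtain ⟨w, -, rfl⟩ := hx
      induction w using List.reverseRecOn with
      | nil => simpa using one
      | append_singleton w g ih =>
        rw [List.map_append, List.prod_append, List.map_singleton, List.prod_singleton]
        cases g with
        | inl r => exact psi _ _ ih
        | inr k => exact y _ _ ih
    | zero => exact zero
    | add x z _ _ hx hz => exact add _ _ hx hz
    | smul c x _ hx => exact smul _ _ hx
  | zero => exact zero
  | add x z _ _ hx hz => exact add _ _ hx hz

/-- The element acting as the transposition of two strands. -/
noncomputable def intertwiner (r : Fin (n - 1)) : Alg K ℓ n :=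
  1 - (y K ℓ (sndStrand r) - y K ℓ (fstStrand r)) * psi K ℓ r

theorem intertwiner_mul_y_snd (r : Fin (n - 1)) :
    intertwiner r * y K ℓ (sndStrand r) = y K ℓ (fstStrand r) * intertwiner r := by
  have h := (y_commute (K := K) (ℓ := ℓ) (fstStrand r) (sndStrand r)).eq
  rw [intertwiner, sub_mul, mul_assoc, psi_mul_y_snd, mul_sub, ← mul_assoc, mul_sub, h, mul_add,
    ← mul_assoc, sub_mul]
  noncomm_ring

theorem intertwiner_mul_y_fst (r : Fin (n - 1)) :
    intertwiner r * y K ℓ (fstStrand r) = y K ℓ (sndStrand r) * intertwiner r := by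
  have h := (y_commute (K := K) (ℓ := ℓ) (fstStrand r) (sndStrand r)).eq
  have h' : psi K ℓ r * y K ℓ (fstStrand r) = y K ℓ (sndStrand r) * psi K ℓ r - 1 := by
    rw [y_snd_mul_psi, add_sub_cancel_right]
  rw [intertwiner, sub_mul, mul_assoc, h', mul_sub, ← mul_assoc, mul_sub]
  simp only [sub_mul, h, mul_sub, ← mul_assoc]
  noncomm_ring

theorem intertwiner_mul_self (r : Fin (n - 1)) :
    (intertwiner r : Alg K ℓ n) * intertwiner r = 1 := by
  have h : (intertwiner r : Alg K ℓ n) * psi K ℓ r = psi K ℓ r := by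
    rw [intertwiner, sub_mul, mul_assoc, psi_mul_self]
    noncomm_ring
  have h' : (intertwiner r : Alg K ℓ n) * (y K ℓ (sndStrand r) - y K ℓ (fstStrand r)) =
      (y K ℓ (fstStrand r) - y K ℓ (sndStrand r)) * intertwiner r := by
    rw [mul_sub, intertwiner_mul_y_snd, intertwiner_mul_y_fst, sub_mul]
  have h2 : (intertwiner r : Alg K ℓ n) * intertwiner r = intertwiner r * 1 -
      intertwiner r * (y K ℓ (sndStrand r) - y K ℓ (fstStrand r)) * psi K ℓ r := by
    rw [mul_assoc, ← mul_sub]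
    rfl
  rw [h2, h', mul_assoc, h, intertwiner]
  noncomm_ring

/-- The intertwiner is its own inverse and conjugates $y_{r+1}$ into $y_r$, so the cyclotomic
relation spreads from the first strand to all others. -/
theorem y_pow_eq_zero (k : Fin n) : y K ℓ k ^ ℓ = 0 := by
  obtain ⟨k, hk⟩ := k
  induction k with
  | zero => exact y_pow_eq_zero_of_val_eq_zero rfl
  | succ k ih =>
    have h0 := ih (by omega)
    let r : Fin (n - 1) := ⟨k, by omega⟩
    have h : SemiconjBy (intertwiner r) (y K ℓ (sndStrand r)) (y K ℓ (fstStrand r)) :=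
      intertwiner_mul_y_snd r
    have h1 := (h.pow_right ℓ).eq
    have h2 : y K ℓ (fstStrand r) ^ ℓ = 0 := h0
    rw [h2, zero_mul] at h1
    have h3 := congrArg (intertwiner r * ·) h1
    simp only [← mul_assoc, intertwiner_mul_self, one_mul, mul_zero] at h3
    exact h3

/-! ### Polynomials in the `y_k` -/

open scoped IsMulCommutative in
variable (K ℓ n) in
/-- The evaluation of polynomials at the elements `y_k`. -/
noncomputable def ev : MvPolynomial (Fin n) K →ₐ[K] Alg K ℓ n :=
  haveI := Algebra.isMulCommutative_adjoin K (s := Set.range (y K ℓ : Fin n → Alg K ℓ n)) (by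
    rintro _ ⟨k, rfl⟩ _ ⟨m, rfl⟩
    exact (y_commute k m).eq)
  (Algebra.adjoin K (Set.range (y K ℓ : Fin n → Alg K ℓ n))).val.comp
    (aeval fun k => ⟨y K ℓ k, Algebra.subset_adjoin ⟨k, rfl⟩⟩)

@[simp] theorem ev_X (k : Fin n) : ev K ℓ n (X k) = y K ℓ k := by
  simp [ev]

theorem y_mul_psi (r : Fin (n - 1)) (k : Fin n) : y K ℓ k * psi K ℓ r =
    psi K ℓ r * ev K ℓ n (swapVar (fstStrand r) (sndStrand r) (X k)) +
      ev K ℓ n (simpleDemazure r (X k)) := by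
  rw [simpleDemazure]
  by_cases h : k = fstStrand r
  · subst h
    rw [swapVar_X_left, demazure_X_left, ev_X, psi_mul_y_snd, map_neg, map_one]
    abel
  by_cases h' : k = sndStrand r
  · subst h'
    rw [swapVar_X_right, demazure_X_right, ev_X, y_snd_mul_psi, map_one]
  · rw [swapVar_X_of_ne h h', demazure_eq_zero _ (swapVar_X_of_ne h h'), ev_X,
      psi_mul_y_of_ne h h', map_zero, add_zero]

/-- Both sides follow the same twisted Leibniz rule in `f`, so the case of a variable suffices.
Modulo `psiIdeal` this reads $f\psi_r\equiv\partial_rf$: right multiplication by $\psi_r$ is a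
Demazure operator. -/
theorem ev_mul_psi (f : MvPolynomial (Fin n) K) (r : Fin (n - 1)) : ev K ℓ n f * psi K ℓ r =
    psi K ℓ r * ev K ℓ n (swapVar (fstStrand r) (sndStrand r) f) +
      ev K ℓ n (simpleDemazure r f) := by
  induction f using MvPolynomial.induction_on with
  | C c =>
    have h : swapVar (fstStrand r) (sndStrand r) (C c : MvPolynomial (Fin n) K) = C c := by
      simp [swapVar]
    rw [simpleDemazure, demazure_eq_zero _ h, h, map_zero, add_zero, ← algebraMap_eq,
      AlgHom.commutes, Algebra.commutes]
  | add f g hf hg =>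
    simp only [map_add, add_mul, mul_add, hf, hg]
    abel
  | mul_X f k hf =>
    have h1 : ev K ℓ n (f * X k) = y K ℓ k * ev K ℓ n f := by rw [mul_comm, map_mul, ev_X]
    have h2 : simpleDemazure r (f * X k) = X k * simpleDemazure r f +
        simpleDemazure r (X k) * swapVar (fstStrand r) (sndStrand r) f := by
      rw [simpleDemazure, demazure_mul]
      ring
    rw [h1, h2, mul_assoc, hf, mul_add, ← mul_assoc, y_mul_psi, mul_comm f, map_mul, map_mul,
      map_add, map_mul, map_mul, ev_X]
    noncomm_ring

/-- The right ideal generated by the `ψ_r`. -/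
noncomputable def psiIdeal (K : Type u) [Field K] (ℓ n : ℕ) :
    Submodule (Alg K ℓ n)ᵐᵒᵖ (Alg K ℓ n) := Submodule.span _ (Set.range (psi K ℓ))

theorem mul_mem_right {J : Submodule (Alg K ℓ n)ᵐᵒᵖ (Alg K ℓ n)} {x : Alg K ℓ n} (hx : x ∈ J)
    (a : Alg K ℓ n) : x * a ∈ J := J.smul_mem (op a) hx

theorem psi_mul_mem_psiIdeal (r : Fin (n - 1)) (a : Alg K ℓ n) :
    psi K ℓ r * a ∈ psiIdeal K ℓ n :=
  mul_mem_right (Submodule.subset_span (Set.mem_range_self r)) a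

/-! ### The longest element of the nilCoxeter algebra -/

variable (K ℓ n) in
/-- The element `ψ_r`, and `0` if there is no such element. -/
noncomputable def psiNat (r : ℕ) : Alg K ℓ n := if h : r < n - 1 then psi K ℓ ⟨r, h⟩ else 0

theorem psiNat_of_lt {r : ℕ} (h : r < n - 1) : psiNat K ℓ n r = psi K ℓ ⟨r, h⟩ := dif_pos h

theorem psiNat_of_not_lt {r : ℕ} (h : ¬ r < n - 1) : psiNat K ℓ n r = 0 := dif_neg h

theorem psiNat_val (r : Fin (n - 1)) : psiNat K ℓ n r = psi K ℓ r := psiNat_of_lt r.2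

theorem psiNat_mul_self (r : ℕ) : psiNat K ℓ n r * psiNat K ℓ n r = 0 := by
  by_cases h : r < n - 1
  · rw [psiNat_of_lt h, psi_mul_self]
  · rw [psiNat_of_not_lt h, mul_zero]

theorem psiNat_comm {r k : ℕ} (h : r + 1 < k) :
    psiNat K ℓ n r * psiNat K ℓ n k = psiNat K ℓ n k * psiNat K ℓ n r := by
  by_cases hk : k < n - 1
  · rw [psiNat_of_lt hk, psiNat_of_lt (by omega : r < n - 1)]
    have := mk_rel (Rel.psi_comm (K := K) (ℓ := ℓ) ⟨k, hk⟩ ⟨r, by omega⟩ h)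
    rw [map_mul, map_mul] at this
    exact this.symm
  · rw [psiNat_of_not_lt hk, mul_zero, zero_mul]

theorem psiNat_braid (r : ℕ) : psiNat K ℓ n r * psiNat K ℓ n (r + 1) * psiNat K ℓ n r =
    psiNat K ℓ n (r + 1) * psiNat K ℓ n r * psiNat K ℓ n (r + 1) := by
  by_cases h : r + 1 < n - 1
  · rw [psiNat_of_lt h, psiNat_of_lt (by omega : r < n - 1)]
    have := mk_rel (Rel.psi_braid (K := K) (ℓ := ℓ) ⟨r, by omega⟩ ⟨r + 1, h⟩ rfl)
    rw [map_mul, map_mul, map_mul, map_mul] at this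
    exact this
  · rw [psiNat_of_not_lt h, mul_zero, zero_mul, mul_zero]

theorem psiNat_mem_piece (r : ℕ) : psiNat K ℓ n r ∈ piece K ℓ n (-2) := by
  by_cases h : r < n - 1
  · rw [psiNat_of_lt h]
    exact gen_mem_piece (Sum.inl _)
  · rw [psiNat_of_not_lt h]
    exact zero_mem _

variable (K ℓ n) in
/-- The product `ψ_j ψ_{j + 1} ⋯ ψ_{j + L - 1}`. -/
noncomputable def ascending (j : ℕ) : ℕ → Alg K ℓ n
  | 0 => 1
  | L + 1 => ascending j L * psiNat K ℓ n (j + L)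

theorem ascending_zero (j : ℕ) : ascending K ℓ n j 0 = 1 := rfl

theorem ascending_succ (j L : ℕ) :
    ascending K ℓ n j (L + 1) = ascending K ℓ n j L * psiNat K ℓ n (j + L) := rfl

theorem ascending_comm {j L r : ℕ} (h : j + L < r) :
    ascending K ℓ n j L * psiNat K ℓ n r = psiNat K ℓ n r * ascending K ℓ n j L := by
  induction L with
  | zero => rw [ascending, one_mul, mul_one]
  | succ L ih =>
    rw [ascending, mul_assoc, psiNat_comm (by omega), ← mul_assoc, ih (by omega), mul_assoc]

/-- Commute $\psi_r$ leftwards until it meets $\psi_r\psi_{r+1}$ and apply the braid relation; the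
resulting $\psi_{r+1}$ commutes with the initial segment $\psi_j\cdots\psi_{r-1}$. -/
theorem ascending_mul_psiNat {j L r : ℕ} (h : j ≤ r) (h' : r + 1 < j + L) :
    ascending K ℓ n j L * psiNat K ℓ n r = psiNat K ℓ n (r + 1) * ascending K ℓ n j L := by
  induction L with
  | zero => omega
  | succ L ih =>
    by_cases hr : r + 1 < j + L
    · rw [ascending, mul_assoc, ← psiNat_comm hr, ← mul_assoc, ih hr, mul_assoc]
    · cases L with
      | zero => omega
      | succ L =>
        obtain rfl : r = j + L := by omega
        rw [ascending, ascending, ← add_assoc, mul_assoc, mul_assoc, ← mul_assoc (psiNat K ℓ n _),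
          psiNat_braid, mul_assoc, ← mul_assoc, ascending_comm (by omega)]
        simp only [mul_assoc]

theorem ascending_succ_mul_last (j L : ℕ) :
    ascending K ℓ n j (L + 1) * psiNat K ℓ n (j + L) = 0 := by
  rw [ascending, mul_assoc, psiNat_mul_self, mul_zero]

theorem ascending_mem_piece (j L : ℕ) : ascending K ℓ n j L ∈ piece K ℓ n (-(2 * L)) := by
  induction L with
  | zero => simpa [ascending_zero] using one_mem_piece
  | succ L ih =>
    have := mul_mem_piece ih (psiNat_mem_piece (j + L))
    rw [ascending]
    convert this using 2
    push_cast
    ring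

variable (K ℓ n) in
/-- The element `ψ_w` for the longest permutation `w` of the strands `j, …, j + L`. -/
noncomputable def longest (j : ℕ) : ℕ → Alg K ℓ n
  | 0 => 1
  | L + 1 => longest (j + 1) L * ascending K ℓ n j (L + 1)

theorem longest_zero (j : ℕ) : longest K ℓ n j 0 = 1 := rfl

/-- The last letter of the ascending block is killed by $\psi^2=0$. Any other $\psi_r$ passes
through the block as $\psi_{r+1}$ and is absorbed by the shorter longest element. -/
theorem longest_mul_psiNat {j L r : ℕ} (h : j ≤ r) (h' : r < j + L) :
    longest K ℓ n j L * psiNat K ℓ n r = 0 := by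
  induction L generalizing j r with
  | zero => omega
  | succ L ih =>
    rw [longest, mul_assoc]
    by_cases hr : r = j + L
    · rw [hr, ascending_succ_mul_last, mul_zero]
    · rw [ascending_mul_psiNat h (by omega), ← mul_assoc, ih (by omega) (by omega), zero_mul]

theorem longest_mem_piece (j L : ℕ) : longest K ℓ n j L ∈ piece K ℓ n (-(L * (L + 1))) := by
  induction L generalizing j with
  | zero => simpa [longest_zero] using one_mem_piece
  | succ L ih =>
    have := mul_mem_piece (ih (j + 1)) (ascending_mem_piece j (L + 1))
    rw [longest]
    convert this using 2
    push_cast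
    ring

theorem ev_var_comm_psiNat {j r : ℕ} (h : j < r) : ev K ℓ n (var K n j) * psiNat K ℓ n r =
    psiNat K ℓ n r * ev K ℓ n (var K n j) := by
  by_cases hr : r < n - 1
  · rw [psiNat_of_lt hr, var_of_lt (by omega : j < n), ev_X, psi_mul_y_of_ne]
    · simp [fstStrand]; omega
    · simp [sndStrand]; omega
  · rw [psiNat_of_not_lt hr, mul_zero, zero_mul]

theorem commute_ev_var_ascending {j k L : ℕ} (h : j < k) :
    Commute (ev K ℓ n (var K n j)) (ascending K ℓ n k L) := by
  induction L with
  | zero => exact Commute.one_right _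
  | succ L ih => exact ih.mul_right (ev_var_comm_psiNat (by omega))

theorem commute_ev_var_longest {j k L : ℕ} (h : j < k) :
    Commute (ev K ℓ n (var K n j)) (longest K ℓ n k L) := by
  induction L generalizing k with
  | zero => exact Commute.one_right _
  | succ L ih => exact (ih (by omega)).mul_right (commute_ev_var_ascending h)

/-- Modulo `psiIdeal` each letter acts on the polynomial to its left as a Demazure operator, and
these turn $x_j^m$ into $\pm h_{m-i}(x_j,\dots,x_{j+i})$. -/
theorem ev_pow_mul_ascending_sub_mem {j m i : ℕ} (hi : i ≤ m) (hj : j + i < n) :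
    ev K ℓ n (var K n j ^ m) * ascending K ℓ n j i -
      (-1) ^ i * ev K ℓ n (completeHomog (fun k => var K n (j + k)) (i + 1) (m - i)) ∈
        psiIdeal K ℓ n := by
  induction i with
  | zero =>
    rw [ascending, completeHomog_one]
    simp
  | succ i ih =>
    have h := mul_mem_right (ih (by omega) (by omega)) (psiNat K ℓ n (j + i))
    have hr : j + i < n - 1 := by omega
    obtain ⟨k, hk⟩ : ∃ k, m - i = k + 1 := ⟨m - i - 1, by omega⟩
    rw [sub_mul, mul_assoc, ← ascending_succ, mul_assoc _ _ (psiNat K ℓ n _), psiNat_of_lt hr, ev_mul_psi, hk,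
      simpleDemazure, demazure_completeHomog _ i k, mul_add, ← sub_sub] at h
    · have h2 : (-1 : Alg K ℓ n) ^ i * (psi K ℓ ⟨j + i, hr⟩ *
        ev K ℓ n (swapVar (fstStrand ⟨j + i, hr⟩) (sndStrand ⟨j + i, hr⟩)
          (completeHomog (fun k => var K n (j + k)) (i + 1) (k + 1)))) ∈ psiIdeal K ℓ n := by
        rw [((Commute.neg_one_left _).pow_left i).left_comm]
        exact psi_mul_mem_psiIdeal _ _
      have h3 := add_mem h h2
      rw [show m - (i + 1) = k by omega]
      convert h3 using 1
      rw [map_neg, pow_succ]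
      noncomm_ring
    · exact var_of_lt _
    · exact var_of_lt _
    · intro k hk
      rw [var_of_lt (by omega : j + k < n)]
      exact swapVar_X_of_ne (by simp [fstStrand]; omega) (by simp [sndStrand]; omega)

variable (K n) in
/-- The monomial `x_j ^ L x_{j + 1} ^ (L - 1) ⋯ x_{j + L - 1}`. -/
noncomputable def varStair (j : ℕ) : ℕ → MvPolynomial (Fin n) K
  | 0 => 1
  | L + 1 => var K n j ^ (L + 1) * varStair (j + 1) L

theorem ev_var_mem_piece (j : ℕ) : ev K ℓ n (var K n j) ∈ piece K ℓ n 2 := by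
  by_cases h : j < n
  · rw [var_of_lt h, ev_X]
    exact gen_mem_piece (Sum.inr _)
  · rw [var, dif_neg h, map_zero]
    exact zero_mem _

theorem pow_mem_piece_mul {a : Alg K ℓ n} {d : ℤ} (h : a ∈ piece K ℓ n d) (k : ℕ) :
    a ^ k ∈ piece K ℓ n (k * d) := by
  induction k with
  | zero => simpa using one_mem_piece
  | succ k ih =>
    have := mul_mem_piece ih h
    rw [pow_succ]
    convert this using 2
    push_cast
    ring

theorem ev_varStair_mem_piece (j L : ℕ) :
    ev K ℓ n (varStair K n j L) ∈ piece K ℓ n (L * (L + 1)) := by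
  induction L generalizing j with
  | zero => simpa [varStair] using one_mem_piece
  | succ L ih =>
    have := mul_mem_piece (pow_mem_piece_mul (ev_var_mem_piece (ℓ := ℓ) (K := K) (n := n) j) (L + 1)) (ih (j + 1))
    rw [varStair, map_mul, map_pow]
    convert this using 2
    push_cast
    ring

/-- Since $y_j$ commutes with every $\psi_r$, $r>j$, the product regroups as the shorter instance
times $y_j^{L+1}\psi_j\cdots\psi_{j+L}$. The second factor is $(-1)^{L+1}h_0=\pm1$ modulo
`psiIdeal`, and the error terms stay in this right ideal because the sign `c` is central. -/
theorem exists_ev_varStair_mul_longest {j L : ℕ} (h : j + L ≤ n - 1) : ∃ c : ℤˣ,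
    ev K ℓ n (varStair K n j L) * longest K ℓ n j L - ((c : ℤ) : Alg K ℓ n) ∈ psiIdeal K ℓ n := by
  induction L generalizing j with
  | zero => exact ⟨1, by simp [varStair, longest]⟩
  | succ L ih =>
    obtain ⟨c, hc⟩ := ih (j := j + 1) (by omega)
    refine ⟨c * (-1) ^ (L + 1), ?_⟩
    have h1 := mul_mem_right hc (ev K ℓ n (var K n j) ^ (L + 1) * ascending K ℓ n j (L + 1))
    have h2 := ev_pow_mul_ascending_sub_mem (K := K) (ℓ := ℓ) (n := n) (j := j) (le_refl (L + 1))
      (by omega)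
    rw [Nat.sub_self, completeHomog_zero_right, map_one, mul_one] at h2
    have h3 := mul_mem_right h2 ((c : ℤ) : Alg K ℓ n)
    convert add_mem h1 h3 using 1
    have e : ev K ℓ n (varStair K n (j + 1) L) * longest K ℓ n (j + 1) L *
        (ev K ℓ n (var K n j) ^ (L + 1) * ascending K ℓ n j (L + 1)) =
        ev K ℓ n (varStair K n j (L + 1)) * longest K ℓ n j (L + 1) := by
      rw [varStair, longest, mul_comm (var K n j ^ (L + 1)), map_mul, map_pow, mul_assoc, mul_assoc,
        ← mul_assoc (longest K ℓ n _ _),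
        ← ((commute_ev_var_longest (Nat.lt_succ_self j)).pow_left (L + 1)).eq, mul_assoc]
    rw [sub_mul, e, sub_mul, map_pow, (Int.cast_commute (c : ℤ)
      (ev K ℓ n (var K n j) ^ (L + 1) * ascending K ℓ n j (L + 1))).eq]
    push_cast
    rw [(Int.cast_commute (c : ℤ) ((-1 : Alg K ℓ n) ^ (L + 1))).eq]
    abel

theorem varStair_eq_monomial {j L : ℕ} (h : j + L = n - 1) : varStair K n j L =
    monomial (Finsupp.equivFunOnFinite.symm fun i : Fin n => if j ≤ i.val then n - 1 - i else 0) 1 := by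
  induction L generalizing j with
  | zero =>
    have : (Finsupp.equivFunOnFinite.symm fun i : Fin n => if j ≤ i.val then n - 1 - i else 0) =
        0 := by
      ext i
      simp only [Finsupp.equivFunOnFinite_symm_apply_apply, Finsupp.coe_zero, Pi.zero_apply]
      split_ifs <;> omega
    rw [this]
    rfl
  | succ L ih =>
    rw [varStair, ih (by omega), var_of_lt (by omega), X_pow_eq_monomial, monomial_one_mul]
    refine congrArg (fun b => monomial b (1 : K)) ?_
    ext i
    simp only [Finsupp.equivFunOnFinite_symm_apply_apply, Finsupp.add_apply, Finsupp.single_apply,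
      Fin.ext_iff]
    split_ifs <;> omega

theorem varStair_eq_stair : varStair K n 0 (n - 1) = monomial (stair n n) 1 := by
  rw [varStair_eq_monomial (by omega)]
  exact congrArg (fun b => monomial b (1 : K)) (by ext i; simp [stair_apply])

variable (K ℓ n) in
/-- The element `ψ_w` for the longest permutation `w`. -/
noncomputable abbrev psiLongest : Alg K ℓ n := longest K ℓ n 0 (n - 1)

variable (K ℓ n) in
/-- The element `y_1 ^ (n - 1) y_2 ^ (n - 2) ⋯ y_{n - 1}`. -/
noncomputable abbrev yStair : Alg K ℓ n := ev K ℓ n (monomial (stair n n) 1)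

theorem psiLongest_mul_psi (r : Fin (n - 1)) : psiLongest K ℓ n * psi K ℓ r = 0 := by
  rw [← psiNat_val]
  exact longest_mul_psiNat (Nat.zero_le _) (by omega)

theorem exists_yStair_mul_psiLongest : ∃ c : ℤˣ,
    yStair K ℓ n * psiLongest K ℓ n - ((c : ℤ) : Alg K ℓ n) ∈ psiIdeal K ℓ n := by
  rw [yStair, ← varStair_eq_stair]
  exact exists_ev_varStair_mul_longest (by omega)

/-- There is an idempotent of degree `0`, congruent to `1` modulo the right ideal generated by
the `ψ_r`, which is a multiple of `ψ_w` for the longest permutation `w`. -/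
theorem exists_idempotent : ∃ e : Alg K ℓ n, (∃ c : ℤˣ, yStair K ℓ n * psiLongest K ℓ n = (c : ℤ) • e) ∧
    e ∈ piece K ℓ n 0 ∧ (∀ r, e * psi K ℓ r = 0) ∧ 1 - e ∈ psiIdeal K ℓ n ∧ e * e = e := by
  obtain ⟨c, hc⟩ := exists_yStair_mul_psiLongest (K := K) (ℓ := ℓ) (n := n)
  have hcc : (c : ℤ) * c = 1 := by
    rcases Int.units_eq_one_or c with h | h <;> simp [h]
  have h2 : ∀ r, ((c : ℤ) • (yStair K ℓ n * psiLongest K ℓ n)) * psi K ℓ r = 0 := fun r => by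
    rw [smul_mul_assoc, mul_assoc, psiLongest_mul_psi, mul_zero, smul_zero]
  have h3 : 1 - (c : ℤ) • (yStair K ℓ n * psiLongest K ℓ n) ∈ psiIdeal K ℓ n := by
    have := (psiIdeal K ℓ n).neg_mem (mul_mem_right hc ((c : ℤ) : Alg K ℓ n))
    convert this using 1
    rw [sub_mul, ← Int.cast_mul, hcc, zsmul_eq_mul, ((Int.cast_commute (c : ℤ) _)).eq]
    simp
  refine ⟨(c : ℤ) • (yStair K ℓ n * psiLongest K ℓ n), ⟨c, ?_⟩, ?_, h2, h3, ?_⟩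
  · rw [smul_smul, hcc, one_smul]
  · have := mul_mem_piece (ev_varStair_mem_piece (K := K) (ℓ := ℓ) (n := n) 0 (n - 1))
      (longest_mem_piece 0 (n - 1))
    rw [add_neg_cancel, varStair_eq_stair] at this
    exact zsmul_mem this _
  · have h4 : ∀ x ∈ psiIdeal K ℓ n,
        ((c : ℤ) • (yStair K ℓ n * psiLongest K ℓ n)) * x = 0 := by
      intro x hx
      induction hx using Submodule.span_induction with
      | mem x hx => obtain ⟨r, rfl⟩ := hx; exact h2 r
      | zero => exact mul_zero _
      | add x z _ _ hx hz => rw [mul_add, hx, hz, add_zero]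
      | smul a x _ hx =>
        rw [← op_unop a, op_smul_eq_mul, ← mul_assoc, hx, zero_mul]
    have := h4 _ h3
    rw [mul_sub, mul_one, sub_eq_zero] at this
    exact this.symm

end Relations

end CycNilHecke

namespace CycNilHecke

open MvPolynomial

/-! ### The right ideal generated by the `y_k` -/

section YIdeal

open scoped Pointwise

variable {K : Type u} [Field K] {ℓ n : ℕ}

open Classical in
variable (K ℓ n) in
/-- The normal forms of the monomials in `ψ_j, …, ψ_{j + L - 1}`. -/
noncomputable def normalForms (j : ℕ) : ℕ → Finset (Alg K ℓ n)
  | 0 => {1}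
  | L + 1 => normalForms (j + 1) L * (Finset.range (L + 2)).image (ascending K ℓ n j)

theorem card_normalForms_le (j L : ℕ) : (normalForms K ℓ n j L).card ≤ (L + 1).factorial := by
  classical
  induction L generalizing j with
  | zero => simp [normalForms]
  | succ L ih =>
    rw [normalForms, Nat.factorial_succ, mul_comm]
    refine Finset.card_mul_le.trans (Nat.mul_le_mul (ih _) ?_)
    convert Finset.card_image_le (s := Finset.range (L + 2)) (f := ascending K ℓ n j)
    simp

theorem mul_ascending_mem_span {j L i : ℕ} (hi : i ≤ L + 1) {x : Alg K ℓ n}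
    (hx : x ∈ Submodule.span K (normalForms K ℓ n (j + 1) L : Set (Alg K ℓ n))) :
    x * ascending K ℓ n j i ∈
      Submodule.span K (normalForms K ℓ n j (L + 1) : Set (Alg K ℓ n)) := by
  classical
  induction hx using Submodule.span_induction with
  | mem x hx =>
    refine Submodule.subset_span ?_
    rw [normalForms]
    exact Finset.mul_mem_mul hx
      (Finset.mem_image_of_mem _ (Finset.mem_range.2 (by omega)))
  | zero => rw [zero_mul]; exact zero_mem _
  | add x z _ _ hx hz => rw [add_mul]; exact add_mem hx hz
  | smul c x _ hx => rw [smul_mul_assoc]; exact Submodule.smul_mem _ _ hx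

/-- When $\psi_r$ meets the block $\psi_j\cdots\psi_{j+i-1}$ there are four outcomes: an inner
letter moves left as $\psi_{r+1}$, the last letter squares to zero, the next letter lengthens the
block, and a later one commutes past it. -/
theorem mul_psiNat_mem_span {j L r : ℕ} (h : j ≤ r) (h' : r < j + L) {x : Alg K ℓ n}
    (hx : x ∈ Submodule.span K (normalForms K ℓ n j L : Set (Alg K ℓ n))) :
    x * psiNat K ℓ n r ∈ Submodule.span K (normalForms K ℓ n j L : Set (Alg K ℓ n)) := by
  classical
  induction L generalizing j r x with
  | zero => omega
  | succ L ih =>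
    induction hx using Submodule.span_induction with
    | mem x hx =>
      rw [normalForms] at hx
      obtain ⟨a, ha, b, hb, rfl⟩ := Finset.mem_mul.1 hx
      obtain ⟨i, hi, rfl⟩ := Finset.mem_image.1 hb
      have hi := Finset.mem_range.1 hi
      have ha' : a ∈ Submodule.span K (normalForms K ℓ n (j + 1) L : Set (Alg K ℓ n)) :=
        Submodule.subset_span ha
      rw [mul_assoc]
      rcases lt_trichotomy r (j + i) with hr | hr | hr
      · by_cases hr' : r + 1 = j + i
        · obtain ⟨i, rfl⟩ : ∃ i', i = i' + 1 := ⟨i - 1, by omega⟩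
          obtain rfl : r = j + i := by omega
          rw [ascending_succ_mul_last, mul_zero]
          exact zero_mem _
        · rw [ascending_mul_psiNat h (by omega), ← mul_assoc]
          exact mul_ascending_mem_span (by omega) (ih (by omega) (by omega) ha')
      · rw [hr, ← ascending_succ]
        exact mul_ascending_mem_span (by omega) ha'
      · rw [ascending_comm hr, ← mul_assoc]
        exact mul_ascending_mem_span (by omega) (ih (by omega) (by omega) ha')
    | zero => rw [zero_mul]; exact zero_mem _
    | add x z _ _ hx hz => rw [add_mul]; exact add_mem hx hz
    | smul c x _ hx => rw [smul_mul_assoc]; exact Submodule.smul_mem _ _ hx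

theorem one_mem_span_normalForms (j L : ℕ) :
    1 ∈ Submodule.span K (normalForms K ℓ n j L : Set (Alg K ℓ n)) := by
  induction L generalizing j with
  | zero => exact Submodule.subset_span (by simp [normalForms])
  | succ L ih =>
    simpa [ascending_zero] using mul_ascending_mem_span (i := 0) (Nat.zero_le _) (ih (j + 1))

theorem psiWord_append (w : List (Fin (n - 1))) (r : Fin (n - 1)) :
    psiWord K ℓ (w ++ [r]) = psiWord K ℓ w * psi K ℓ r := by
  simp [psiWord]

theorem psiWord_mem_span (w : List (Fin (n - 1))) :
    psiWord K ℓ w ∈ Submodule.span K (normalForms K ℓ n 0 (n - 1) : Set (Alg K ℓ n)) := by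
  induction w using List.reverseRecOn with
  | nil => exact one_mem_span_normalForms 0 (n - 1)
  | append_singleton w r ih =>
    rw [psiWord_append, ← psiNat_val]
    exact mul_psiNat_mem_span (Nat.zero_le _) (by omega) ih

variable (K ℓ n) in
/-- The right ideal generated by the `y_k`. -/
noncomputable def yIdeal : Submodule (Alg K ℓ n)ᵐᵒᵖ (Alg K ℓ n) :=
  Submodule.span _ (Set.range (y K ℓ))

theorem y_mul_mem_yIdeal (k : Fin n) (a : Alg K ℓ n) : y K ℓ k * a ∈ yIdeal K ℓ n :=
  mul_mem_right (Submodule.subset_span (Set.mem_range_self k)) a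

theorem exists_psi_mul_y (r : Fin (n - 1)) (k : Fin n) : ∃ (k' : Fin n) (c : K),
    psi K ℓ r * y K ℓ k = y K ℓ k' * psi K ℓ r + c • 1 := by
  by_cases h : k = sndStrand r
  · exact ⟨fstStrand r, 1, by rw [h, psi_mul_y_snd, one_smul]⟩
  by_cases h' : k = fstStrand r
  · exact ⟨sndStrand r, -1, by rw [h', y_snd_mul_psi, neg_smul, one_smul, add_neg_cancel_right]⟩
  · exact ⟨k, 0, by rw [zero_smul, add_zero, psi_mul_y_of_ne h' h]⟩

/-- A $y$ to the right of a $\psi$-word can be moved to the front at the cost of scalar multiples of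
$\psi$-words, and at the front it is absorbed by the right ideal. Hence the sum is closed under
right multiplication by all generators. -/
theorem mem_yIdeal_sup (a : Alg K ℓ n) : a ∈ (yIdeal K ℓ n).restrictScalars K ⊔
    Submodule.span K (Set.range (psiWord K ℓ)) := by
  set E := (yIdeal K ℓ n).restrictScalars K ⊔
    Submodule.span K (Set.range (psiWord K ℓ : List (Fin (n - 1)) → Alg K ℓ n)) with hE
  have hw : ∀ w, psiWord K ℓ w ∈ E := fun w =>
    Submodule.mem_sup_right (Submodule.subset_span ⟨w, rfl⟩)
  have closed : ∀ b : Alg K ℓ n, (∀ w, psiWord K ℓ w * b ∈ E) → ∀ x ∈ E, x * b ∈ E := by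
    intro b hb x hx
    obtain ⟨u, hu, v, hv, rfl⟩ := Submodule.mem_sup.1 hx
    rw [add_mul]
    refine add_mem (Submodule.mem_sup_left (mul_mem_right hu b)) ?_
    clear hx hu
    induction hv using Submodule.span_induction with
    | mem x hx => obtain ⟨w, rfl⟩ := hx; exact hb w
    | zero => rw [zero_mul]; exact zero_mem _
    | add x z _ _ hx hz => rw [add_mul]; exact add_mem hx hz
    | smul c x _ hx => rw [smul_mul_assoc]; exact Submodule.smul_mem _ _ hx
  have hpsi : ∀ r, ∀ x ∈ E, x * psi K ℓ r ∈ E := fun r => closed _ fun w => by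
    rw [← psiWord_append]
    exact hw _
  have hy : ∀ k, ∀ x ∈ E, x * y K ℓ k ∈ E := fun k => closed _ fun w => by
    induction w using List.reverseRecOn generalizing k with
    | nil =>
      refine Submodule.mem_sup_left ?_
      have := y_mul_mem_yIdeal (K := K) (ℓ := ℓ) k 1
      rw [mul_one] at this
      simpa [psiWord] using this
    | append_singleton w r ih =>
      obtain ⟨k', c, hc⟩ := exists_psi_mul_y (K := K) (ℓ := ℓ) r k
      rw [psiWord_append, mul_assoc, hc, mul_add, ← mul_assoc, mul_smul_comm, mul_one]
      exact add_mem (hpsi _ _ (ih k')) (Submodule.smul_mem _ _ (hw w))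
  induction a using alg_induction with
  | one => exact hw []
  | add x z hx hz => exact add_mem hx hz
  | smul c x hx => exact Submodule.smul_mem _ _ hx
  | psi x r hx => exact hpsi r x hx
  | y x k hx => exact hy k x hx

theorem span_mkQ_normalForms : Submodule.span K (Set.range fun x : normalForms K ℓ n 0 (n - 1) =>
    ((yIdeal K ℓ n).restrictScalars K).mkQ x.1) = ⊤ := by
  rw [eq_top_iff]
  rintro x -
  obtain ⟨a, rfl⟩ := Submodule.mkQ_surjective _ x
  obtain ⟨u, hu, v, hv, rfl⟩ := Submodule.mem_sup.1 (mem_yIdeal_sup a)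
  rw [map_add, Submodule.mkQ_apply, (Submodule.Quotient.mk_eq_zero _).2 hu, zero_add]
  have hv' : v ∈ Submodule.span K (normalForms K ℓ n 0 (n - 1) : Set (Alg K ℓ n)) := by
    refine Submodule.span_le.2 ?_ hv
    rintro _ ⟨w, rfl⟩
    exact psiWord_mem_span w
  clear hv
  induction hv' using Submodule.span_induction with
  | mem x hx => exact Submodule.subset_span ⟨⟨x, hx⟩, rfl⟩
  | zero => rw [map_zero]; exact zero_mem _
  | add x z _ _ hx hz => rw [map_add]; exact add_mem hx hz
  | smul c x _ hx => rw [map_smul]; exact Submodule.smul_mem _ _ hx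

instance : Module.Finite K (Alg K ℓ n ⧸ (yIdeal K ℓ n).restrictScalars K) := by
  refine ⟨Submodule.fg_def.2 ⟨_, Set.finite_range _, span_mkQ_normalForms⟩⟩

theorem finrank_quotient_yIdeal_le :
    Module.finrank K (Alg K ℓ n ⧸ (yIdeal K ℓ n).restrictScalars K) ≤ n.factorial := by
  refine (finrank_le_of_span_eq_top (span_mkQ_normalForms (K := K) (ℓ := ℓ) (n := n))).trans ?_
  rw [Fintype.card_coe]
  refine (card_normalForms_le _ _).trans ?_
  cases n <;> simp

end YIdeal

/-! ### Orbits in polynomial representations -/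

section Orbit

variable {K : Type u} [Field K] {ℓ n : ℕ} {I : Ideal (MvPolynomial (Fin n) K)}
  (hst : IsDemazureStable I)
  (hℓ : ∀ k : Fin n, k.val = 0 → (X k ^ ℓ : MvPolynomial (Fin n) K) ∈ I)

theorem inv_ev (f : MvPolynomial (Fin n) K) : inv (ev K ℓ n f) = ev K ℓ n f := by
  induction f using MvPolynomial.induction_on with
  | C c => rw [← algebraMap_eq, AlgHom.commutes, Algebra.algebraMap_eq_smul_one, inv_smul, inv_one]
  | add f g hf hg => rw [map_add, inv_add, hf, hg]
  | mul_X f k hf =>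
    conv_rhs => rw [mul_comm]
    rw [map_mul, map_mul, inv_mul, hf, ev_X, y, inv_gen]

theorem rep_ev (f g : MvPolynomial (Fin n) K) :
    rep hst hℓ (ev K ℓ n f) (Ideal.Quotient.mk I g) = Ideal.Quotient.mk I (f * g) := by
  induction f using MvPolynomial.induction_on generalizing g with
  | C c =>
    rw [← algebraMap_eq, AlgHom.commutes, AlgHom.commutes, Module.algebraMap_end_apply,
      ← Algebra.smul_def]
    rfl
  | add f f' hf hf' => rw [map_add, map_add, LinearMap.add_apply, hf, hf', add_mul, map_add]
  | mul_X f k hf => rw [map_mul, map_mul, Module.End.mul_apply, ev_X, rep_y, hf, mul_assoc]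

/-- The right action of the algebra on an element of a polynomial representation. -/
noncomputable def orbit (x : MvPolynomial (Fin n) K ⧸ I) :
    Alg K ℓ n →ₗ[K] MvPolynomial (Fin n) K ⧸ I where
  toFun a := rep hst hℓ (inv a) x
  map_add' a b := by rw [inv_add, map_add, LinearMap.add_apply]
  map_smul' c a := by rw [inv_smul, map_smul, LinearMap.smul_apply, RingHom.id_apply]

theorem orbit_apply (x : MvPolynomial (Fin n) K ⧸ I) (a : Alg K ℓ n) :
    orbit hst hℓ x a = rep hst hℓ (inv a) x := rfl

theorem orbit_mul (x : MvPolynomial (Fin n) K ⧸ I) (a b : Alg K ℓ n) :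
    orbit hst hℓ x (a * b) = orbit hst hℓ (orbit hst hℓ x a) b := by
  rw [orbit_apply, orbit_apply, orbit_apply, inv_mul, map_mul, Module.End.mul_apply]

theorem orbit_one (x : MvPolynomial (Fin n) K ⧸ I) : orbit hst hℓ x 1 = x := by
  rw [orbit_apply, inv_one, map_one, Module.End.one_apply]

theorem orbit_zero (a : Alg K ℓ n) : orbit hst hℓ 0 a = 0 := by
  rw [orbit_apply, map_zero]

theorem orbit_ev (f g : MvPolynomial (Fin n) K) :
    orbit hst hℓ (Ideal.Quotient.mk I f) (ev K ℓ n g) = Ideal.Quotient.mk I (g * f) := by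
  rw [orbit_apply, inv_ev, rep_ev]

theorem orbit_eq_zero_of_mem_span {S : Set (Alg K ℓ n)} {x : MvPolynomial (Fin n) K ⧸ I}
    (hS : ∀ s ∈ S, orbit hst hℓ x s = 0) {a : Alg K ℓ n}
    (ha : a ∈ Submodule.span (Alg K ℓ n)ᵐᵒᵖ S) : orbit hst hℓ x a = 0 := by
  induction ha using Submodule.span_induction with
  | mem a ha => exact hS a ha
  | zero => exact map_zero _
  | add a b _ _ ha hb => rw [map_add, ha, hb, add_zero]
  | smul c a _ ha => rw [← op_unop c, op_smul_eq_mul, orbit_mul, ha, orbit_zero]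

/-- Demazure operators kill constants. -/
theorem orbit_eq_zero_of_mem_psiIdeal {a : Alg K ℓ n} (ha : a ∈ psiIdeal K ℓ n) :
    orbit hst hℓ 1 a = 0 := by
  refine orbit_eq_zero_of_mem_span hst hℓ ?_ ha
  rintro _ ⟨r, rfl⟩
  rw [orbit_apply, psi, inv_gen, ← psi, ← map_one (Ideal.Quotient.mk I), rep_psi, simpleDemazure,
    demazure_one, map_zero]

/-- The staircase class is $1\cdot y^{\mathrm{stair}}$, and the vector $1$ does not distinguish
$y^{\mathrm{stair}}\psi_{w_0}$ from the sign `c`, since their difference lies in `psiIdeal`. So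
$\psi_{w_0}$ takes the staircase class back to $\pm1$, and the staircase class generates the module.
-/
theorem exists_orbit_stair : ∃ c : ℤˣ, ∀ f : MvPolynomial (Fin n) K,
    orbit hst hℓ (Ideal.Quotient.mk I (monomial (stair n n) 1))
      (psiLongest K ℓ n * ev K ℓ n f) = (c : ℤ) • Ideal.Quotient.mk I f := by
  obtain ⟨c, hc⟩ := exists_yStair_mul_psiLongest (K := K) (ℓ := ℓ) (n := n)
  refine ⟨c, fun f => ?_⟩
  have h := orbit_eq_zero_of_mem_psiIdeal hst hℓ hc
  rw [map_sub, sub_eq_zero, orbit_mul, ← map_one (Ideal.Quotient.mk I), orbit_ev, mul_one,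
    ← zsmul_one, map_zsmul, orbit_one] at h
  rw [orbit_mul, h, ← map_zsmul, orbit_ev, mul_smul_comm, mul_one, map_zsmul]

theorem IsDemazureStable.demazure_mem {hst : IsDemazureStable I} (a b : Fin n) (hab : a ≠ b)
    (h : b.val = a.val + 1) {f : MvPolynomial (Fin n) K} (hf : f ∈ I) : demazure hab f ∈ I := by
  have hr : a.val < n - 1 := by omega
  obtain rfl : b = sndStrand ⟨a, hr⟩ := Fin.ext h
  exact hst ⟨a, hr⟩ f hf

end Orbit

/-! ### The coinvariant representation -/

section Coinvariant

variable {K : Type u} [Field K] {ℓ n : ℕ}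

theorem X_pow_mem_formIdeal_self (hn : n ≤ ℓ) (p : Fin n → ℕ) (k : Fin n) (_ : k.val = 0) :
    X k ^ ℓ ∈ formIdeal K ℓ p :=
  X_pow_mem_formIdeal hn (fun _ => Nat.le_add_left _ _) k

variable (K ℓ n) in
/-- The ideal defining the coinvariant algebra. -/
noncomputable abbrev coinvIdeal : Ideal (MvPolynomial (Fin n) K) :=
  formIdeal K ℓ fun i => ℓ - n + i

/-- All exponents of this alternant are at least $\ell-n$, so already the $n$-th powers of the
variables lie in the ideal, and the staircase starts from $m=n$ rather than $m=\ell$. -/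
theorem completeHomog_mem_coinvIdeal (hn : n ≤ ℓ) (i : ℕ) (hi : i < n) :
    completeHomog (var K n) (i + 1) (n - i) ∈ coinvIdeal K ℓ n :=
  completeHomog_mem_of_stable
    (fun a b hab h _ hf =>
      IsDemazureStable.demazure_mem (hst := formIdeal_isDemazureStable ℓ _) a b hab h hf)
    (fun k _ => X_pow_mem_formIdeal hn (fun j => by omega) k) le_rfl i hi

theorem stair_notMem_coinvIdeal (hn : n ≤ ℓ) : monomial (stair n n) 1 ∉ coinvIdeal K ℓ n := by
  intro h
  have h1 := coeffForm_eq_zero h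
  have h2 := coeffForm_monomial (K := K) (ℓ := ℓ) (p := fun i : Fin n => ℓ - n + i)
    (fun i j hij => Fin.ext (by simpa using hij)) (fun i => by omega)
  have h3 : (Finsupp.equivFunOnFinite.symm fun i : Fin n => ℓ - 1 - (ℓ - n + i)) = stair n n := by
    ext i
    simp only [stair_apply, Finsupp.equivFunOnFinite_symm_apply_apply]
    omega
  rw [h3, h1] at h2
  exact zero_ne_one h2

variable (K) in
/-- The right action on the socle of the coinvariant algebra. -/
noncomputable def socleMap (hn : n ≤ ℓ) :
    Alg K ℓ n →ₗ[K] MvPolynomial (Fin n) K ⧸ coinvIdeal K ℓ n :=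
  orbit (formIdeal_isDemazureStable ℓ _) (X_pow_mem_formIdeal_self hn _)
    (Ideal.Quotient.mk _ (monomial (stair n n) 1))

theorem finrank_coinvariant (hn : n ≤ ℓ) :
    Module.finrank K (MvPolynomial (Fin n) K ⧸ coinvIdeal K ℓ n) = n.factorial := by
  rw [finrank_quotient_staircase (completeHomog_mem_coinvIdeal hn) le_rfl
    (stair_notMem_coinvIdeal hn), Nat.descFactorial_self]

theorem socleMap_surjective (hn : n ≤ ℓ) : Function.Surjective (socleMap K hn) := by
  intro x
  obtain ⟨f, rfl⟩ := Ideal.Quotient.mk_surjective x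
  obtain ⟨c, hc⟩ := exists_orbit_stair (formIdeal_isDemazureStable ℓ _)
    (X_pow_mem_formIdeal_self (K := K) hn fun i => ℓ - n + i)
  refine ⟨psiLongest K ℓ n * ev K ℓ n ((c : ℤ) • f), ?_⟩
  rw [socleMap, hc, map_zsmul, smul_smul]
  rcases Int.units_eq_one_or c with h | h <;> simp [h]

theorem socleMap_eq_zero_of_mem (hn : n ≤ ℓ) {a : Alg K ℓ n} (ha : a ∈ yIdeal K ℓ n) :
    socleMap K hn a = 0 := by
  refine orbit_eq_zero_of_mem_span _ _ ?_ ha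
  rintro _ ⟨k, rfl⟩
  rw [← ev_X, orbit_ev, mul_comm]
  exact Ideal.Quotient.eq_zero_iff_mem.2
    (stair_mul_X_mem (completeHomog_mem_coinvIdeal hn) le_rfl k)

/-- Dimension count: the induced map goes from $H/Y$, of dimension at most $n!$, onto the
coinvariant algebra, of dimension exactly $n!$. -/
theorem socleMap_eq_zero_iff (hn : n ≤ ℓ) {a : Alg K ℓ n} :
    socleMap K hn a = 0 ↔ a ∈ yIdeal K ℓ n := by
  refine ⟨fun h => ?_, socleMap_eq_zero_of_mem hn⟩
  let g := ((yIdeal K ℓ n).restrictScalars K).liftQ (socleMap K hn)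
    fun a ha => socleMap_eq_zero_of_mem hn ha
  have hg : Function.Surjective g := by
    intro x
    obtain ⟨a, ha⟩ := socleMap_surjective hn x
    exact ⟨Submodule.Quotient.mk a, ha⟩
  have : Module.Finite K (MvPolynomial (Fin n) K ⧸ coinvIdeal K ℓ n) :=
    Module.Finite.of_surjective g hg
  have hle := LinearMap.finrank_le_finrank_of_surjective hg
  have hfr : Module.finrank K (Alg K ℓ n ⧸ (yIdeal K ℓ n).restrictScalars K) =
      Module.finrank K (MvPolynomial (Fin n) K ⧸ coinvIdeal K ℓ n) := by
    refine le_antisymm ?_ hle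
    rw [finrank_coinvariant hn]
    exact finrank_quotient_yIdeal_le
  have hinj := (LinearMap.injective_iff_surjective_of_finrank_eq_finrank hfr).2 hg
  have : Submodule.Quotient.mk (p := (yIdeal K ℓ n).restrictScalars K) a = 0 :=
    hinj (by rw [map_zero]; exact h)
  exact (Submodule.Quotient.mk_eq_zero _).1 this

/-- The image of $1$ is the staircase class, which is a multiple of every nonzero class. This is the
simplicity of $H/Y$ in terms of elements. -/
theorem exists_mul_sub_one_mem_yIdeal (hn : n ≤ ℓ) {a : Alg K ℓ n} (ha : a ∉ yIdeal K ℓ n) :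
    ∃ b, a * b - 1 ∈ yIdeal K ℓ n := by
  rw [← socleMap_eq_zero_iff hn] at ha
  obtain ⟨f, hf⟩ := Ideal.Quotient.mk_surjective (socleMap K hn a)
  have hfI : f ∉ coinvIdeal K ℓ n := fun h => ha (by rw [← hf, Ideal.Quotient.eq_zero_iff_mem.2 h])
  obtain ⟨g, hg⟩ := exists_mul_sub_stair_mem (completeHomog_mem_coinvIdeal hn) le_rfl hfI
  refine ⟨ev K ℓ n g, ?_⟩
  have h1 : socleMap K hn (a * ev K ℓ n g) = orbit _ _ (socleMap K hn a) (ev K ℓ n g) :=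
    orbit_mul _ _ _ _ _
  have h2 : socleMap K hn 1 = _ := orbit_one _ _ _
  rw [← socleMap_eq_zero_iff hn, map_sub, sub_eq_zero, h1, h2, ← hf, orbit_ev, mul_comm]
  exact Ideal.Quotient.eq.2 hg

theorem psiLongest_notMem_yIdeal (hn : n ≤ ℓ) : psiLongest K ℓ n ∉ yIdeal K ℓ n := by
  intro h
  obtain ⟨c, hc⟩ := exists_orbit_stair (formIdeal_isDemazureStable ℓ _)
    (X_pow_mem_formIdeal_self (K := K) hn fun i => ℓ - n + i)
  have h1 := hc 1
  rw [map_one (ev K ℓ n), mul_one] at h1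
  replace h1 := (socleMap_eq_zero_of_mem hn h).symm.trans h1
  have h2 : Ideal.Quotient.mk (coinvIdeal K ℓ n) 1 = 0 := by
    rcases Int.units_eq_one_or c with h | h
    · simpa [h] using h1.symm
    · simpa [h] using h1.symm
  refine stair_notMem_coinvIdeal (K := K) hn ?_
  rw [← mul_one (monomial (stair n n) (1 : K))]
  exact Ideal.mul_mem_left _ _ (Ideal.Quotient.eq_zero_iff_mem.1 h2)

theorem finrank_quotient_yIdeal (hn : n ≤ ℓ) :
    Module.finrank K (Alg K ℓ n ⧸ (yIdeal K ℓ n).restrictScalars K) = n.factorial := by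
  have hker : LinearMap.ker (socleMap K hn) = (yIdeal K ℓ n).restrictScalars K := by
    ext a
    exact socleMap_eq_zero_iff hn
  rw [← finrank_coinvariant (K := K) hn, ← hker]
  exact ((socleMap K hn).quotKerEquivOfSurjective (socleMap_surjective hn)).finrank_eq

end Coinvariant

end CycNilHecke

namespace CycNilHecke

open MvPolynomial

/-! ### The cellular ideals -/

section CellIdeal

variable {K : Type u} [Field K] {ℓ n : ℕ}

theorem theta_strictMono (μ : Multipartition ℓ n) : StrictMono (theta μ) := by
  intro i j h
  have := (μ.1.orderEmbOfFin μ.2).strictMono h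
  simp only [theta]
  omega

theorem one_le_theta (μ : Multipartition ℓ n) (i : Fin n) : 1 ≤ theta μ i :=
  Nat.le_add_left _ _

theorem theta_le (μ : Multipartition ℓ n) (i : Fin n) : theta μ i ≤ ℓ := by
  have := (μ.1.orderEmbOfFin μ.2 i).2
  simp only [theta]
  omega

theorem card_le_of_multipartition (μ : Multipartition ℓ n) : n ≤ ℓ := by
  simpa [μ.2] using Finset.card_le_univ μ.1

/-- A strictly decreasing sequence below `ℓ` comes from a multipartition. -/
theorem exists_theta_eq {b : Fin n → ℕ} (hb : StrictAnti b) (hℓ : ∀ i, b i < ℓ) :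
    ∃ lam : Multipartition ℓ n, ∀ i, theta lam i = ℓ - b i := by
  let f : Fin n → Fin ℓ := fun i => ⟨ℓ - 1 - b i, by have := hℓ i; omega⟩
  have hf : StrictMono f := by
    intro i j h
    have h1 := hb h
    have h2 := hℓ i
    simp only [f, Fin.mk_lt_mk]
    omega
  refine ⟨⟨Finset.univ.image f, by
    rw [Finset.card_image_of_injective _ hf.injective, Finset.card_univ, Fintype.card_fin]⟩,
    fun i => ?_⟩
  have h := Finset.orderEmbOfFin_unique (s := Finset.univ.image f) (k := n) (by
    rw [Finset.card_image_of_injective _ hf.injective, Finset.card_univ, Fintype.card_fin])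
    (f := f) (fun x => Finset.mem_image_of_mem _ (Finset.mem_univ x)) hf
  have h2 := hℓ i
  simp only [theta, ← h, f]
  omega

/-- The exponent of `y_μ`. -/
noncomputable def yExp (μ : Multipartition ℓ n) : Fin n →₀ ℕ :=
  Finsupp.equivFunOnFinite.symm fun i => ℓ - theta μ i

theorem yExp_apply (μ : Multipartition ℓ n) (i : Fin n) : yExp μ i = ℓ - theta μ i := rfl

theorem monomial_one_eq_prod (b : Fin n →₀ ℕ) :
    monomial b (1 : K) = ∏ i, X i ^ b i := by
  rw [monomial_eq, Finsupp.prod_fintype _ _ fun i => pow_zero _, C_1, one_mul]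

theorem yElt_eq_ev (μ : Multipartition ℓ n) : yElt K μ = ev K ℓ n (monomial (yExp μ) 1) := by
  rw [monomial_one_eq_prod, ← List.prod_ofFn, map_list_prod, List.map_ofFn, yElt]
  congr 2
  funext i
  simp [yExp_apply]

/-- First $\psi_r(zy_r)\psi_r=z\psi_r(\psi_ry_{r+1}-1)=-z\psi_r$ puts $z\psi_r$ in `T`; then
$z=z\psi_ry_{r+1}-zy_r\psi_r$. The lemma serves to break a tie between two neighbouring exponents.
-/
theorem mem_of_commute_psi {T : TwoSidedIdeal (Alg K ℓ n)} {z : Alg K ℓ n} {r : Fin (n - 1)}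
    (hz : z * psi K ℓ r = psi K ℓ r * z) (h : z * y K ℓ (fstStrand r) ∈ T) : z ∈ T := by
  have h1 : psi K ℓ r * (z * y K ℓ (fstStrand r)) * psi K ℓ r = -(z * psi K ℓ r) := by
    have : y K ℓ (fstStrand r) * psi K ℓ r = psi K ℓ r * y K ℓ (sndStrand r) - 1 := by
      rw [psi_mul_y_snd, add_sub_cancel_right]
    rw [← mul_assoc, ← hz, mul_assoc, mul_assoc, this, mul_sub, ← mul_assoc (psi K ℓ r),
      psi_mul_self, zero_mul, zero_sub, mul_one, mul_neg]
  have h2 : z * psi K ℓ r ∈ T := by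
    rw [← neg_mem_iff, ← h1]
    exact T.mul_mem_right _ _ (T.mul_mem_left _ _ h)
  have h3 : z = z * psi K ℓ r * y K ℓ (sndStrand r) - z * y K ℓ (fstStrand r) * psi K ℓ r := by
    rw [mul_assoc, psi_mul_y_snd, mul_add, mul_one, mul_assoc, add_sub_cancel_left]
  rw [h3]
  exact sub_mem (T.mul_mem_right _ _ h2) (T.mul_mem_right _ _ h)

/-- If all entries are below $\ell$, the monomial is $y_\lambda$ for some $\lambda>\mu$; an entry at
least $\ell$ makes it zero. -/
theorem ev_monomial_mem_of_strictAnti {μ : Multipartition ℓ n} {b : Fin n →₀ ℕ}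
    (hle : yExp μ ≤ b) (hne : yExp μ ≠ b) (hb : StrictAnti b) :
    ev K ℓ n (monomial b 1) ∈ cellIdeal K μ := by
  by_cases hℓ : ∀ i, b i < ℓ
  · obtain ⟨lam, hlam⟩ := exists_theta_eq hb hℓ
    have hexp : yExp lam = b := by
      ext i
      have := hℓ i
      rw [yExp_apply, hlam]
      omega
    refine TwoSidedIdeal.subset_span ⟨lam, [], [], ⟨fun i => ?_, fun h => hne ?_⟩, fun _ _ =>
      Nat.zero_le _, fun _ _ => Nat.zero_le _, ?_⟩
    · have h1 := hle i
      have h2 := theta_le μ i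
      have h3 := hlam i
      rw [yExp_apply] at h1
      omega
    · rw [← hexp]
      ext i
      rw [yExp_apply, yExp_apply, h]
    · rw [yElt_eq_ev, hexp]
      simp [psiWord, inv_one]
  · push Not at hℓ
    obtain ⟨i, hi⟩ := hℓ
    have : Finsupp.single i ℓ ≤ b := Finsupp.single_le_iff.2 hi
    obtain ⟨c, rfl⟩ := exists_add_of_le this
    rw [← monomial_one_mul, map_mul, ← X_pow_eq_monomial, map_pow, ev_X, y_pow_eq_zero, zero_mul]
    exact zero_mem _

/-- The exponent may have one tie, between positions $k-1$ and $k$. A tied monomial is symmetric in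
these two strands and commutes with the $\psi$ between them, so by `mem_of_commute_psi` the earlier
exponent may be raised by one. The only possible tie then lies one place further left, and at $k=0$
none is left. -/
theorem ev_monomial_mem_cellIdeal {μ : Multipartition ℓ n} (k : ℕ) {b : Fin n →₀ ℕ}
    (hle : yExp μ ≤ b) (hne : yExp μ ≠ b) (hb : ∀ i j, i < j → b j ≤ b i)
    (hb' : ∀ i j, i < j → i.val + 1 ≠ k ∨ j.val ≠ k → b j < b i) :
    ev K ℓ n (monomial b 1) ∈ cellIdeal K μ := by
  induction k generalizing b with
  | zero => exact ev_monomial_mem_of_strictAnti hle hne fun i j h => hb' i j h (by omega)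
  | succ k ih =>
    by_cases hk : ∃ h : k + 1 < n, b ⟨k + 1, h⟩ = b ⟨k, by omega⟩
    swap
    · refine ev_monomial_mem_of_strictAnti hle hne fun i j h => ?_
      by_cases h' : i.val + 1 ≠ k + 1 ∨ j.val ≠ k + 1
      · exact hb' i j h h'
      · have hi : i.val = k := by omega
        have hj : j.val = k + 1 := by omega
        refine lt_of_le_of_ne (hb i j h) fun e => hk ⟨by omega, ?_⟩
        convert e using 2 <;> exact Fin.ext (by simp only; omega)
    obtain ⟨hk, he⟩ := hk
    let r : Fin (n - 1) := ⟨k, by omega⟩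
    have he' : b (sndStrand r) = b (fstStrand r) := he
    refine mem_of_commute_psi (r := r) ?_ ?_
    · have hs : swapVar (fstStrand r) (sndStrand r) (monomial b (1 : K)) = monomial b 1 := by
        rw [swapVar, rename_monomial, ← Finsupp.equivMapDomain_eq_mapDomain]
        refine congrArg (fun b => monomial b (1 : K)) ?_
        ext i
        rw [Finsupp.equivMapDomain_apply, Equiv.symm_swap]
        by_cases h1 : i = fstStrand r
        · rw [h1, Equiv.swap_apply_left, he']
        by_cases h2 : i = sndStrand r
        · rw [h2, Equiv.swap_apply_right, he']
        · rw [Equiv.swap_apply_of_ne_of_ne h1 h2]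
      rw [ev_mul_psi, hs, simpleDemazure, demazure_eq_zero _ hs, map_zero, add_zero]
    · rw [← ev_X, ← map_mul, X, monomial_one_mul]
      have hval : ∀ i, (b + Finsupp.single (fstStrand r) 1 : Fin n →₀ ℕ) i =
          b i + if i.val = k then 1 else 0 := by
        intro i
        rw [Finsupp.add_apply, Finsupp.single_apply]
        congr 2
        simp only [fstStrand, Fin.ext_iff, r, eq_comm]
      refine ih (hle.trans (le_add_of_nonneg_right (zero_le))) ?_ ?_ ?_
      · intro h
        have h1 := DFunLike.congr_fun h (fstStrand r)
        rw [hval, if_pos (show (fstStrand r).val = k from rfl)] at h1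
        have h2 := hle (fstStrand r)
        omega
      · intro i j hij
        rw [hval, hval]
        have h1 := hb i j hij
        have h2 := hb' i j hij
        have hij' := Fin.lt_def.1 hij
        split_ifs <;> omega
      · intro i j hij h
        rw [hval, hval]
        have h1 := hb i j hij
        have h2 := hb' i j hij
        have hij' := Fin.lt_def.1 hij
        -- Entry `k` has been raised by one. For `i` before position `k - 1`, two strict
        -- inequalities through that position leave room for it.
        by_cases hj : j.val = k
        · have h3 := hb' i ⟨k - 1, by omega⟩ (Fin.lt_def.2 (by simp only; omega))
            (by simp only; omega)
          have h4 := hb' ⟨k - 1, by omega⟩ j (Fin.lt_def.2 (by simp only; omega))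
            (by simp only; omega)
          split_ifs <;> omega
        · by_cases hi : i.val = k
          · rw [if_pos hi, if_neg hj]
            omega
          · rw [if_neg hi, if_neg hj]
            have := h2 (by omega)
            omega

/-- The exponents of $y_\mu$ decrease strictly, so raising the one at `k` creates at most a tie with
its left neighbour. -/
theorem yElt_mul_y_mem_cellIdeal (μ : Multipartition ℓ n) (k : Fin n) :
    yElt K μ * y K ℓ k ∈ cellIdeal K μ := by
  have hval : ∀ i, (yExp μ + Finsupp.single k 1 : Fin n →₀ ℕ) i =
      yExp μ i + if i.val = k.val then 1 else 0 := by
    intro i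
    rw [Finsupp.add_apply, Finsupp.single_apply]
    congr 2
    simp only [Fin.ext_iff, eq_comm]
  have hlt : ∀ i j, i < j → yExp μ j < yExp μ i := by
    intro i j h
    have h1 := theta_strictMono μ h
    have h2 := theta_le μ j
    rw [yExp_apply, yExp_apply]
    omega
  rw [yElt_eq_ev, ← ev_X, ← map_mul, X, monomial_one_mul]
  refine ev_monomial_mem_cellIdeal k.val (le_add_of_nonneg_right (zero_le)) ?_ ?_ ?_
  · intro h
    have h1 := DFunLike.congr_fun h k
    rw [hval, if_pos rfl] at h1
    omega
  · intro i j hij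
    rw [hval, hval]
    have := hlt i j hij
    split_ifs <;> omega
  · intro i j hij h
    rw [hval, hval]
    have h1 := hlt i j hij
    have hij' := Fin.lt_def.1 hij
    by_cases hj : j.val = k.val
    · have h3 := hlt i ⟨k - 1, by omega⟩ (Fin.lt_def.2 (by simp only; omega))
      have h4 := hlt ⟨k - 1, by omega⟩ j (Fin.lt_def.2 (by simp only; omega))
      split_ifs <;> omega
    · rw [if_neg hj]
      omega

/-! ### A functional separating `y_μ` from the ideal above `μ` -/

/-- The linear form induced by `coeffForm` on the quotient by `formIdeal`. -/
noncomputable def quotForm (ℓ : ℕ) (p : Fin n → ℕ) :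
    MvPolynomial (Fin n) K ⧸ formIdeal K ℓ p →ₗ[K] K :=
  ((formIdeal K ℓ p).restrictScalars K).liftQ (coeffForm K ℓ p) (fun _ hf => coeffForm_eq_zero hf)
    ∘ₗ (Submodule.Quotient.restrictScalarsEquiv K (formIdeal K ℓ p)).symm.toLinearMap

theorem quotForm_mk (ℓ : ℕ) (p : Fin n → ℕ) (f : MvPolynomial (Fin n) K) :
    quotForm ℓ p (Ideal.Quotient.mk _ f) = coeffForm K ℓ p f := rfl

variable (K) in
/-- The action on the polynomial representation defined by an alternant. -/
noncomputable abbrev formRep (hn : n ≤ ℓ) (p : Fin n → ℕ) :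
    Alg K ℓ n →ₐ[K] Module.End K (MvPolynomial (Fin n) K ⧸ formIdeal K ℓ p) :=
  rep (formIdeal_isDemazureStable ℓ p) (X_pow_mem_formIdeal_self hn p)

variable (K) in
/-- The right action on the generator of the polynomial representation defined by an alternant. -/
noncomputable abbrev formOrbit (hn : n ≤ ℓ) (p : Fin n → ℕ) :
    Alg K ℓ n →ₗ[K] MvPolynomial (Fin n) K ⧸ formIdeal K ℓ p :=
  orbit (formIdeal_isDemazureStable ℓ p) (X_pow_mem_formIdeal_self hn p) 1

/-- The generators are fixed by `inv` and act self-adjointly: the $\psi_r$ by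
`coeffForm_demazure_mul`, the $y_k$ as multiplications. -/
theorem quotForm_rep_mul (hn : n ≤ ℓ) (p : Fin n → ℕ) (a : Alg K ℓ n)
    (x z : MvPolynomial (Fin n) K ⧸ formIdeal K ℓ p) :
    quotForm ℓ p (formRep K hn p a x * z) = quotForm ℓ p (x * formRep K hn p (inv a) z) := by
  induction a using alg_induction generalizing x z with
  | one => simp [inv_one]
  | add a b ha hb =>
    rw [map_add, LinearMap.add_apply, add_mul, map_add, ha, hb, inv_add, map_add,
      LinearMap.add_apply, mul_add, map_add]
  | smul c a ha =>
    rw [map_smul, LinearMap.smul_apply, smul_mul_assoc, map_smul, ha, inv_smul, map_smul,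
      LinearMap.smul_apply, mul_smul_comm, map_smul]
  | psi a r ha =>
    rw [map_mul (formRep K hn p), Module.End.mul_apply, ha, inv_mul, map_mul (formRep K hn p),
      Module.End.mul_apply]
    obtain ⟨f, rfl⟩ := Ideal.Quotient.mk_surjective x
    obtain ⟨g, hg⟩ := Ideal.Quotient.mk_surjective (formRep K hn p (inv a) z)
    rw [← hg, psi, inv_gen, ← psi, rep_psi, rep_psi, ← map_mul, ← map_mul, quotForm_mk,
      quotForm_mk, simpleDemazure, coeffForm_demazure_mul]
  | y a k ha =>
    rw [map_mul (formRep K hn p), Module.End.mul_apply, ha, inv_mul, map_mul (formRep K hn p),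
      Module.End.mul_apply]
    obtain ⟨f, rfl⟩ := Ideal.Quotient.mk_surjective x
    obtain ⟨g, hg⟩ := Ideal.Quotient.mk_surjective (formRep K hn p (inv a) z)
    rw [← hg, y, inv_gen, ← y, rep_y, rep_y, ← map_mul, ← map_mul, mul_assoc, mul_left_comm]

/-- Adjointness moves `b` to the other side, leaving the form of the monomial of $y_\lambda$ times a
polynomial. Since $\theta(\lambda)\le\theta(\mu)$ with one strict inequality,
$\sum(\theta(\mu)_i-1)+\sum(\ell-\theta(\lambda)_i)>n(\ell-1)$ and the degree count applies. -/
theorem quotForm_formOrbit_eq_zero {lam μ : Multipartition ℓ n} (h : Dominates lam μ)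
    (hn : n ≤ ℓ) (a b : Alg K ℓ n) :
    quotForm ℓ (fun i => theta μ i - 1)
      (formOrbit K hn (fun i => theta μ i - 1) (a * yElt K lam * b)) = 0 := by
  rw [formOrbit, orbit_mul, orbit_mul, orbit_apply (a := b), ← mul_one (rep _ _ (inv b) _),
    quotForm_rep_mul hn]
  obtain ⟨f, hf⟩ := Ideal.Quotient.mk_surjective
    (formOrbit K hn (fun i => theta μ i - 1) a)
  obtain ⟨g, hg⟩ := Ideal.Quotient.mk_surjective
    (formRep K hn (fun i => theta μ i - 1) (inv (inv b)) 1)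
  rw [← hf, ← hg, yElt_eq_ev, orbit_ev, ← map_mul, quotForm_mk, mul_assoc]
  refine coeffForm_monomial_mul_eq_zero ?_ _
  obtain ⟨h1, h2⟩ := h
  obtain ⟨i, hi⟩ := Function.ne_iff.1 h2
  have hlt : ∑ i : Fin n, (ℓ - 1) < ∑ i, ((theta μ i - 1) + yExp lam i) := by
    refine Finset.sum_lt_sum (fun i _ => ?_) ⟨i, Finset.mem_univ _, ?_⟩
    · have := h1 i
      have := one_le_theta lam i
      have := theta_le μ i
      rw [yExp_apply]
      omega
    · have := h1 i
      have := one_le_theta lam i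
      have := theta_le μ i
      rw [yExp_apply]
      omega
  simpa [Finset.sum_add_distrib] using hlt

theorem quotForm_eq_zero_of_mem_cellIdeal {μ : Multipartition ℓ n} (hn : n ≤ ℓ) {x : Alg K ℓ n}
    (hx : x ∈ cellIdeal K μ) :
    quotForm ℓ (fun i => theta μ i - 1) (formOrbit K hn (fun i => theta μ i - 1) x) = 0 := by
  -- Quantifying over all two-sided multiples makes the absorption cases of the ideal induction
  -- immediate.
  suffices h : ∀ a b, quotForm ℓ (fun i => theta μ i - 1)
      (formOrbit K hn (fun i => theta μ i - 1) (a * x * b)) = 0 by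
    simpa using h 1 1
  have hx' : x ∈ TwoSidedIdeal.span (cellularElts K μ) := hx
  clear hx
  induction hx' using TwoSidedIdeal.span_induction with
  | mem x h =>
    obtain ⟨lam, w, u, h, -, -, rfl⟩ := h
    intro a b
    rw [show a * (inv (psiWord K ℓ w) * yElt K lam * psiWord K ℓ u) * b =
      (a * inv (psiWord K ℓ w)) * yElt K lam * (psiWord K ℓ u * b) by simp only [mul_assoc]]
    exact quotForm_formOrbit_eq_zero h hn _ _
  | zero => simp
  | add x z _ _ hx hz => intro a b; rw [mul_add, add_mul, map_add, map_add, hx, hz, add_zero]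
  | neg x _ hx => intro a b; rw [mul_neg, neg_mul, map_neg, map_neg, hx, neg_zero]
  | left_absorb c x _ hx => intro a b; rw [← mul_assoc]; exact hx _ _
  | right_absorb c x _ hx => intro a b; rw [← mul_assoc, mul_assoc]; exact hx _ _

/-- The vector $1$ is killed by `psiIdeal`, so `e` fixes it. The exponent of $y_\mu$ complements
$\theta(\mu)-1$ to $\ell-1$ and hence picks out the diagonal term of the alternant. -/
theorem quotForm_mul_yElt (μ : Multipartition ℓ n) (hn : n ≤ ℓ) {e : Alg K ℓ n}
    (he : 1 - e ∈ psiIdeal K ℓ n) : quotForm ℓ (fun i => theta μ i - 1)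
      (formOrbit K hn (fun i => theta μ i - 1) (e * yElt K μ)) = 1 := by
  have h1 := orbit_eq_zero_of_mem_psiIdeal (formIdeal_isDemazureStable ℓ fun i => theta μ i - 1)
    (X_pow_mem_formIdeal_self hn _) he
  rw [map_sub, orbit_one, sub_eq_zero] at h1
  rw [formOrbit, orbit_mul, ← h1, yElt_eq_ev, ← map_one (Ideal.Quotient.mk _), orbit_ev, mul_one,
    quotForm_mk]
  have h2 : yExp μ = Finsupp.equivFunOnFinite.symm fun i => ℓ - 1 - (theta μ i - 1) := by
    ext i
    have := one_le_theta μ i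
    rw [yExp_apply, Finsupp.equivFunOnFinite_symm_apply_apply]
    omega
  rw [h2]
  refine coeffForm_monomial (fun i j hij => (theta_strictMono μ).injective ?_) fun i => ?_
  · have := one_le_theta μ i
    have := one_le_theta μ j
    omega
  · have := one_le_theta μ i
    have := theta_le μ i
    omega

/-- With $e=1$ this shows that Specht generators are nonzero; with the idempotent it gives the
nondegeneracy behind $D_0$ and the lower bound on $\dim eH$. -/
theorem mul_yElt_notMem_cellIdeal (μ : Multipartition ℓ n) {e : Alg K ℓ n}
    (he : 1 - e ∈ psiIdeal K ℓ n) : e * yElt K μ ∉ cellIdeal K μ := fun h => by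
  have hn := card_le_of_multipartition μ
  have := quotForm_eq_zero_of_mem_cellIdeal hn h
  rw [quotForm_mul_yElt μ hn he] at this
  exact one_ne_zero this

theorem yElt_notMem_cellIdeal (μ : Multipartition ℓ n) : yElt K μ ∉ cellIdeal K μ := by
  have := mul_yElt_notMem_cellIdeal (K := K) μ (e := 1) (by simp)
  rwa [one_mul] at this

end CellIdeal

end CycNilHecke

/-! ### Homogeneous components -/

namespace GradedRightModule

variable {K A : Type u} [Field K] [Ring A] [Algebra K A] {𝒜 : ℤ → Submodule K A}

theorem iSup_piece (M : GradedRightModule 𝒜) : ⨆ d, M.piece d = ⊤ :=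
  ((DirectSum.isInternal_submodule_iff_iSupIndep_and_iSup_eq_top _).1 M.isInternal).2

/-- The projection to a homogeneous component. -/
noncomputable def proj (M : GradedRightModule 𝒜) (d : ℤ) : M →ₗ[K] M :=
  (M.piece d).subtype ∘ₗ DirectSum.component K ℤ (fun d => M.piece d) d ∘ₗ
    (LinearEquiv.ofBijective (DirectSum.coeLinearMap M.piece) M.isInternal).symm.toLinearMap

theorem proj_mem (M : GradedRightModule 𝒜) (d : ℤ) (x : M) : M.proj d x ∈ M.piece d :=
  Subtype.mem _

theorem proj_of_mem {M : GradedRightModule 𝒜} {e : ℤ} (d : ℤ) {x : M} (hx : x ∈ M.piece e) :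
    M.proj d x = if e = d then x else 0 := by
  have h : (LinearEquiv.ofBijective (DirectSum.coeLinearMap M.piece) M.isInternal).symm x =
      DirectSum.lof K ℤ (fun d => M.piece d) e ⟨x, hx⟩ := by
    rw [LinearEquiv.symm_apply_eq]
    exact (DirectSum.coeLinearMap_lof M.piece e ⟨x, hx⟩).symm
  rw [proj, LinearMap.comp_apply, LinearMap.comp_apply, LinearEquiv.coe_coe, h]
  split_ifs with hd
  · subst hd
    rw [DirectSum.component.lof_self]
    rfl
  · rw [DirectSum.component.of, dif_neg hd]
    rfl

theorem proj_eq_self {M : GradedRightModule 𝒜} {d : ℤ} {x : M} (hx : x ∈ M.piece d) :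
    M.proj d x = x := by
  rw [proj_of_mem d hx, if_pos rfl]

/-- Induction over sums of homogeneous elements. -/
theorem homogeneous_induction {M : GradedRightModule 𝒜} {p : M → Prop} (zero : p 0)
    (add : ∀ x z, p x → p z → p (x + z)) (mem : ∀ d, ∀ x ∈ M.piece d, p x) (x : M) : p x := by
  have hx : x ∈ ⨆ d, M.piece d := M.iSup_piece ▸ Submodule.mem_top
  induction hx using Submodule.iSup_induction' with
  | mem d x hx => exact mem d x hx
  | zero => exact zero
  | add x z _ _ hx hz => exact add x z hx hz

theorem IsGradedHom.map_proj {M N : GradedRightModule 𝒜} {f : M →ₗ[Aᵐᵒᵖ] N}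
    (hf : IsGradedHom f) (d : ℤ) (x : M) : f (M.proj d x) = N.proj d (f x) := by
  induction x using homogeneous_induction with
  | zero => simp only [map_zero]
  | add x z hx hz => simp only [map_add, hx, hz]
  | mem e x hx =>
    rw [proj_of_mem d hx, proj_of_mem d (hf e x hx)]
    split_ifs
    · rfl
    · exact map_zero f

theorem IsHomogeneous.proj_mem {M : GradedRightModule 𝒜} {N : Submodule Aᵐᵒᵖ M}
    (hN : IsHomogeneous N) (d : ℤ) {x : M} (hx : x ∈ N) : M.proj d x ∈ N := by
  have hx' := hN hx
  clear hx
  induction hx' using Submodule.iSup_induction' with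
  | mem e x hx =>
    rw [proj_of_mem d hx.2]
    split_ifs
    · exact hx.1
    · exact N.zero_mem
  | zero => rw [map_zero]; exact N.zero_mem
  | add x z _ _ hx hz => rw [map_add]; exact N.add_mem hx hz

theorem IsGradedHom.range_isHomogeneous {M N : GradedRightModule 𝒜} {f : M →ₗ[Aᵐᵒᵖ] N}
    (hf : IsGradedHom f) : IsHomogeneous (LinearMap.range f) := by
  rintro _ ⟨x, rfl⟩
  induction x using homogeneous_induction with
  | zero => rw [map_zero]; exact Submodule.zero_mem _
  | add x z hx hz => rw [map_add]; exact Submodule.add_mem _ hx hz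
  | mem d x hx => exact Submodule.mem_iSup_of_mem d ⟨⟨x, rfl⟩, hf d x hx⟩

theorem IsGradedHom.exists_preimage {M N : GradedRightModule 𝒜} {f : M →ₗ[Aᵐᵒᵖ] N}
    (hf : IsGradedHom f) (hs : Function.Surjective f) {d : ℤ} {x : N} (hx : x ∈ N.piece d) :
    ∃ m ∈ M.piece d, f m = x := by
  obtain ⟨m, rfl⟩ := hs x
  exact ⟨M.proj d m, M.proj_mem d m, by rw [hf.map_proj, proj_eq_self hx]⟩

/-- Two projective covers map onto each other. -/
theorem IsProjectiveCover.exists_surjective {P Q D : GradedRightModule 𝒜}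
    (hP : P.IsProjectiveCover D) (hQ : Q.IsProjectiveCover D) :
    ∃ h : P →ₗ[Aᵐᵒᵖ] Q, Function.Surjective h := by
  obtain ⟨hproj, f, hf, hfs, -⟩ := hP
  obtain ⟨-, g, hg, hgs, hess⟩ := hQ
  obtain ⟨h, hh, hgh⟩ := hproj Q D g f hg hgs hf
  refine ⟨h, LinearMap.range_eq_top.1 (hess _ hh.range_isHomogeneous ?_)⟩
  rw [eq_top_iff]
  rintro x -
  obtain ⟨p, hp⟩ := hfs (g x)
  rw [← add_sub_cancel (h p) x]
  refine Submodule.add_mem_sup ⟨p, rfl⟩ ?_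
  rw [LinearMap.mem_ker, map_sub, ← hp, ← hgh, LinearMap.comp_apply, sub_self]

theorem op_smul_smul_assoc (M : GradedRightModule 𝒜) (c : K) (a : A) (x : M) :
    op (c • a) • x = c • op a • x := by
  rw [op_smul, smul_assoc]

/-- The restriction of scalars to the ground field. -/
def toFieldLinear {M N : GradedRightModule 𝒜} (f : M →ₗ[Aᵐᵒᵖ] N) : M →ₗ[K] N where
  toFun := f
  map_add' := map_add f
  map_smul' c x := by
    have h : ∀ (L : GradedRightModule 𝒜) (z : L), c • z = op (c • (1 : A)) • z := fun L z => by
      rw [op_smul_smul_assoc, op_one, one_smul]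
    rw [RingHom.id_apply, h M, h N, map_smul]

theorem IsProjectiveCover.finrank_eq {P Q D : GradedRightModule 𝒜} [Module.Finite K P]
    (hP : P.IsProjectiveCover D) (hQ : Q.IsProjectiveCover D) :
    Module.finrank K Q = Module.finrank K P := by
  obtain ⟨f, hf⟩ := hP.exists_surjective hQ
  obtain ⟨g, hg⟩ := hQ.exists_surjective hP
  have : Module.Finite K Q := Module.Finite.of_surjective (toFieldLinear f) hf
  exact le_antisymm (LinearMap.finrank_le_finrank_of_surjective (f := toFieldLinear f) hf)
    (LinearMap.finrank_le_finrank_of_surjective (f := toFieldLinear g) hg)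

end GradedRightModule

namespace CycNilHecke

open GradedRightModule

variable {K : Type u} [Field K] {ℓ n : ℕ}

/-! ### Modules generated by a vector killed by the `y_k` -/

/-- A homogeneous generator of a graded module that is killed by all `y_k`. -/
structure IsSocleGenerator (M : GradedRightModule (piece K ℓ n)) (v : M) (d : ℤ) : Prop where
  mem : v ∈ M.piece d
  ne_zero : v ≠ 0
  y_smul : ∀ k : Fin n, op (y K ℓ k) • v = 0
  exists_smul_eq : ∀ x : M, ∃ a : Alg K ℓ n, op a • v = x

variable (K ℓ n) in
/-- The projection to a homogeneous component of the algebra. -/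
noncomputable def algProj (d : ℤ) : Alg K ℓ n →ₗ[K] Alg K ℓ n := (regular K ℓ n).proj d

theorem algProj_mem (d : ℤ) (a : Alg K ℓ n) : algProj K ℓ n d a ∈ piece K ℓ n d :=
  (regular K ℓ n).proj_mem d a

theorem algProj_of_mem {e : ℤ} (d : ℤ) {a : Alg K ℓ n} (ha : a ∈ piece K ℓ n e) :
    algProj K ℓ n d a = if e = d then a else 0 :=
  proj_of_mem (M := regular K ℓ n) d ha

theorem proj_smul {M : GradedRightModule (piece K ℓ n)} {v : M} {d : ℤ} (hv : v ∈ M.piece d)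
    (j : ℤ) (a : Alg K ℓ n) : M.proj j (op a • v) = op (algProj K ℓ n (j - d) a) • v := by
  have ha : a ∈ ⨆ d, piece K ℓ n d := CycNilHecke.iSup_piece (K := K) ▸ Submodule.mem_top
  induction ha using Submodule.iSup_induction' with
  | zero => rw [map_zero, op_zero, zero_smul, map_zero]
  | add a b _ _ ha hb => rw [op_add, add_smul, map_add, ha, hb, map_add, op_add, add_smul]
  | mem e a ha =>
    rw [algProj_of_mem _ ha, proj_of_mem j (M.op_smul_mem hv ha)]
    by_cases h : d + e = j
    · rw [if_pos h, if_pos (by omega)]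
    · rw [if_neg h, if_neg (by omega), op_zero, zero_smul]

theorem exists_homogeneous_smul_eq {M : GradedRightModule (piece K ℓ n)} {v : M} {d : ℤ}
    (hv : v ∈ M.piece d) {j : ℤ} {a : Alg K ℓ n} (ha : op a • v ∈ M.piece j) :
    ∃ b ∈ piece K ℓ n (j - d), op b • v = op a • v :=
  ⟨algProj K ℓ n (j - d) a, algProj_mem _ _, by rw [← proj_smul hv, proj_eq_self ha]⟩

namespace IsSocleGenerator

variable {M : GradedRightModule (piece K ℓ n)} {v : M} {d : ℤ}

theorem smul_eq_zero_of_mem (hv : IsSocleGenerator M v d)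
    {a : Alg K ℓ n} (ha : a ∈ yIdeal K ℓ n) : op a • v = 0 := by
  induction ha using Submodule.span_induction with
  | mem a ha => obtain ⟨k, rfl⟩ := ha; exact hv.y_smul k
  | zero => rw [op_zero, zero_smul]
  | add a b _ _ ha hb => rw [op_add, add_smul, ha, hb, add_zero]
  | smul c a _ ha => rw [← op_unop c, op_smul_eq_mul, op_mul, mul_smul, ha, smul_zero]

theorem exists_smul_smul_eq (hv : IsSocleGenerator M v d)
    (hn : n ≤ ℓ) {a : Alg K ℓ n} (ha : a ∉ yIdeal K ℓ n) :
    ∃ b : Alg K ℓ n, op b • op a • v = v := by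
  obtain ⟨b, hb⟩ := exists_mul_sub_one_mem_yIdeal hn ha
  have := hv.smul_eq_zero_of_mem hb
  rw [op_sub, sub_smul, sub_eq_zero, op_mul, mul_smul, op_one, one_smul] at this
  exact ⟨b, this⟩

theorem smul_eq_zero_iff (hv : IsSocleGenerator M v d)
    (hn : n ≤ ℓ) {a : Alg K ℓ n} : op a • v = 0 ↔ a ∈ yIdeal K ℓ n := by
  refine ⟨fun h => ?_, hv.smul_eq_zero_of_mem⟩
  by_contra ha
  obtain ⟨b, hb⟩ := hv.exists_smul_smul_eq hn ha
  rw [h, smul_zero] at hb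
  exact hv.ne_zero hb.symm

theorem eq_bot_or_eq_top (hv : IsSocleGenerator M v d)
    (hn : n ≤ ℓ) (N : Submodule (Alg K ℓ n)ᵐᵒᵖ M) : N = ⊥ ∨ N = ⊤ := by
  refine or_iff_not_imp_left.2 fun h => ?_
  obtain ⟨x, hx, hx0⟩ := N.ne_bot_iff.1 h
  obtain ⟨a, rfl⟩ := hv.exists_smul_eq x
  obtain ⟨b, hb⟩ := hv.exists_smul_smul_eq hn fun ha => hx0 (hv.smul_eq_zero_of_mem ha)
  have hvN : v ∈ N := hb ▸ N.smul_mem _ hx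
  rw [eq_top_iff]
  rintro z -
  obtain ⟨c, rfl⟩ := hv.exists_smul_eq z
  exact N.smul_mem _ hvN

theorem isGradedSimple (hv : IsSocleGenerator M v d)
    (hn : n ≤ ℓ) : M.IsGradedSimple :=
  ⟨⟨v, 0, hv.ne_zero⟩, fun N _ => hv.eq_bot_or_eq_top hn N⟩

theorem finrank_eq (hv : IsSocleGenerator M v d)
    (hn : n ≤ ℓ) : Module.finrank K M = n.factorial := by
  let f : Alg K ℓ n →ₗ[K] M :=
    { toFun := fun a => op a • v
      map_add' := fun a b => by rw [op_add, add_smul]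
      map_smul' := fun c a => M.op_smul_smul_assoc c a v }
  have hf : Function.Surjective f := hv.exists_smul_eq
  have hker : LinearMap.ker f = (yIdeal K ℓ n).restrictScalars K := by
    ext a
    exact hv.smul_eq_zero_iff hn
  rw [← finrank_quotient_yIdeal (K := K) hn, ← hker]
  exact (f.quotKerEquivOfSurjective hf).finrank_eq.symm

/-- Both generators have annihilator $Y$, so both modules are $H/Y$. Degrees match because every
homogeneous element is a homogeneous multiple of the generator. -/
theorem isIsomorphic (hv : IsSocleGenerator M v d)
    (hn : n ≤ ℓ) {M' : GradedRightModule (piece K ℓ n)} {v' : M'}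
    (hv' : IsSocleGenerator M' v' d) : M.IsIsomorphic M' := by
  let f := LinearMap.toSpanSingleton (Alg K ℓ n)ᵐᵒᵖ M v
  let f' := LinearMap.toSpanSingleton (Alg K ℓ n)ᵐᵒᵖ M' v'
  have hf : Function.Surjective f := fun x => by
    obtain ⟨a, ha⟩ := hv.exists_smul_eq x
    exact ⟨op a, ha⟩
  have hf' : Function.Surjective f' := fun x => by
    obtain ⟨a, ha⟩ := hv'.exists_smul_eq x
    exact ⟨op a, ha⟩
  have hker : LinearMap.ker f = LinearMap.ker f' := by
    ext a
    exact (hv.smul_eq_zero_iff hn (a := unop a)).trans (hv'.smul_eq_zero_iff hn).symm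
  let e : M ≃ₗ[(Alg K ℓ n)ᵐᵒᵖ] M' := (f.quotKerEquivOfSurjective hf).symm.trans
    ((Submodule.quotEquivOfEq _ _ hker).trans (f'.quotKerEquivOfSurjective hf'))
  have he : ∀ a : Alg K ℓ n, e (op a • v) = op a • v' := by
    intro a
    have h : (f.quotKerEquivOfSurjective hf).symm (op a • v) = Submodule.Quotient.mk (op a) := by
      rw [LinearEquiv.symm_apply_eq]
      rfl
    simp only [e, LinearEquiv.trans_apply, h]
    rfl
  refine ⟨e, fun j x => ⟨fun hx => ?_, fun hx => ?_⟩⟩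
  · obtain ⟨a, rfl⟩ := hv.exists_smul_eq x
    obtain ⟨b, hb, hba⟩ := exists_homogeneous_smul_eq hv.mem hx
    rw [← hba, he]
    have := M'.op_smul_mem hv'.mem hb
    rwa [add_sub_cancel] at this
  · obtain ⟨a, rfl⟩ := hv.exists_smul_eq x
    rw [he] at hx
    obtain ⟨b, hb, hba⟩ := exists_homogeneous_smul_eq hv'.mem hx
    have hab : op b • v = op a • v := e.injective (by rw [he, he, hba])
    rw [← hab]
    have := M.op_smul_mem hv.mem hb
    rwa [add_sub_cancel] at this

theorem shift (hv : IsSocleGenerator M v d) (s : ℤ) :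
    IsSocleGenerator (M.shift s) (show M from v) (d + s) where
  mem := by
    have := hv.mem
    change v ∈ M.piece (d + s - s)
    rwa [add_sub_cancel_right]
  ne_zero := hv.ne_zero
  y_smul := hv.y_smul
  exists_smul_eq := hv.exists_smul_eq

end IsSocleGenerator

/-- Every graded simple module is generated by a vector killed by the `y_k`. -/
theorem exists_isSocleGenerator {M : GradedRightModule (piece K ℓ n)} (hM : M.IsGradedSimple) :
    ∃ (v : M) (d : ℤ), IsSocleGenerator M v d := by
  have h0 : ∃ d, ∃ v ∈ M.piece d, v ≠ 0 := by
    by_contra! h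
    obtain ⟨x, hx⟩ := @exists_ne M hM.1 0
    have hall : ∀ x : M, x = 0 := fun x => by
      induction x using homogeneous_induction with
      | zero => rfl
      | add x z hx hz => rw [hx, hz, add_zero]
      | mem d x hx => exact h d x hx
    exact hx (hall x)
  -- The $y_k$ are killed one at a time: by nilpotency there is a last power of $y_k$ not
  -- annihilating the vector, and the multiple by that power replaces it. Commutativity keeps the
  -- earlier $y$'s acting by zero.
  have h1 : ∀ i ≤ n, ∃ d, ∃ v ∈ M.piece d, v ≠ 0 ∧
      ∀ k : Fin n, k.val < i → op (y K ℓ k) • v = 0 := by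
    intro i hi
    induction i with
    | zero =>
      obtain ⟨d, v, hv, hv0⟩ := h0
      exact ⟨d, v, hv, hv0, fun k hk => by omega⟩
    | succ i ih =>
      obtain ⟨d, v, hv, hv0, hvk⟩ := ih (by omega)
      classical
      let k₀ : Fin n := ⟨i, by omega⟩
      have hex : ∃ p, op (y K ℓ k₀ ^ p) • v = 0 := ⟨ℓ, by rw [y_pow_eq_zero, op_zero, zero_smul]⟩
      obtain ⟨p, hp⟩ : ∃ p, Nat.find hex = p + 1 := by
        refine Nat.exists_eq_succ_of_ne_zero fun h => hv0 ?_
        have := Nat.find_spec hex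
        rwa [h, pow_zero, op_one, one_smul] at this
      refine ⟨_, op (y K ℓ k₀ ^ p) • v, M.op_smul_mem hv
        (pow_mem_piece_mul (gen_mem_piece (Sum.inr k₀)) p), Nat.find_min hex (by omega), ?_⟩
      intro k hk
      by_cases hki : k.val < i
      · rw [← mul_smul, ← op_mul, ((y_commute k₀ k).pow_left p).eq, op_mul, mul_smul, hvk k hki,
          smul_zero]
      · obtain rfl : k = k₀ := Fin.ext (by simp only [k₀]; omega)
        rw [← mul_smul, ← op_mul, ← pow_succ, ← hp]
        exact Nat.find_spec hex
  obtain ⟨d, v, hv, hv0, hvk⟩ := h1 n le_rfl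
  refine ⟨v, d, hv, hv0, fun k => hvk k k.2, fun x => ?_⟩
  have htop : Submodule.span (Alg K ℓ n)ᵐᵒᵖ {v} = ⊤ :=
    (hM.2 _ (span_isHomogeneous hv)).resolve_left fun h =>
      hv0 (Submodule.span_singleton_eq_bot.1 h)
  obtain ⟨a, ha⟩ := Submodule.mem_span_singleton.1 (htop ▸ Submodule.mem_top : x ∈ _)
  exact ⟨unop a, ha⟩

end CycNilHecke

namespace CycNilHecke

open GradedRightModule MvPolynomial

variable {K : Type u} [Field K] {ℓ n : ℕ}

/-! ### Specht modules -/

theorem ev_monomial_mem_piece (b : Fin n →₀ ℕ) :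
    ev K ℓ n (monomial b 1) ∈ piece K ℓ n (2 * ∑ i, (b i : ℤ)) := by
  induction b using Finsupp.induction_linear with
  | zero => simpa using one_mem_piece
  | add b c hb hc =>
    have := mul_mem_piece hb hc
    rw [← map_mul, monomial_one_mul, ← mul_add, ← Finset.sum_add_distrib] at this
    simpa using this
  | single i k =>
    rw [← X_pow_eq_monomial, map_pow, ev_X]
    have := pow_mem_piece_mul (gen_mem_piece (K := K) (ℓ := ℓ) (Sum.inr i)) k
    convert this using 2
    · rw [Finset.sum_eq_single i (fun j _ hj => by simp [hj.symm]) (by simp)]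
      simp [genDeg, mul_comm]
    · rfl

variable (K) in
/-- The generator of the Specht module. -/
noncomputable def spechtGen (μ : Multipartition ℓ n) : specht K μ :=
  (⟨residue K μ (yElt K μ), Submodule.mem_span_singleton_self _⟩ :
    Submodule.span (Alg K ℓ n)ᵐᵒᵖ {residue K μ (yElt K μ)})

theorem spechtIncl_smul_spechtGen (μ : Multipartition ℓ n) (a : Alg K ℓ n) :
    spechtIncl K μ (op a • spechtGen K μ) = residue K μ (yElt K μ * a) := by
  rw [map_smul, ← op_smul_eq_mul, map_smul]
  rfl

theorem spechtIncl_injective (μ : Multipartition ℓ n) : Function.Injective (spechtIncl K μ) :=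
  Subtype.val_injective

theorem smul_spechtGen_eq_zero_iff (μ : Multipartition ℓ n) {a : Alg K ℓ n} :
    op a • spechtGen K μ = 0 ↔ yElt K μ * a ∈ cellIdeal K μ := by
  rw [← residue_eq_zero, ← spechtIncl_smul_spechtGen, ← (spechtIncl_injective μ).eq_iff, map_zero]

/-- The degree of the generator of the Specht module. -/
def spechtDeg (μ : Multipartition ℓ n) : ℤ := (n : ℤ) * ℓ - ∑ i, (theta μ i : ℤ)

theorem spechtGen_isSocleGenerator (μ : Multipartition ℓ n) :
    IsSocleGenerator (specht K μ) (spechtGen K μ) (spechtDeg μ) where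
  mem := by
    -- In the quotient the class of $y_\mu$ has degree twice `spechtDeg μ`; the shift built into
    -- `specht` removes one copy.
    change residue K μ (yElt K μ) ∈ (cellQuot K μ).piece _
    refine residue_mem_piece ?_
    rw [yElt_eq_ev]
    convert ev_monomial_mem_piece (K := K) (ℓ := ℓ) (yExp μ) using 2
    have : ∀ i, ((yExp μ i : ℕ) : ℤ) = ℓ - theta μ i := fun i => by
      rw [yExp_apply, Nat.cast_sub (theta_le μ i)]
    simp only [this, Finset.sum_sub_distrib, spechtDeg, Finset.sum_const, Finset.card_univ,
      Fintype.card_fin, nsmul_eq_mul]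
    ring
  ne_zero h := by
    refine yElt_notMem_cellIdeal (K := K) μ ?_
    rw [← mul_one (yElt K μ), ← smul_spechtGen_eq_zero_iff, op_one, one_smul, h]
  y_smul k := (smul_spechtGen_eq_zero_iff μ).2 (yElt_mul_y_mem_cellIdeal μ k)
  exists_smul_eq := by
    rintro ⟨x, hx⟩
    obtain ⟨a, rfl⟩ := Submodule.mem_span_singleton.1 hx
    exact ⟨unop a, rfl⟩

theorem theta_lamMin (hn : n ≤ ℓ) (i : Fin n) : theta (lamMin n hn) i = ℓ - n + i + 1 := by
  have h := Finset.orderEmbOfFin_unique (s := (lamMin n hn).1) (lamMin n hn).2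
    (f := fun i => (⟨ℓ - n + i.val, by omega⟩ : Fin ℓ))
    (fun x => by simp only [lamMin, Finset.mem_filter, Finset.mem_univ, true_and]; omega) (fun i j hij => by
      have := Fin.lt_def.1 hij
      simp only [Fin.mk_lt_mk]
      omega)
  simp only [theta, ← h]

theorem yElt_lamMin (hn : n ≤ ℓ) : yElt K (lamMin n hn) = yStair K ℓ n := by
  rw [yElt_eq_ev, yStair]
  refine congrArg (fun b => ev K ℓ n (monomial b (1 : K))) ?_
  ext i
  rw [yExp_apply, theta_lamMin, stair_apply]
  omega

theorem spechtDeg_lamMin (hn : n ≤ ℓ) : spechtDeg (lamMin n hn) = (n * (n - 1) / 2 : ℕ) := by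
  have h1 := Finset.sum_range_id_mul_two n
  have h2 : ∑ i, (theta (lamMin n hn) i : ℤ) =
      n * ((ℓ : ℤ) - n + 1) + ((∑ i ∈ Finset.range n, i : ℕ) : ℤ) := by
    rw [Finset.sum_range, Nat.cast_sum]
    have : ∀ i : Fin n, (theta (lamMin n hn) i : ℤ) = ((ℓ : ℤ) - n + 1) + (i.val : ℤ) := by
      intro i
      rw [theta_lamMin]
      push_cast [hn]
      ring
    simp only [this, Finset.sum_add_distrib, Finset.sum_const, Finset.card_univ, Fintype.card_fin,
      nsmul_eq_mul]
    ring
  rw [spechtDeg, h2, ← Finset.sum_range_id]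
  have h3 : ((∑ i ∈ Finset.range n, i : ℕ) : ℤ) * 2 = n * (n - 1) := by
    rw [show (2 : ℤ) = ((2 : ℕ) : ℤ) from rfl, ← Nat.cast_mul, h1]
    cases n with
    | zero => simp
    | succ n => push_cast; simp
  linarith

/-- Pair the generator with its multiple by $\psi_{w_0}^*$. As $y_{\lambda_{\min}}$ is the staircase
monomial, the product is $y_{\lambda_{\min}}\psi_{w_0}y_{\lambda_{\min}}=\pm e\,y_{\lambda_{\min}}$,
which lies outside the ideal. -/
theorem spechtGen_notMem_formRadical (hn : n ≤ ℓ) :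
    spechtGen K (lamMin n hn) ∉ formRadical K (lamMin n hn) := by
  intro h
  have h1 := h (op (inv (psiLongest K ℓ n)) • spechtGen K (lamMin n hn)) (yElt K (lamMin n hn))
    (yElt K (lamMin n hn) * inv (psiLongest K ℓ n)) rfl (spechtIncl_smul_spechtGen _ _).symm
  obtain ⟨e, ⟨c, hc⟩, -, -, he, -⟩ := exists_idempotent (K := K) (ℓ := ℓ) (n := n)
  rw [zero_smul, sub_zero, inv_mul, inv_inv, inv_yElt, ← mul_assoc, yElt_lamMin, hc,
    ← yElt_lamMin hn] at h1
  refine mul_yElt_notMem_cellIdeal (lamMin n hn) he ?_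
  rcases Int.units_eq_one_or c with hc | hc
  · simpa [hc] using h1
  · simpa [hc] using h1

variable (K) in
/-- The generator of `D_0`. -/
noncomputable def d0Gen (hn : n ≤ ℓ) : D0 K hn :=
  (formRadical K (lamMin n hn)).mkQ (spechtGen K (lamMin n hn))

theorem d0Gen_isSocleGenerator (hn : n ≤ ℓ) :
    IsSocleGenerator (D0 K hn) (d0Gen K hn) (spechtDeg (lamMin n hn)) where
  mem := ⟨_, (spechtGen_isSocleGenerator _).mem, rfl⟩
  ne_zero h := spechtGen_notMem_formRadical hn ((Submodule.Quotient.mk_eq_zero _).1 h)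
  y_smul k := by
    change (formRadical K (lamMin n hn)).mkQ (op (y K ℓ k) • spechtGen K (lamMin n hn)) = 0
    rw [(spechtGen_isSocleGenerator _).y_smul, map_zero]
  exists_smul_eq x := by
    obtain ⟨z, rfl⟩ := (formRadical K (lamMin n hn)).mkQ_surjective x
    obtain ⟨a, rfl⟩ := (spechtGen_isSocleGenerator _).exists_smul_eq z
    exact ⟨a, rfl⟩

/-! ### The projective module generated by an idempotent -/

section Idempotent

/-- A homogeneous idempotent killed by the `ψ_r` and congruent to `1` modulo `psiIdeal`. -/
structure IsPsiIdempotent (e : Alg K ℓ n) : Prop where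
  mem : e ∈ piece K ℓ n 0
  mul_psi : ∀ r, e * psi K ℓ r = 0
  one_sub_mem : 1 - e ∈ psiIdeal K ℓ n
  mul_self : e * e = e

variable {e : Alg K ℓ n}

/-- The right ideal generated by `e`, shifted by `s`. -/
noncomputable def idempotentModule (he : e ∈ piece K ℓ n 0) (s : ℤ) :
    GradedRightModule (piece K ℓ n) :=
  ((regular K ℓ n).sub (Submodule.span (Alg K ℓ n)ᵐᵒᵖ {e})
    (span_isHomogeneous (M := regular K ℓ n) he)).shift s

/-- The inclusion of the right ideal generated by `e`. -/
noncomputable def idempotentIncl (he : e ∈ piece K ℓ n 0) (s : ℤ) :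
    idempotentModule he s →ₗ[(Alg K ℓ n)ᵐᵒᵖ] Alg K ℓ n :=
  (Submodule.span (Alg K ℓ n)ᵐᵒᵖ {e}).subtype

/-- The element `e * a` of the right ideal generated by `e`. -/
noncomputable def idempotentMk (he : e ∈ piece K ℓ n 0) (s : ℤ) (a : Alg K ℓ n) :
    idempotentModule he s :=
  (⟨e * a, Submodule.smul_mem _ (op a) (Submodule.mem_span_singleton_self e)⟩ :
    Submodule.span (Alg K ℓ n)ᵐᵒᵖ {e})

theorem idempotentIncl_mk (he : e ∈ piece K ℓ n 0) (s : ℤ) (a : Alg K ℓ n) :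
    idempotentIncl he s (idempotentMk he s a) = e * a := rfl

theorem idempotentIncl_injective (he : e ∈ piece K ℓ n 0) (s : ℤ) :
    Function.Injective (idempotentIncl he s) := Subtype.val_injective

theorem exists_idempotentMk_eq (he : e ∈ piece K ℓ n 0) (s : ℤ) (x : idempotentModule he s) :
    ∃ a, idempotentMk he s a = x := by
  obtain ⟨x, hx⟩ := x
  obtain ⟨a, rfl⟩ := Submodule.mem_span_singleton.1 hx
  exact ⟨unop a, rfl⟩

theorem mem_piece_idempotentModule (he : e ∈ piece K ℓ n 0) {s d : ℤ}
    {x : idempotentModule he s} :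
    x ∈ (idempotentModule he s).piece d ↔ idempotentIncl he s x ∈ piece K ℓ n (d - s) := Iff.rfl

theorem idempotentMk_one_mem (he : e ∈ piece K ℓ n 0) (s : ℤ) :
    idempotentMk he s 1 ∈ (idempotentModule he s).piece s := by
  rw [mem_piece_idempotentModule, idempotentIncl_mk, mul_one, sub_self]
  exact he

theorem IsPsiIdempotent.smul_mk_one (he : IsPsiIdempotent e) (s : ℤ)
    (x : idempotentModule he.mem s) :
    op (idempotentIncl he.mem s x) • idempotentMk he.mem s 1 = x := by
  obtain ⟨a, rfl⟩ := exists_idempotentMk_eq he.mem s x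
  refine idempotentIncl_injective he.mem s ?_
  rw [map_smul, idempotentIncl_mk, idempotentIncl_mk, op_smul_eq_mul, mul_one, ← mul_assoc,
    he.mul_self]

/-- The homomorphism from the algebra given by the action on an element. -/
noncomputable def actionMap (M : GradedRightModule (piece K ℓ n)) (m : M) :
    Alg K ℓ n →ₗ[(Alg K ℓ n)ᵐᵒᵖ] M where
  toFun a := op a • m
  map_add' a b := by rw [op_add, add_smul]
  map_smul' c a := by
    rw [RingHom.id_apply, ← mul_smul, ← op_unop c, op_smul_eq_mul, op_mul]

theorem actionMap_isGradedHom (he : e ∈ piece K ℓ n 0) {s : ℤ}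
    {M : GradedRightModule (piece K ℓ n)} {m : M} (hm : m ∈ M.piece s) :
    IsGradedHom (M := idempotentModule he s) (actionMap M m ∘ₗ idempotentIncl he s) := by
  intro d x hx
  have := M.op_smul_mem hm hx
  rwa [add_sub_cancel] at this

/-- A map out of $eH$ is determined by the image of $e$. If $m$ is a homogeneous lift of that image,
$x\mapsto m\cdot x$ lifts the map, because $ex=x$ on $eH$. -/
theorem IsPsiIdempotent.isGradedProjective (he : IsPsiIdempotent e) (s : ℤ) :
    (idempotentModule he.mem s).IsGradedProjective := by
  intro M N g f hg hgs hf
  obtain ⟨m, hm, hmx⟩ := hg.exists_preimage hgs (hf s _ (idempotentMk_one_mem he.mem s))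
  refine ⟨actionMap M m ∘ₗ idempotentIncl he.mem s, actionMap_isGradedHom he.mem hm, ?_⟩
  refine LinearMap.ext fun x => ?_
  change g (op (idempotentIncl he.mem s x) • m) = f x
  rw [map_smul, hmx, ← map_smul, he.smul_mk_one]

/-- Since $e\psi_r=0$, one has $ef\psi_r=e\,\partial_rf$, so $e\,K[y]$ is closed under right
multiplication by the generators. -/
theorem IsPsiIdempotent.exists_mul_ev_eq (he : IsPsiIdempotent e) (a : Alg K ℓ n) :
    ∃ f, e * ev K ℓ n f = e * a := by
  induction a using alg_induction with
  | one => exact ⟨1, by rw [map_one]⟩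
  | add a b ha hb =>
    obtain ⟨f, hf⟩ := ha
    obtain ⟨g, hg⟩ := hb
    exact ⟨f + g, by rw [map_add, mul_add, mul_add, hf, hg]⟩
  | smul c a ha =>
    obtain ⟨f, hf⟩ := ha
    exact ⟨c • f, by rw [map_smul, mul_smul_comm, mul_smul_comm, hf]⟩
  | psi a r ha =>
    obtain ⟨f, hf⟩ := ha
    refine ⟨simpleDemazure r f, ?_⟩
    rw [← mul_assoc, ← hf, mul_assoc, ev_mul_psi, mul_add, ← mul_assoc, he.mul_psi, zero_mul,
      zero_add]
  | y a k ha =>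
    obtain ⟨f, hf⟩ := ha
    exact ⟨f * X k, by rw [map_mul, ev_X, ← mul_assoc, hf, mul_assoc]⟩

/-- The $y_k$ have positive degree, so in $eH=e\,K[y]$ only constants contribute to degree zero. -/
theorem IsPsiIdempotent.exists_algProj_eq (he : IsPsiIdempotent e) (a : Alg K ℓ n) :
    ∃ c : K, algProj K ℓ n 0 (e * a) = c • e := by
  obtain ⟨f, hf⟩ := he.exists_mul_ev_eq a
  rw [← hf]
  clear hf
  induction f using MvPolynomial.induction_on' with
  | monomial b c =>
    have h := mul_mem_piece he.mem (ev_monomial_mem_piece (K := K) (ℓ := ℓ) b)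
    have hm : monomial b c = c • monomial b (1 : K) := by rw [smul_monomial, smul_eq_mul, mul_one]
    rw [hm, map_smul, mul_smul_comm, map_smul, algProj_of_mem 0 h]
    split_ifs with hb
    · have hb0 : b = 0 := by
        have h0 : ∑ i, (b i : ℤ) = 0 := by omega
        rw [Finset.sum_eq_zero_iff_of_nonneg fun i _ => by positivity] at h0
        ext i
        exact_mod_cast h0 i (Finset.mem_univ i)
      refine ⟨c, ?_⟩
      rw [hb0, show monomial (0 : Fin n →₀ ℕ) (1 : K) = 1 from rfl, map_one, mul_one]
    · exact ⟨0, by rw [smul_zero, zero_smul]⟩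
  | add p q hp hq =>
    obtain ⟨c, hc⟩ := hp
    obtain ⟨d, hd⟩ := hq
    exact ⟨c + d, by rw [map_add, mul_add, map_add, hc, hd, add_smul]⟩

theorem IsPsiIdempotent.exists_eq_smul (he : IsPsiIdempotent e) {s : ℤ}
    {x : idempotentModule he.mem s} (hx : x ∈ (idempotentModule he.mem s).piece s) :
    ∃ c : K, x = c • idempotentMk he.mem s 1 := by
  obtain ⟨a, rfl⟩ := exists_idempotentMk_eq he.mem s x
  rw [mem_piece_idempotentModule, idempotentIncl_mk, sub_self] at hx
  obtain ⟨c, hc⟩ := he.exists_algProj_eq a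
  rw [algProj_of_mem 0 hx, if_pos rfl] at hc
  refine ⟨c, idempotentIncl_injective he.mem s ?_⟩
  have : idempotentIncl he.mem s (c • idempotentMk he.mem s 1) = c • (e * 1) := rfl
  rw [this, idempotentIncl_mk, hc, mul_one]

theorem IsPsiIdempotent.longest_mul (he : IsPsiIdempotent e) :
    psiLongest K ℓ n * e = psiLongest K ℓ n := by
  have h : ∀ x ∈ psiIdeal K ℓ n, psiLongest K ℓ n * x = 0 := by
    intro x hx
    induction hx using Submodule.span_induction with
    | mem x hx => obtain ⟨r, rfl⟩ := hx; exact psiLongest_mul_psi r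
    | zero => exact mul_zero _
    | add x z _ _ hx hz => rw [mul_add, hx, hz, add_zero]
    | smul a x _ hx => rw [← op_unop a, op_smul_eq_mul, ← mul_assoc, hx, zero_mul]
  have := h _ he.one_sub_mem
  rw [mul_sub, mul_one, sub_eq_zero] at this
  exact this.symm

/-- The vector $u=v\psi_{w_0}$ is nonzero and satisfies $ue=u$, so $e\mapsto u$ defines a map onto
the simple module. The component of $eH$ containing $e$ is the line $Ke$, on which the map is
injective; a homogeneous submodule that together with the kernel spans $eH$ must therefore contain
$e$. -/
theorem IsPsiIdempotent.isProjectiveCover (he : IsPsiIdempotent e) (hn : n ≤ ℓ)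
    {M : GradedRightModule (piece K ℓ n)} {v : M} {d : ℤ} (hv : IsSocleGenerator M v d) :
    ∃ s, (idempotentModule he.mem s).IsProjectiveCover M := by
  obtain ⟨s, hs⟩ : ∃ s, op (psiLongest K ℓ n) • v ∈ M.piece s :=
    ⟨_, M.op_smul_mem hv.mem (longest_mem_piece 0 (n - 1))⟩
  set u := op (psiLongest K ℓ n) • v with hu
  have hu0 : u ≠ 0 := fun h => psiLongest_notMem_yIdeal hn ((hv.smul_eq_zero_iff hn).1 h)
  set f := actionMap M u ∘ₗ idempotentIncl he.mem s with hf
  have hf1 : f (idempotentMk he.mem s 1) = u := by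
    change op (e * 1) • u = u
    rw [mul_one, hu, ← mul_smul, ← op_mul, he.longest_mul]
  refine ⟨s, he.isGradedProjective s, f, actionMap_isGradedHom he.mem hs, ?_, ?_⟩
  · rw [← LinearMap.range_eq_top]
    refine (hv.eq_bot_or_eq_top hn _).resolve_left fun h => hu0 ?_
    rw [← hf1, ← Submodule.mem_bot (Alg K ℓ n)ᵐᵒᵖ, ← h]
    exact ⟨_, rfl⟩
  · intro N hN hsup
    obtain ⟨a, ha, b, hb, hab⟩ := Submodule.mem_sup.1
      (hsup ▸ Submodule.mem_top : idempotentMk he.mem s 1 ∈ N ⊔ LinearMap.ker f)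
    have h1 := congrArg ((idempotentModule he.mem s).proj s) hab
    rw [map_add, proj_eq_self (idempotentMk_one_mem he.mem s)] at h1
    obtain ⟨c, hc⟩ := he.exists_eq_smul ((idempotentModule he.mem s).proj_mem s b)
    have h2 : f ((idempotentModule he.mem s).proj s b) = 0 := by
      rw [(actionMap_isGradedHom he.mem hs).map_proj, LinearMap.mem_ker.1 hb, map_zero]
    have h3 : c • u = 0 := by
      rw [← h2, hc, ← hf1]
      exact (map_smul (toFieldLinear f) c _).symm
    rw [hc, (smul_eq_zero.1 h3).resolve_right hu0, zero_smul, add_zero] at h1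
    have h4 : idempotentMk he.mem s 1 ∈ N := h1 ▸ hN.proj_mem s ha
    rw [eq_top_iff]
    rintro x -
    rw [← he.smul_mk_one s x]
    exact N.smul_mem _ h4

/-- The polynomials annihilating `e`. -/
noncomputable def annIdeal (e : Alg K ℓ n) : Ideal (MvPolynomial (Fin n) K) where
  carrier := {f | e * ev K ℓ n f = 0}
  add_mem' ha hb := by
    rw [Set.mem_ofPred_eq] at ha hb ⊢
    rw [map_add, mul_add, ha, hb, add_zero]
  zero_mem' := by rw [Set.mem_ofPred_eq, map_zero, mul_zero]
  smul_mem' c f hf := by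
    rw [Set.mem_ofPred_eq] at hf ⊢
    rw [smul_eq_mul, mul_comm, map_mul, ← mul_assoc, hf, zero_mul]

theorem mem_annIdeal {f : MvPolynomial (Fin n) K} : f ∈ annIdeal e ↔ e * ev K ℓ n f = 0 := Iff.rfl

theorem IsPsiIdempotent.annIdeal_isDemazureStable (he : IsPsiIdempotent e) :
    IsDemazureStable (annIdeal e) := by
  intro r f hf
  rw [mem_annIdeal] at hf ⊢
  have h := congrArg (e * ·) (ev_mul_psi (ℓ := ℓ) f r)
  simp only [mul_add, ← mul_assoc, hf, he.mul_psi, zero_mul, zero_add] at h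
  exact h.symm

/-- The $\ell$-staircase is the exponent of $y_\lambda$ for $\theta(\lambda)=(1,\dots,n)$, and
$e\,y_\lambda$ is not even in the ideal above $\lambda$. -/
theorem IsPsiIdempotent.stair_notMem_annIdeal (he : IsPsiIdempotent e) (hn : n ≤ ℓ) :
    monomial (stair ℓ n) 1 ∉ annIdeal e := by
  obtain ⟨lam, hlam⟩ := exists_theta_eq (ℓ := ℓ) (b := fun i : Fin n => ℓ - 1 - i.val)
    (fun i j h => by
      have := Fin.lt_def.1 h
      simp only
      omega) (fun i => by omega)
  have hexp : yExp lam = stair ℓ n := by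
    ext i
    rw [yExp_apply, hlam, stair_apply]
    omega
  intro h
  refine mul_yElt_notMem_cellIdeal lam he.one_sub_mem ?_
  rw [yElt_eq_ev, hexp, mem_annIdeal.1 h]
  exact zero_mem _

/-- The map $f\mapsto ef$ identifies the polynomial ring modulo `annIdeal e` with $eH$, and the
staircase count applies with $m=\ell$. -/
theorem IsPsiIdempotent.finrank_idempotentModule (he : IsPsiIdempotent e) (hn : n ≤ ℓ) (s : ℤ) :
    Module.finrank K (idempotentModule he.mem s) = ℓ.descFactorial n := by
  rw [← finrank_quotient_staircase (completeHomog_mem_of_stable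
    (fun a b hab h _ hf =>
      IsDemazureStable.demazure_mem (hst := he.annIdeal_isDemazureStable) a b hab h hf)
    (fun k _ => by rw [mem_annIdeal, map_pow, ev_X, y_pow_eq_zero, mul_zero]) hn) hn
    (he.stair_notMem_annIdeal hn)]
  let g : MvPolynomial (Fin n) K →ₗ[K] idempotentModule he.mem s :=
    { toFun := fun f => idempotentMk he.mem s (ev K ℓ n f)
      map_add' := fun f f' => idempotentIncl_injective he.mem s (by
        rw [map_add, map_add, idempotentIncl_mk, idempotentIncl_mk, idempotentIncl_mk, mul_add])
      map_smul' := fun c f => idempotentIncl_injective he.mem s (by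
        change e * ev K ℓ n (c • f) = c • (e * ev K ℓ n f)
        rw [map_smul, mul_smul_comm]) }
  have hg : Function.Surjective g := by
    intro x
    obtain ⟨a, rfl⟩ := exists_idempotentMk_eq he.mem s x
    obtain ⟨f, hf⟩ := he.exists_mul_ev_eq a
    exact ⟨f, idempotentIncl_injective he.mem s hf⟩
  have hker : LinearMap.ker g = (annIdeal e).restrictScalars K := by
    ext f
    exact (idempotentIncl_injective he.mem s).eq_iff' (map_zero _) |>.symm.trans Iff.rfl
  rw [← (Submodule.Quotient.restrictScalarsEquiv K (annIdeal e)).finrank_eq, ← hker]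
  exact (g.quotKerEquivOfSurjective hg).finrank_eq.symm

end Idempotent

end CycNilHecke

/-! ### Assembly of the main theorem -/

open CycNilHecke GradedRightModule in
theorem mainTheorem10 {K : Type u} [Field K] {ℓ n : ℕ} (hn : n ≤ ℓ) :
    (CycNilHecke.D0 K hn).IsGradedSimple ∧
    (∀ M : GradedRightModule (CycNilHecke.piece K ℓ n), M.IsGradedSimple →
      ∃ s : ℤ, M.IsIsomorphic ((CycNilHecke.D0 K hn).shift s)) ∧
    Module.finrank K (CycNilHecke.D0 K hn) = n.factorial ∧
    (∃ P₀ : GradedRightModule (CycNilHecke.piece K ℓ n),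
      P₀.IsProjectiveCover (CycNilHecke.D0 K hn)) ∧
    (∀ P₀ : GradedRightModule (CycNilHecke.piece K ℓ n),
      P₀.IsProjectiveCover (CycNilHecke.D0 K hn) →
        Module.finrank K P₀ = ℓ.choose n * n.factorial) ∧
    (∀ μ : CycNilHecke.Multipartition ℓ n,
      (CycNilHecke.specht K μ).IsIsomorphic
        ((CycNilHecke.D0 K hn).shift
          ((n : ℤ) * ℓ - (n * (n - 1) / 2 : ℕ) - ∑ i, (CycNilHecke.theta μ i : ℤ)))) := by
  have hD := d0Gen_isSocleGenerator (K := K) hn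
  obtain ⟨e, -, h1, h2, h3, h4⟩ := exists_idempotent (K := K) (ℓ := ℓ) (n := n)
  have he : IsPsiIdempotent e := ⟨h1, h2, h3, h4⟩
  obtain ⟨s, hs⟩ := he.isProjectiveCover hn hD
  refine ⟨hD.isGradedSimple hn, fun M hM => ?_, hD.finrank_eq hn, ⟨_, hs⟩, fun P hP => ?_,
    fun μ => ?_⟩
  · obtain ⟨v, d, hv⟩ := exists_isSocleGenerator hM
    refine ⟨d - spechtDeg (lamMin n hn), hv.isIsomorphic hn
      (v' := (show ((D0 K hn).shift _ : Type u) from d0Gen K hn)) ?_⟩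
    have := hD.shift (d - spechtDeg (lamMin n hn))
    rwa [add_sub_cancel] at this
  · have hfr := he.finrank_idempotentModule hn s
    -- Two covers map onto each other, so finite dimension of this one fixes the dimension of every
    -- other.
    have : Module.Finite K (idempotentModule he.mem s) := Module.finite_of_finrank_pos (by
      rw [hfr]
      exact Nat.descFactorial_pos.2 hn)
    rw [hs.finrank_eq hP, hfr, Nat.descFactorial_eq_factorial_mul_choose, mul_comm]
  · refine (spechtGen_isSocleGenerator μ).isIsomorphic hn
      (v' := (show ((D0 K hn).shift _ : Type u) from d0Gen K hn)) ?_
    have := hD.shift ((n : ℤ) * ℓ - (n * (n - 1) / 2 : ℕ) - ∑ i, (theta μ i : ℤ))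
    convert this using 1
    rw [spechtDeg_lamMin, spechtDeg]
    ring
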